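/- **Setting.** There are $K\ge 1$ arms $[K]$. An oblivious adversary fixes in advance a sequence of laws on $[0,1]^K$; the reward vectors $(Y_t(a))_{a\in[K]}$, $t\ge 1$, are independent with these laws, and $\mu_t(a)=\mathbb{E}\,Y_t(a)$. A (randomized) policy $\pi$ selects an arm $\pi_t$ at each round $t$ and observes $Y_t(\pi_t)$ only. Its dynamic regret is $R(\pi,T)=\sum_{t=1}^T\max_{a}\mu_t(a)-\mathbb{E}\big[\sum_{t=1}^T\mu_t(\pi_t)\big]$. Let $\delta_t(a)=\max_{a'}(\mu_t(a')-\mu_t(a))$. Arm $a$ has significant regret on $[s_1,s_2]$ if $\sum_{t=s_1}^{s_2}\delta_t(a)\ge\sqrt{K(s_2-s_1)}$. Put $\tau_0=1$ and, recursively, let $\tau_{i+1}$ be the earliest round $\tau\in(\tau_i,T]$ such that every arm has significant regret on some $[s_1,s_2]\subseteq[\tau_i,\tau]$ with $s_1<s_2$; $\tilde L=\tilde L(T)$ is the number of these significant shifts $\tau_1,\tau_2,\dots$ by round $T$. Let $V=V(T)=\sum_{t=2}^T\max_a|\mu_t(a)-\mu_{t-1}(a)|$. **META with horizon $T_0$**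 (and a constant $C_0>0$) plays rounds $1,\dots,T_0$ in episodes. An episode starting at round $t_\ell$ sets $\mathcal A_{\rm master}=[K]$, draws independent $B_{s,m}\sim\mathrm{Bernoulli}\big(1/\sqrt{m(s-t_\ell)}\big)$ for $s=t_\ell+1,\dots,T_0$ and $m=2,4,\dots,2^{\lceil\log_2T_0\rceil}$, and runs Base-Alg$(t_\ell,T_0+1-t_\ell)$; when that run returns and rounds remain, a new episode starts. Base-Alg$(t_{\rm start},m_0)$ starts with its own candidate set $\mathcal A=[K]$ and, while $t\le T_0$, repeats: play an arm drawn uniformly from $\mathcal A$ (write $\mathcal A_t$ for the set used at round $t$); increase $t$ by one; if some $B_{t,m}=1$, run Base-Alg$(t,m)$ for the largest such $m$, and continue here when it returns; if $t>t_{\rm start}+m_0$, return; remove from $\mathcal A_{\rm master}$ (respectively $\mathcal A$) all arms $a$ for which there are rounds $s_1<s_2$ with $[s_1,s_2]\subseteq[t_\ell,t)$ (respectively $[t_{\rm start},t)$) and $$\max_{a'\in[K]}\sum_{r=s_1}^{s_2}|\mathcal A_r|\big(Y_r(a')\mathbf 1\{\pi_r=a'\}-Y_r(a)\mathbf 1\{\pi_r=a\}\big)>\log(T_0)\sqrt{C_0\,\big(K(s_2-s_1)\vee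 K^2\big)};$$ if $\mathcal A_{\rm master}=\emptyset$, return. The **doubling-horizon version of META** runs, for $n=0,1,2,\dots$, a fresh independent copy of META with horizon $2^n$ on the rounds $2^n,\dots,2^{n+1}-1$; it does not depend on $T$. **Proposition.** There are constants $c>0$ and $p\in\mathbb N$ such that for every $C_0\ge c$ there is a $C>0$ (depending on $C_0$ only) for which the doubling-horizon version $\pi$ of META with constant $C_0$ satisfies, for every $K\ge1$, every environment as above and every $T\ge1$, $$R(\pi,T)\le C\,(1+\log T)^p\,\min\Big\{\sqrt{(\tilde L+1)KT},\ \sqrt{KT}+(KV)^{1/3}T^{2/3}\Big\}.$$ -/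

import Mathlib

open MeasureTheory ProbabilityTheory

noncomputable section

namespace Bandit

/-! ### The bandit environment

There are `K` arms `Fin K` and rounds `t = 1, 2, …`.  An oblivious adversary fixes the sequence
`ν t` of laws of the reward vectors `Y_t = (Y_t(a))_a`; the vectors of different rounds are
independent. -/

/-- The mean reward `μ_t(a)` of arm `a` at round `t`. -/
def mean {K : ℕ} (ν : ℕ → Measure (Fin K → ℝ)) (t : ℕ) (a : Fin K) : ℝ :=
  ∫ y, y a ∂(ν t)

/-- The worst gap `δ_t(a) = max_{a'} (μ_t(a') - μ_t(a))`. -/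
def gap {K : ℕ} (μ : ℕ → Fin K → ℝ) (t : ℕ) (a : Fin K) : ℝ :=
  ⨆ a' : Fin K, (μ t a' - μ t a)

/-- Arm `a` incurs significant regret on the interval of rounds `[s₁, s₂]`. -/
def SignificantRegret {K : ℕ} (μ : ℕ → Fin K → ℝ) (a : Fin K) (s₁ s₂ : ℕ) : Prop :=
  √((K : ℝ) * ((s₂ : ℝ) - (s₁ : ℝ))) ≤ ∑ t ∈ Finset.Icc s₁ s₂, gap μ t a

/-- The significant shift times `τ_i` by round `T`: `τ_0 = 1`, and `τ_{i+1}` is the earliest round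
`τ ∈ (τ_i, T]` such that every arm incurs significant regret on some `[s₁, s₂] ⊆ [τ_i, τ]` with
`s₁ < s₂`.  The value is `⊤` if there is no such round. -/
def shiftTime {K : ℕ} (μ : ℕ → Fin K → ℝ) (T : ℕ) : ℕ → ℕ∞
  | 0 => 1
  | i + 1 => sInf {τ : ℕ∞ | shiftTime μ T i < τ ∧ τ ≤ (T : ℕ∞) ∧
      ∀ a : Fin K, ∃ s₁ s₂ : ℕ, s₁ < s₂ ∧ shiftTime μ T i ≤ (s₁ : ℕ∞) ∧ (s₂ : ℕ∞) ≤ τ ∧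
        SignificantRegret μ a s₁ s₂}

/-- The number `L̃` of significant shifts by round `T`. -/
def numShifts {K : ℕ} (μ : ℕ → Fin K → ℝ) (T : ℕ) : ℕ :=
  Set.ncard {i : ℕ | shiftTime μ T (i + 1) ≤ (T : ℕ∞)}

/-- The total variation `V = ∑_{t=2}^T max_a |μ_t(a) - μ_{t-1}(a)|`. -/
def totalVariation {K : ℕ} (μ : ℕ → Fin K → ℝ) (T : ℕ) : ℝ :=
  ∑ t ∈ Finset.Icc 2 T, ⨆ a : Fin K, |μ t a - μ (t - 1) a|

/-! ### Policies and dynamic regret -/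

/-- A randomized bandit policy: a random seed with a given law, and a rule that selects the next arm
from the seed and from the list (in chronological order) of the arms played so far together with
the rewards observed for them. -/
structure Policy (K : ℕ) where
  Seed : Type
  [seedMeasurableSpace : MeasurableSpace Seed]
  law : Measure Seed
  [law_isProbabilityMeasure : IsProbabilityMeasure law]
  act : Seed → List (Fin K × ℝ) → Fin K

attribute [instance] Policy.seedMeasurableSpace Policy.law_isProbabilityMeasure

/-- The pairs (arm played, observed reward) of the rounds `1, …, t`, when the seed is `ω` and `y r`
is the reward vector of round `r`.  The policy observes the reward of the arm it plays only. -/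
def Policy.history {K : ℕ} (π : Policy K) (ω : π.Seed) (y : ℕ → Fin K → ℝ) :
    ℕ → List (Fin K × ℝ)
  | 0 => []
  | t + 1 => π.history ω y t ++
      [(π.act ω (π.history ω y t), y (t + 1) (π.act ω (π.history ω y t)))]

/-- The arm `π_t` played at round `t ≥ 1`. -/
def Policy.arm {K : ℕ} (π : Policy K) (ω : π.Seed) (y : ℕ → Fin K → ℝ) (t : ℕ) : Fin K :=
  π.act ω (π.history ω y (t - 1))

/-- The dynamic regret `R(π, T) = ∑_{t ≤ T} max_a μ_t(a) - 𝔼 ∑_{t ≤ T} μ_t(π_t)`.  The expectation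
is over the seed of the policy and the independent reward vectors. -/
def dynamicRegret {K : ℕ} (π : Policy K) (ν : ℕ → Measure (Fin K → ℝ)) (T : ℕ) : ℝ :=
  (∑ t ∈ Finset.Icc 1 T, ⨆ a : Fin K, mean ν t a) -
    ∫ p : π.Seed × (ℕ → Fin K → ℝ),
      ∑ t ∈ Finset.Icc 1 T, mean ν t (π.arm p.1 p.2 t) ∂(π.law.prod (Measure.infinitePi ν))

/-! ### The algorithm META with a given horizon

The recursive calls of the base algorithm are kept on a stack: the head is the instance that is
active, and the instance below it is the one that called it. -/

/-- An instance `Base-Alg(start, duration)` with its candidate arm set. -/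
structure Frame (K : ℕ) where
  start : ℕ
  duration : ℕ
  arms : Finset (Fin K)

/-- The state of META just before an arm is played at round `round`: the first round `t_ℓ` of the
current episode, the master candidate set, the stack of the running instances of the base
algorithm, and for every round `r` played in the episode the candidate set from which the arm was
drawn, the arm, and the observed reward. -/
structure State (K : ℕ) where
  round : ℕ
  episodeStart : ℕ
  master : Finset (Fin K)
  stack : List (Frame K)
  log : ℕ → Finset (Fin K) × Fin K × ℝ

/-- The candidate set `𝒜_t` of the active instance. -/
def State.activeArms {K : ℕ} (S : State K) : Finset (Fin K) :=
  match S.stack with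
  | [] => Finset.univ
  | f :: _ => f.arms

/-- The state at the start of an episode at round `t`: it runs `Base-Alg(t, T + 1 - t)`. -/
def newEpisode {K : ℕ} (T t : ℕ) (log : ℕ → Finset (Fin K) × Fin K × ℝ) : State K where
  round := t
  episodeStart := t
  master := Finset.univ
  stack := [⟨t, T + 1 - t, Finset.univ⟩]
  log := log

/-- The importance-weighted estimate `|𝒜_r| (Y_r(a') 1{π_r = a'} - Y_r(a) 1{π_r = a})` of the
relative gap of `a` to `a'` at a round whose log entry is `e`. -/
def gapEstimate {K : ℕ} (e : Finset (Fin K) × Fin K × ℝ) (a' a : Fin K) : ℝ :=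
  (e.1.card : ℝ) * ((if e.2.1 = a' then e.2.2 else 0) - (if e.2.1 = a then e.2.2 else 0))

open Classical in
/-- The arms which satisfy the eviction criterion on some interval of rounds `[s₁, s₂] ⊆ [s, t)`,
`s₁ < s₂`. -/
def badArms {K : ℕ} (C₀ : ℝ) (T : ℕ) (log : ℕ → Finset (Fin K) × Fin K × ℝ) (s t : ℕ) :
    Finset (Fin K) :=
  Finset.univ.filter fun a => ∃ s₁ s₂ : ℕ, s ≤ s₁ ∧ s₁ < s₂ ∧ s₂ < t ∧
    Real.log T * √(C₀ * max ((K : ℝ) * ((s₂ : ℝ) - (s₁ : ℝ))) ((K : ℝ) ^ 2)) <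
      ⨆ a' : Fin K, ∑ r ∈ Finset.Icc s₁ s₂, gapEstimate (log r) a' a

/-- The random draws of META.  `choice (t, A)` is the arm drawn at round `t` if the candidate set is
`A`; `replay (t_ℓ, s, j)` is the draw `B_{s,m}`, `m = 2 ^ j`, of the episode that starts at
round `t_ℓ`. -/
abbrev MetaSeed (K : ℕ) : Type := (ℕ × Finset (Fin K) → Fin K) × (ℕ × ℕ × ℕ → Bool)

/-- The uniform law on the candidate set `A` (on all arms if `A` is empty, which is never used). -/
def choiceLaw {K : ℕ} (A : Finset (Fin K)) : Measure (Fin K) :=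
  uniformOn (if A.Nonempty then (A : Set (Fin K)) else Set.univ)

/-- The law of `B_{s,m}`, `m = 2 ^ j`, in the episode starting at `t_ℓ`: Bernoulli with parameter
`1 / √(m (s - t_ℓ))`.  (The projection to `[0, 1]` changes nothing when `t_ℓ < s`.) -/
def replayLaw (i : ℕ × ℕ × ℕ) : Measure Bool :=
  bernoulliMeasure true false
    (Set.projIcc (0 : ℝ) 1 zero_le_one (1 / √((2 : ℝ) ^ i.2.2 * ((i.2.1 : ℝ) - (i.1 : ℝ)))))

/-- The law of the draws of META: all draws are independent. -/
def metaLaw (K : ℕ) : Measure (MetaSeed K) :=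
  (Measure.infinitePi fun i : ℕ × Finset (Fin K) => choiceLaw i.2).prod
    (Measure.infinitePi replayLaw)

instance {K : ℕ} [NeZero K] (A : Finset (Fin K)) : IsProbabilityMeasure (choiceLaw A) := by
  unfold choiceLaw
  apply isProbabilityMeasure_uniformOn
  · exact Set.toFinite _
  · split_ifs with h
    · exact h
    · exact Set.univ_nonempty

instance (i : ℕ × ℕ × ℕ) : IsProbabilityMeasure (replayLaw i) := by
  unfold replayLaw
  infer_instance

instance {K : ℕ} [NeZero K] : IsProbabilityMeasure (metaLaw K) := by
  unfold metaLaw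
  infer_instance

/-- What META does between two plays when no replay starts at the current round `S.round`: instances
whose scheduled duration has elapsed return; the first instance that has not returned evicts arms
from the master set and from its own candidate set; if the master set becomes empty, then all
instances return and a new episode starts.  (Only rounds up to `T` are of interest; there the
outermost instance never returns by its duration.) -/
def resume {K : ℕ} (C₀ : ℝ) (T : ℕ) (S : State K) : State K :=
  match S.stack.dropWhile (fun f => f.start + f.duration < S.round) with
  | [] => newEpisode T S.round S.log
  | f :: fs =>
      if S.master \ badArms C₀ T S.log S.episodeStart S.round = ∅ then
        newEpisode T S.round S.log
      else
        { S with
          master := S.master \ badArms C₀ T S.log S.episodeStart S.round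
          stack := { f with arms := f.arms \ badArms C₀ T S.log f.start S.round } :: fs }

/-- The exponents `j` of the replay lengths `m = 2 ^ j ∈ {2, 4, …, 2 ^ ⌈log₂ T⌉}` with
`B_{t,m} = 1`, at the current round `t = S.round`. -/
def scheduled {K : ℕ} (T : ℕ) (ω : MetaSeed K) (S : State K) : Finset ℕ :=
  (Finset.Icc 1 (Nat.clog 2 T)).filter fun j => ω.2 (S.episodeStart, S.round, j) = true

/-- What META does between two plays, at the current round `t = S.round`: if some replay is
scheduled, then the longest one, `Base-Alg(t, m)`, becomes active; otherwise see `resume`. -/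
def proceed {K : ℕ} (C₀ : ℝ) (T : ℕ) (ω : MetaSeed K) (S : State K) : State K :=
  if h : (scheduled T ω S).Nonempty then
    { S with stack := ⟨S.round, 2 ^ (scheduled T ω S).max' h, Finset.univ⟩ :: S.stack }
  else resume C₀ T S

/-- One round of META: arm `e.1` is played and reward `e.2` is observed, the round count is
increased, and META proceeds to its next play. -/
def step {K : ℕ} (C₀ : ℝ) (T : ℕ) (ω : MetaSeed K) (S : State K) (e : Fin K × ℝ) : State K :=
  proceed C₀ T ω
    { S with
      round := S.round + 1
      log := Function.update S.log S.round (S.activeArms, e) }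

/-- The state of META with horizon `T` after the rounds recorded in the list `h`. -/
def metaState {K : ℕ} [NeZero K] (C₀ : ℝ) (T : ℕ) (ω : MetaSeed K) (h : List (Fin K × ℝ)) :
    State K :=
  h.foldl (step C₀ T ω) (newEpisode T 1 fun _ => (∅, 0, 0))

/-- The policy META with horizon `T` and eviction constant `C₀`. -/
def metaPolicy (K : ℕ) [NeZero K] (C₀ : ℝ) (T : ℕ) : Policy K where
  Seed := MetaSeed K
  law := metaLaw K
  act ω h := ω.1 ((metaState C₀ T ω h).round, (metaState C₀ T ω h).activeArms)

/-! ### The doubling trick -/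

/-- The policy that plays `π n` afresh, with its own independent seed and no memory of the past, on
the block of the `2 ^ n` rounds `2 ^ n, …, 2 ^ (n + 1) - 1`, for `n = 0, 1, 2, …`. -/
def doubling {K : ℕ} (π : ℕ → Policy K) : Policy K where
  Seed := ∀ n, (π n).Seed
  law := Measure.infinitePi fun n => (π n).law
  act ω h := (π (Nat.log 2 (h.length + 1))).act (ω (Nat.log 2 (h.length + 1)))
    (h.drop (2 ^ Nat.log 2 (h.length + 1) - 1))

/-- The doubling-horizon version of META: META with horizon `2 ^ n` on the block of rounds
`2 ^ n, …, 2 ^ (n + 1) - 1`, for `n = 0, 1, 2, …`. -/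
def metaDoubling (K : ℕ) [NeZero K] (C₀ : ℝ) : Policy K :=
  doubling fun n => metaPolicy K C₀ (2 ^ n)

end Bandit

end

/-!
# The dynamic regret of META with doubling horizons

Only one horizon `T`, and its first `N ≤ T` rounds, has to be considered: a block of the doubling
policy is an independent run of META on shifted rewards (`doubling_arm`,
`measurePreserving_blockOutcome`), and there are only logarithmically many blocks.  The rounds are
divided into phases by the significant shifts.  By definition of a shift, every phase has a *safe*
arm, one without significant regret on any interval of the phase (`exists_safePhases`).  The regret
turns out to be at most the sum of `√(K n)` over the lengths `n` of the phases, up to logarithms.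
By Cauchy-Schwarz this sum is at most `√((L + 1) K T)` (`phaseSum_le_sqrt`).  It is also bounded in
terms of the total variation (`phaseSum_le_totalVariation`): an arm that is optimal at a shift had
significant regret in the phase before, so the means have changed by at least `√(K / n) / 4` in
between; Hölder's inequality concludes.

The stack of META is eliminated first.  `isRun_run` shows that the candidate set of round `t`
consists of the arms that are not bad on the interval `[s, t)`, where `s` is the latest round at
which a replay was scheduled whose duration has not elapsed at `t` (`replayStart`).

*The good event.*  With high probability the importance-weighted estimates are accurate on all
intervals (`outcomeLaw_not_accurate_le`); there are not many more replays than expected; and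
whenever many replays of a given kind are expected, at least one occurs
(`replayLaw_not_goodReplays_le`).  The rest is deterministic:

* A safe arm is not evicted by an instance started in its phase (`safe_mem_arms`), so an episode
  does not end within the phase in which it started, and every phase meets at most two episodes
  (`card_episodes_le_two`).
* In an episode, let `a₀` be an arm that is left in the master set at the last round at which an
  instance is resumed.  While an instance runs, its candidates are compared with `a₀`, which is a
  candidate throughout; as candidate sets shrink, drawing uniformly costs only a factor
  `1 + log K` more than the worst candidate (`sum_average_le`, `sum_averageGap_instance_le`).  The
  bound for the number of replays controls the sum over all instances of an episode
  (`sum_sqrt_replays_le`, `card_running_le`).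
* The regret of `a₀` itself is cut into segments at the rounds in which it reaches a threshold
  (`segStart`).  A replay which starts early in a completed segment and lasts until its end would
  reveal `a₀` as bad, because the safe arm is then a candidate to compare with
  (`mem_badArms_of_detectingReplay`).  Since `a₀` was not evicted, there was no such replay, so
  that not many can have been expected, and the segments are short in total (`sum_gap_le`).

Together these give `sum_averageGap_le`, and `lintegral_gap_runArm` identifies its left-hand side
with the regret: given the past, the arm is uniformly distributed on the candidate set
(`lintegral_oneStep`).
-/

open MeasureTheory ProbabilityTheory

noncomputable section

namespace Bandit

/-! ### An explicit description of the runs of META -/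

/-- At round `t` of an episode that starts at round `e`, the instance of the base algorithm started
at round `s` may still run: it is the outermost one, or a replay whose scheduled duration has not
elapsed. -/
def IsRunningStart (b : ℕ × ℕ × ℕ → Bool) (T e t s : ℕ) : Prop :=
  s = e ∨ e < s ∧ ∃ j ∈ Finset.Icc 1 (Nat.clog 2 T), b (e, s, j) = true ∧ t ≤ s + 2 ^ j

open Classical in
/-- The round at which the instance of the base algorithm active at round `t` was started, in an
episode that starts at round `e`: the latest replay whose scheduled duration has not elapsed, or
the outermost instance if there is none. -/
def replayStart (b : ℕ × ℕ × ℕ → Bool) (T e t : ℕ) : ℕ :=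
  Nat.findGreatest (IsRunningStart b T e t) t

section replayStart

variable {b : ℕ × ℕ × ℕ → Bool} {T e t : ℕ}

lemma replayStart_le : replayStart b T e t ≤ t := by
  classical exact Nat.findGreatest_le _

lemma le_replayStart (h : e ≤ t) : e ≤ replayStart b T e t := by
  classical exact Nat.le_findGreatest h (Or.inl rfl)

lemma le_replayStart_of_replay {s j : ℕ} (hes : e < s) (hst : s ≤ t)
    (hj : j ∈ Finset.Icc 1 (Nat.clog 2 T)) (hb : b (e, s, j) = true) (ht : t ≤ s + 2 ^ j) :
    s ≤ replayStart b T e t := by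
  classical exact Nat.le_findGreatest hst (Or.inr ⟨hes, j, hj, hb, ht⟩)

lemma replayStart_spec (h : e ≤ t) :
    replayStart b T e t = e ∨ e < replayStart b T e t ∧ ∃ j ∈ Finset.Icc 1 (Nat.clog 2 T),
      b (e, replayStart b T e t, j) = true ∧ t ≤ replayStart b T e t + 2 ^ j := by
  classical exact Nat.findGreatest_spec (P := IsRunningStart b T e t) h (Or.inl rfl)

/-- The rounds during which an instance runs are nested: everything that is active between the
start of an instance and a later round of the same instance was started after that instance. -/
lemma replayStart_nested {r : ℕ} (he : e ≤ t) (h₁ : replayStart b T e t ≤ r) (h₂ : r ≤ t) :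
    replayStart b T e t ≤ replayStart b T e r := by
  rcases replayStart_spec (b := b) (T := T) he with h | ⟨h, j, hj, hb, ht⟩
  · rw [h] at h₁ ⊢
    exact le_replayStart h₁
  · exact le_replayStart_of_replay h h₁ hj hb (h₂.trans ht)

lemma replayStart_self : replayStart b T e e = e :=
  le_antisymm replayStart_le (le_replayStart le_rfl)

end replayStart

section badArms

variable {K : ℕ} {C₀ : ℝ} {T : ℕ} {lg lg' : ℕ → Finset (Fin K) × Fin K × ℝ}

lemma badArms_mono {s s' t t' : ℕ} (hs : s' ≤ s) (ht : t ≤ t') :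
    badArms C₀ T lg s t ⊆ badArms C₀ T lg s' t' := by
  intro a ha
  simp only [badArms, Finset.mem_filter, Finset.mem_univ, true_and] at ha ⊢
  obtain ⟨s₁, s₂, h₁, h₂, h₃, h⟩ := ha
  exact ⟨s₁, s₂, hs.trans h₁, h₂, h₃.trans_le ht, h⟩

lemma badArms_congr {s t : ℕ} (h : ∀ r, s ≤ r → r < t → lg r = lg' r) :
    badArms C₀ T lg s t = badArms C₀ T lg' s t := by
  ext a
  simp only [badArms, Finset.mem_filter, Finset.mem_univ, true_and]
  refine exists_congr fun s₁ => exists_congr fun s₂ => ?_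
  refine and_congr_right fun h₁ => and_congr_right fun h₂ => and_congr_right fun h₃ => ?_
  have : ∀ a' : Fin K, ∑ r ∈ Finset.Icc s₁ s₂, gapEstimate (lg r) a' a =
      ∑ r ∈ Finset.Icc s₁ s₂, gapEstimate (lg' r) a' a := fun a' =>
    Finset.sum_congr rfl fun r hr => by
      rw [Finset.mem_Icc] at hr
      rw [h r (h₁.trans hr.1) (hr.2.trans_lt h₃)]
  simp_rw [this]

lemma badArms_self {s t : ℕ} (h : t ≤ s + 1) : badArms C₀ T lg s t = ∅ := by
  ext a
  simp only [badArms, Finset.mem_filter, Finset.mem_univ, true_and, Finset.notMem_empty,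
    iff_false]
  rintro ⟨s₁, s₂, h₁, h₂, h₃, -⟩
  omega

lemma sdiff_badArms_sdiff {s u t : ℕ} (h : u ≤ t) :
    (Finset.univ \ badArms C₀ T lg s u) \ badArms C₀ T lg s t =
      Finset.univ \ badArms C₀ T lg s t := by
  have := badArms_mono (C₀ := C₀) (T := T) (lg := lg) (le_refl s) h
  ext a
  simp only [Finset.mem_sdiff, Finset.mem_univ, true_and]
  exact ⟨fun h => h.2, fun h => ⟨fun h' => h (this h'), h⟩⟩

lemma univ_sdiff_badArms_eq_empty {s t : ℕ} :
    Finset.univ \ badArms C₀ T lg s t = ∅ ↔ badArms C₀ T lg s t = Finset.univ := by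
  rw [Finset.sdiff_eq_empty_iff_subset, Finset.univ_subset_iff]

end badArms

/-- The properties of the states of META that make the explicit description of its runs correct:
the stack holds exactly the instances that may still be running, latest first, and the candidate
sets are complements of sets of arms which satisfy the eviction criterion, by the round `u` at which
the set was last updated.  The active candidate set is always up to date. -/
structure StateInvariant {K : ℕ} (C₀ : ℝ) (T : ℕ) (b : ℕ × ℕ × ℕ → Bool) (S : State K) :
    Prop where
  episodeStart_le : S.episodeStart ≤ S.round
  master : ∃ u ≤ S.round, S.master = Finset.univ \ badArms C₀ T S.log S.episodeStart u
  sorted : S.stack.Pairwise fun f g => g.start < f.start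
  root : ∃ A, (⟨S.episodeStart, T + 1 - S.episodeStart, A⟩ : Frame K) ∈ S.stack
  cover : ∀ s j, S.episodeStart < s → s ≤ S.round → j ∈ Finset.Icc 1 (Nat.clog 2 T) →
    b (S.episodeStart, s, j) = true → S.round ≤ s + 2 ^ j →
      ∃ f ∈ S.stack, f.start = s ∧ 2 ^ j ≤ f.duration
  frames : ∀ f ∈ S.stack, f.start ≤ S.round ∧ (f.start = S.episodeStart ∨
    S.episodeStart < f.start ∧ ∃ j ∈ Finset.Icc 1 (Nat.clog 2 T),
      b (S.episodeStart, f.start, j) = true ∧ f.duration = 2 ^ j)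
  arms : ∀ f ∈ S.stack, ∃ u ≤ S.round, f.arms = Finset.univ \ badArms C₀ T S.log f.start u
  active : S.activeArms = Finset.univ \
    badArms C₀ T S.log (replayStart b T S.episodeStart S.round) S.round

lemma stateInvariant_newEpisode {K : ℕ} (C₀ : ℝ) (T : ℕ) (b : ℕ × ℕ × ℕ → Bool) (t : ℕ)
    (lg : ℕ → Finset (Fin K) × Fin K × ℝ) : StateInvariant C₀ T b (newEpisode T t lg) where
  episodeStart_le := le_rfl
  master := ⟨t, le_rfl, by simp [newEpisode, badArms_self]⟩
  sorted := by simp [newEpisode]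
  root := ⟨Finset.univ, by simp [newEpisode]⟩
  cover := fun s j h₁ h₂ => absurd h₂ (not_le.2 h₁)
  frames := by simp [newEpisode]
  arms := by
    simp only [newEpisode, List.mem_singleton, forall_eq]
    exact ⟨t, le_rfl, by simp [badArms_self]⟩
  active := by
    simp [newEpisode, State.activeArms, replayStart_self, badArms_self]

/-- The round at which the episode that is running at round `t` started, when the episode running
at round `t - 1` started at round `e`: a new episode starts if no replay is scheduled and all arms
satisfy the eviction criterion. -/
def nextEpisodeStart {K : ℕ} (C₀ : ℝ) (T : ℕ) (b : ℕ × ℕ × ℕ → Bool)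
    (lg : ℕ → Finset (Fin K) × Fin K × ℝ) (e t : ℕ) : ℕ :=
  open Classical in
  if (∀ j ∈ Finset.Icc 1 (Nat.clog 2 T), b (e, t, j) = false) ∧
    badArms C₀ T lg e t = Finset.univ then t else e

/-- One round of META preserves the invariant, and starts a new episode as described by
`nextEpisodeStart`. -/
lemma StateInvariant.step {K : ℕ} {C₀ : ℝ} {T : ℕ} {ω : MetaSeed K} {S : State K}
    (hS : StateInvariant C₀ T ω.2 S) (hT : S.round ≤ T) (x : Fin K × ℝ) :
    (step C₀ T ω S x).round = S.round + 1 ∧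
    (step C₀ T ω S x).log = Function.update S.log S.round (S.activeArms, x) ∧
    (step C₀ T ω S x).episodeStart = nextEpisodeStart C₀ T ω.2 (step C₀ T ω S x).log
      S.episodeStart (S.round + 1) ∧
    StateInvariant C₀ T ω.2 (step C₀ T ω S x) := by
  set lg := Function.update S.log S.round (S.activeArms, x) with hlg
  have hcongr : ∀ s u, u ≤ S.round → badArms C₀ T S.log s u = badArms C₀ T lg s u := by
    intro s u hu
    refine badArms_congr fun r _ hr => ?_
    rw [hlg, Function.update_of_ne (by omega)]
  obtain ⟨um, hum, hmaster⟩ := hS.master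
  rw [hcongr _ _ hum] at hmaster
  have hes := hS.episodeStart_le
  have harms : ∀ f ∈ S.stack, ∃ u ≤ S.round, f.arms = Finset.univ \ badArms C₀ T lg f.start u := by
    intro f hf
    obtain ⟨u, hu, h⟩ := hS.arms f hf
    exact ⟨u, hu, by rw [h, hcongr _ _ hu]⟩
  unfold Bandit.step proceed
  simp only
  split_ifs with h
  · -- A replay starts: nothing is evicted, and the new instance has all arms as candidates.
    have hmem := Finset.max'_mem _ h
    set jm := (scheduled T ω _).max' h with hjm
    have hmem' := hmem
    simp only [scheduled, Finset.mem_filter] at hmem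
    refine ⟨rfl, rfl, ?_, ?_⟩
    · rw [nextEpisodeStart, if_neg]
      rintro ⟨h', -⟩
      exact absurd hmem.2 (by rw [h' jm hmem.1]; simp)
    · refine ⟨by simp only; omega, ⟨um, by simp only; omega, hmaster⟩, ?_, ?_, ?_, ?_, ?_, ?_⟩
      · refine List.pairwise_cons.2 ⟨fun g hg => ?_, hS.sorted⟩
        have := (hS.frames g hg).1
        simp only; omega
      · obtain ⟨A, hA⟩ := hS.root
        exact ⟨A, List.mem_cons_of_mem _ hA⟩
      · intro s j h₁ h₂ hj hb hr
        simp only at h₁ h₂ hb hr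
        rcases Nat.lt_or_ge S.round s with h₃ | h₃
        · have hs : s = S.round + 1 := by omega
          refine ⟨_, List.mem_cons_self, hs.symm, ?_⟩
          simp only
          refine Nat.pow_le_pow_right (by norm_num) (Finset.le_max' _ _ ?_)
          simp only [scheduled, Finset.mem_filter]
          exact ⟨hj, hs ▸ hb⟩
        · obtain ⟨f, hf, hfs⟩ := hS.cover s j h₁ h₃ hj hb (by omega)
          exact ⟨f, List.mem_cons_of_mem _ hf, hfs⟩
      · intro f hf
        rcases List.mem_cons.1 hf with rfl | hf
        · refine ⟨le_rfl, Or.inr ⟨by simp only; omega, jm, hmem.1, hmem.2, rfl⟩⟩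
        · obtain ⟨h₁, h₂⟩ := hS.frames f hf
          exact ⟨by simp only; omega, h₂⟩
      · intro f hf
        rcases List.mem_cons.1 hf with rfl | hf
        · exact ⟨S.round + 1, le_rfl, by simp [badArms_self]⟩
        · obtain ⟨u, hu, h'⟩ := harms f hf
          exact ⟨u, Nat.le_succ_of_le hu, h'⟩
      · have : replayStart ω.2 T S.episodeStart (S.round + 1) = S.round + 1 := by
          refine le_antisymm replayStart_le (le_replayStart_of_replay (by omega) le_rfl hmem.1
            hmem.2 (Nat.le_add_right _ _))
        simp [State.activeArms, this, badArms_self]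
  · have hb : ∀ j ∈ Finset.Icc 1 (Nat.clog 2 T), ω.2 (S.episodeStart, S.round + 1, j) = false := by
      intro j hj
      by_contra hne
      refine h ⟨j, ?_⟩
      simp only [scheduled, Finset.mem_filter]
      exact ⟨hj, by simpa using hne⟩
    have hnext : nextEpisodeStart C₀ T ω.2 lg S.episodeStart (S.round + 1) =
        if badArms C₀ T lg S.episodeStart (S.round + 1) = Finset.univ then S.round + 1
          else S.episodeStart := by
      unfold nextEpisodeStart
      by_cases h' : badArms C₀ T lg S.episodeStart (S.round + 1) = Finset.univ
      · rw [if_pos ⟨hb, h'⟩, if_pos h']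
      · rw [if_neg fun h'' => h' h''.2, if_neg h']
    -- No replay starts: the instances whose duration has elapsed are dropped, never the root.
    obtain ⟨A₀, hA₀⟩ := hS.root
    set p : Frame K → Bool := fun f => decide (f.start + f.duration < S.round + 1) with hp
    have hroot : p ⟨S.episodeStart, T + 1 - S.episodeStart, A₀⟩ = false := by
      simp only [hp, decide_eq_false_iff_not]; omega
    have hsplit : S.stack.takeWhile p ++ S.stack.dropWhile p = S.stack :=
      List.takeWhile_append_dropWhile
    have htake : ∀ f ∈ S.stack.takeWhile p, p f = true := fun f hf => List.mem_takeWhile_imp hf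
    unfold resume
    simp only
    split
    next heq =>
      exfalso
      change S.stack.dropWhile p = [] at heq
      rw [heq, List.append_nil] at hsplit
      have := htake _ (hsplit.symm ▸ hA₀)
      rw [hroot] at this
      exact absurd this (by simp)
    next f fs heq =>
      change S.stack.dropWhile p = f :: fs at heq
      have hpf : p f = false := by
        have := List.head_dropWhile_not p (l := S.stack) (by rw [heq]; simp)
        simpa [heq] using this
      rw [heq] at hsplit
      have hmemf : ∀ g ∈ f :: fs, g ∈ S.stack := fun g hg => by
        rw [← hsplit]; exact List.mem_append_right _ hg
      have hkeep : ∀ g ∈ S.stack, p g = false → g ∈ f :: fs := by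
        intro g hg hpg
        rw [← hsplit] at hg
        rcases List.mem_append.1 hg with h' | h'
        · rw [htake g h'] at hpg; exact absurd hpg (by simp)
        · exact h'
      have hsorted : (f :: fs).Pairwise fun f g => g.start < f.start := by
        have := hS.sorted
        rw [← hsplit] at this
        exact (List.pairwise_append.1 this).2.1
      rw [hmaster, sdiff_badArms_sdiff (by omega)]
      split_ifs with hbad <;> rw [univ_sdiff_badArms_eq_empty] at hbad
      · refine ⟨rfl, rfl, ?_, stateInvariant_newEpisode _ _ _ _ _⟩
        change _ = nextEpisodeStart C₀ T ω.2 lg _ _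
        rw [hnext, if_pos hbad]; rfl
      · refine ⟨rfl, rfl, ?_, ?_⟩
        · simp only
          rw [hnext, if_neg hbad]
        have hstart : replayStart ω.2 T S.episodeStart (S.round + 1) = f.start := by
          have hf := hmemf f List.mem_cons_self
          obtain ⟨h₁, h₂⟩ := hS.frames f hf
          have hpf' : ¬ (f.start + f.duration < S.round + 1) := by simpa [hp] using hpf
          refine le_antisymm ?_ ?_
          · have hle : S.episodeStart ≤ f.start := by rcases h₂ with h₂ | h₂ <;> omega
            rcases replayStart_spec (b := ω.2) (T := T) (e := S.episodeStart)
              (t := S.round + 1) (by omega) with h₃ | ⟨h₃, j, hj, hbj, ht⟩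
            · omega
            · by_contra hlt
              have hle' := replayStart_le (b := ω.2) (T := T) (e := S.episodeStart)
                (t := S.round + 1)
              set s := replayStart ω.2 T S.episodeStart (S.round + 1)
              have hne : s ≠ S.round + 1 := by
                intro hs
                rw [hs, hb j hj] at hbj
                exact absurd hbj (by simp)
              obtain ⟨g, hg, hgs, hgd⟩ := hS.cover s j h₃ (by omega) hj hbj (by omega)
              have hpg : p g = false := by
                simp only [hp, decide_eq_false_iff_not]; omega
              rcases List.mem_cons.1 (hkeep g hg hpg) with h₄ | h₄
              · rw [h₄] at hgs; omega
              · have := (List.pairwise_cons.1 hsorted).1 g h₄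
                omega
          · rcases h₂ with h₂ | ⟨h₂, j, hj, hbj, hd⟩
            · rw [h₂]; exact le_replayStart (by omega)
            · exact le_replayStart_of_replay h₂ (by omega) hj hbj (by omega)
        have hfarms : f.arms \ badArms C₀ T lg f.start (S.round + 1) =
            Finset.univ \ badArms C₀ T lg f.start (S.round + 1) := by
          obtain ⟨u, hu, h'⟩ := harms f (hmemf f List.mem_cons_self)
          rw [h', sdiff_badArms_sdiff (by omega)]
        refine ⟨by simp only; omega, ⟨S.round + 1, le_rfl, rfl⟩, ?_, ?_, ?_, ?_, ?_, ?_⟩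
        · exact List.pairwise_cons.2 (List.pairwise_cons.1 hsorted)
        · rcases List.mem_cons.1 (hkeep _ hA₀ hroot) with h' | h'
          · exact ⟨A₀ \ badArms C₀ T lg S.episodeStart (S.round + 1), by rw [← h']; simp [hlg]⟩
          · exact ⟨A₀, List.mem_cons_of_mem _ h'⟩
        · intro s j h₁ h₂ hj hbj hr
          simp only at h₁ h₂ hbj hr
          have hne : s ≠ S.round + 1 := by
            intro hs
            rw [hs, hb j hj] at hbj
            exact absurd hbj (by simp)
          obtain ⟨g, hg, hgs, hgd⟩ := hS.cover s j h₁ (by omega) hj hbj (by omega)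
          have hpg : p g = false := by
            simp only [hp, decide_eq_false_iff_not]; omega
          rcases List.mem_cons.1 (hkeep g hg hpg) with h₄ | h₄
          · exact ⟨_, List.mem_cons_self, by simp only; rw [← h₄]; exact ⟨hgs, hgd⟩⟩
          · exact ⟨g, List.mem_cons_of_mem _ h₄, hgs, hgd⟩
        · intro g hg
          rcases List.mem_cons.1 hg with rfl | hg
          · obtain ⟨h₁, h₂⟩ := hS.frames f (hmemf f List.mem_cons_self)
            exact ⟨by simp only; omega, h₂⟩
          · obtain ⟨h₁, h₂⟩ := hS.frames g (hmemf g (List.mem_cons_of_mem _ hg))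
            exact ⟨by simp only; omega, h₂⟩
        · intro g hg
          rcases List.mem_cons.1 hg with rfl | hg
          · exact ⟨S.round + 1, le_rfl, hfarms⟩
          · obtain ⟨u, hu, h'⟩ := harms g (hmemf g (List.mem_cons_of_mem _ hg))
            exact ⟨u, by simp only; omega, h'⟩
        · simp only [State.activeArms]
          rw [hstart]
          exact hfarms

/-- The recursion satisfied by the log `lg` and the episode starts `e` of the first `N` rounds of
META with horizon `T`, when the replays are given by `b`: `lg r` holds the candidate set of round
`r`, the arm played and the reward observed, and `e r` is the first round of the episode to which
round `r` belongs. -/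
structure IsRun {K : ℕ} (C₀ : ℝ) (T N : ℕ) (b : ℕ × ℕ × ℕ → Bool)
    (lg : ℕ → Finset (Fin K) × Fin K × ℝ) (e : ℕ → ℕ) : Prop where
  first : e 1 = 1
  next : ∀ t, 1 ≤ t → t < N → e (t + 1) = nextEpisodeStart C₀ T b lg (e t) (t + 1)
  arms : ∀ t, 1 ≤ t → t ≤ N →
    (lg t).1 = Finset.univ \ badArms C₀ T lg (replayStart b T (e t) t) t

section run

variable {K : ℕ} [NeZero K] (C₀ : ℝ) (T : ℕ) (ω : MetaSeed K) (y : ℕ → Fin K → ℝ)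

/-- The state of META after `t` rounds. -/
def runState (t : ℕ) : State K := metaState C₀ T ω ((metaPolicy K C₀ T).history ω y t)

/-- The candidate set of round `t`. -/
def runArms (t : ℕ) : Finset (Fin K) := (runState C₀ T ω y (t - 1)).activeArms

/-- The arm that META plays at round `t`. -/
def runArm (t : ℕ) : Fin K := (metaPolicy K C₀ T).arm ω y t

/-- The candidate set, the arm played and the reward observed at round `t`. -/
def runLog (t : ℕ) : Finset (Fin K) × Fin K × ℝ :=
  (runArms C₀ T ω y t, runArm C₀ T ω y t, y t (runArm C₀ T ω y t))

/-- The first round of the episode to which round `t` belongs. -/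
def runEpisode (t : ℕ) : ℕ := (runState C₀ T ω y (t - 1)).episodeStart

variable {C₀ T ω y}

lemma runState_succ (t : ℕ) : runState C₀ T ω y (t + 1) = step C₀ T ω (runState C₀ T ω y t)
    (runArm C₀ T ω y (t + 1), y (t + 1) (runArm C₀ T ω y (t + 1))) := by
  simp [runState, metaState, Policy.history, List.foldl_append, runArm, Policy.arm]

lemma runState_spec (t : ℕ) (ht : t ≤ T) : (runState C₀ T ω y t).round = t + 1 ∧
    (∀ r, 1 ≤ r → r ≤ t → (runState C₀ T ω y t).log r = runLog C₀ T ω y r) ∧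
    StateInvariant C₀ T ω.2 (runState C₀ T ω y t) := by
  induction t with
  | zero =>
    refine ⟨rfl, fun r h₁ h₂ => by omega, ?_⟩
    exact stateInvariant_newEpisode _ _ _ _ _
  | succ t ih =>
    obtain ⟨h₁, h₂, h₃⟩ := ih (by omega)
    obtain ⟨g₁, g₂, -, g₄⟩ := h₃.step (by omega)
      (runArm C₀ T ω y (t + 1), y (t + 1) (runArm C₀ T ω y (t + 1)))
    rw [runState_succ]
    refine ⟨by rw [g₁, h₁], fun r hr hr' => ?_, g₄⟩
    rw [g₂, h₁]
    rcases Nat.lt_or_ge r (t + 1) with h | h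
    · rw [Function.update_of_ne (by omega), h₂ r hr (by omega)]
    · obtain rfl : r = t + 1 := by omega
      rw [Function.update_self]
      rfl

lemma runArm_eq (t : ℕ) (ht : t < T) :
    runArm C₀ T ω y (t + 1) = ω.1 (t + 1, runArms C₀ T ω y (t + 1)) := by
  have := (runState_spec (C₀ := C₀) (T := T) (ω := ω) (y := y) t ht.le).1
  change ω.1 ((runState C₀ T ω y t).round, (runState C₀ T ω y t).activeArms) = _
  rw [this]
  rfl

lemma one_le_runEpisode (t : ℕ) (ht : t < T) : 1 ≤ runEpisode C₀ T ω y (t + 1) := by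
  induction t with
  | zero => exact le_rfl
  | succ t ih =>
    obtain ⟨h₁, -, h₃⟩ := runState_spec (C₀ := C₀) (T := T) (ω := ω) (y := y) t (by omega)
    obtain ⟨-, -, g₃, -⟩ := h₃.step (by omega)
      (runArm C₀ T ω y (t + 1), y (t + 1) (runArm C₀ T ω y (t + 1)))
    rw [← runState_succ] at g₃
    change 1 ≤ (runState C₀ T ω y (t + 1)).episodeStart
    rw [g₃, nextEpisodeStart]
    have := ih (by omega)
    split_ifs
    · omega
    · exact this

/-- The runs of META obey the explicit description. -/
lemma isRun_run {N : ℕ} (hN : N ≤ T) :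
    IsRun C₀ T N ω.2 (runLog C₀ T ω y) (runEpisode C₀ T ω y) where
  first := rfl
  next := by
    intro t h₁ h₂
    obtain ⟨t, rfl⟩ : ∃ u, t = u + 1 := ⟨t - 1, by omega⟩
    obtain ⟨k₁, k₂, k₃⟩ := runState_spec (C₀ := C₀) (T := T) (ω := ω) (y := y) t (by omega)
    obtain ⟨l₁, l₂, l₃⟩ := runState_spec (C₀ := C₀) (T := T) (ω := ω) (y := y) (t + 1) (by omega)
    obtain ⟨-, -, g₃, -⟩ := k₃.step (by omega)
      (runArm C₀ T ω y (t + 1), y (t + 1) (runArm C₀ T ω y (t + 1)))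
    rw [← runState_succ, k₁] at g₃
    have he : runEpisode C₀ T ω y (t + 1 + 1) = (runState C₀ T ω y (t + 1)).episodeStart := rfl
    have he' : runEpisode C₀ T ω y (t + 1) = (runState C₀ T ω y t).episodeStart := rfl
    rw [he, he', g₃]
    unfold nextEpisodeStart
    have hpos := one_le_runEpisode (C₀ := C₀) (T := T) (ω := ω) (y := y) t (by omega)
    rw [badArms_congr (lg' := runLog C₀ T ω y) fun r hr hr' => l₂ r (by omega) (by omega)]
  arms := by
    intro t h₁ h₂
    obtain ⟨t, rfl⟩ : ∃ u, t = u + 1 := ⟨t - 1, by omega⟩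
    obtain ⟨k₁, k₂, k₃⟩ := runState_spec (C₀ := C₀) (T := T) (ω := ω) (y := y) t (by omega)
    have := k₃.active
    change (runState C₀ T ω y t).activeArms = _
    rw [this, k₁]
    have hpos := one_le_runEpisode (C₀ := C₀) (T := T) (ω := ω) (y := y) t (by omega)
    have hle := k₃.episodeStart_le
    rw [k₁] at hle
    change 1 ≤ (runState C₀ T ω y t).episodeStart at hpos
    have := le_replayStart (b := ω.2) (T := T) hle
    congr 1
    exact badArms_congr fun r hr hr' => k₂ r (hpos.trans (this.trans hr)) (Nat.lt_succ_iff.1 hr')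

end run

/-! ### Gaps and confidence radii -/

section gap

variable {K : ℕ} {μ : ℕ → Fin K → ℝ}

lemma sub_le_gap (t : ℕ) (a' a : Fin K) : μ t a' - μ t a ≤ gap μ t a :=
  le_ciSup (f := fun a' => μ t a' - μ t a) (Set.finite_range _).bddAbove a'

lemma gap_nonneg (t : ℕ) (a : Fin K) : 0 ≤ gap μ t a :=
  (sub_self (μ t a)).symm.le.trans (sub_le_gap t a a)

lemma gap_le_one [NeZero K] (hμ : ∀ t a, μ t a ∈ Set.Icc (0 : ℝ) 1) (t : ℕ) (a : Fin K) :
    gap μ t a ≤ 1 :=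
  ciSup_le fun a' => by linarith [(hμ t a').2, (hμ t a).1]

lemma gap_eq [NeZero K] (t : ℕ) (a : Fin K) : gap μ t a = (⨆ a', μ t a') - μ t a := by
  refine le_antisymm (ciSup_le fun a' => ?_) ?_
  · exact sub_le_sub_right (le_ciSup (Set.finite_range _).bddAbove a') _
  · rw [sub_le_iff_le_add]
    refine ciSup_le fun a' => ?_
    linarith [sub_le_gap (μ := μ) t a' a]

lemma exists_gap_eq_zero [NeZero K] (t : ℕ) : ∃ a : Fin K, gap μ t a = 0 := by
  obtain ⟨a, ha⟩ := exists_eq_ciSup_of_finite (f := fun a' => μ t a')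
  exact ⟨a, by rw [gap_eq, ← ha, sub_self]⟩

end gap

/-- The confidence radius `√(K n ∨ K²)` of an interval of `n + 1` rounds, up to constants and
logarithms. -/
def radius (K n : ℕ) : ℝ := √(max ((K : ℝ) * n) ((K : ℝ) ^ 2))

section radius

variable {K n m : ℕ}

lemma radius_mono (h : n ≤ m) : radius K n ≤ radius K m := by
  unfold radius
  gcongr

lemma sqrt_le_radius : √((K : ℝ) * n) ≤ radius K n :=
  Real.sqrt_le_sqrt (le_max_left _ _)

lemma le_radius : (K : ℝ) ≤ radius K n := by
  rw [← Real.sqrt_sq (Nat.cast_nonneg K : (0 : ℝ) ≤ K)]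
  exact Real.sqrt_le_sqrt (le_max_right _ _)

lemma radius_pos [NeZero K] : 0 < radius K n :=
  lt_of_lt_of_le (Nat.cast_pos.2 (NeZero.pos K)) le_radius

lemma radius_eq (h : K ≤ n) : radius K n = √((K : ℝ) * n) := by
  unfold radius
  rw [max_eq_left]
  rw [sq]
  gcongr

lemma radius_div_four (h : 4 * K ≤ n) : radius K (n / 4) ≤ radius K n / 2 := by
  rw [radius_eq (by omega), radius_eq (by omega)]
  have h4 : (4 : ℝ) * ((n / 4 : ℕ) : ℝ) ≤ n := by exact_mod_cast Nat.mul_div_le n 4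
  rw [le_div_iff₀ two_pos]
  refine Real.le_sqrt_of_sq_le ?_
  rw [mul_pow, Real.sq_sqrt (by positivity)]
  nlinarith [(Nat.cast_nonneg K : (0 : ℝ) ≤ K)]

end radius

/-! ### Averages over nested candidate sets -/

/-- The hypothesis says that the `k`-th smallest value of `f` is at least `k`. -/
lemma sum_inv_le_harmonic {ι : Type*} [DecidableEq ι] (f : ι → ℕ) (U : Finset ι)
    (h : ∀ k, (U.filter fun a => f a ≤ k).card ≤ k) :
    ∑ a ∈ U, ((f a : ℝ))⁻¹ ≤ (harmonic U.card : ℝ) := by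
  induction U using Finset.induction_on_max_value f with
  | empty => simp
  | insert a s ha hmax ih =>
    rw [Finset.sum_insert ha, Finset.card_insert_of_notMem ha, harmonic_succ, add_comm]
    push_cast
    refine add_le_add (ih fun k => ?_) ?_
    · exact (Finset.card_le_card (Finset.filter_subset_filter _ (Finset.subset_insert _ _))).trans
        (h k)
    · have := h (f a)
      rw [Finset.filter_true_of_mem, Finset.card_insert_of_notMem ha] at this
      · have h' : ((s.card : ℝ) + 1) ≤ f a := by exact_mod_cast this
        exact inv_anti₀ (by positivity) h'
      · intro b hb
        rcases Finset.mem_insert.1 hb with rfl | hb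
        · exact le_rfl
        · exact hmax b hb

/-- If the candidate sets `A t` shrink over the rounds of `I` and every arm costs at most `M` in
total over the rounds in which it is a candidate, then the average costs of the candidates sum up
to at most `(1 + log K) M`: an arm that is the `k`-th last to be removed is always played with
probability at most `1 / k`. -/
lemma sum_average_le {K : ℕ} [NeZero K] (I : Finset ℕ) (A : ℕ → Finset (Fin K))
    (x : ℕ → Fin K → ℝ) (hx : ∀ t a, 0 ≤ x t a) (M : ℝ) (hM : 0 ≤ M)
    (hA : ∀ t ∈ I, ∀ t' ∈ I, t ≤ t' → A t' ⊆ A t)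
    (h : ∀ a, ∑ t ∈ I with a ∈ A t, x t a ≤ M) :
    ∑ t ∈ I, (∑ a ∈ A t, x t a) / (A t).card ≤ (1 + Real.log K) * M := by
  classical
  set U : Finset (Fin K) := Finset.univ.filter fun a => ∃ t ∈ I, a ∈ A t with hU
  have hlast : ∀ a, ∃ u, a ∈ U → u ∈ I ∧ a ∈ A u ∧ ∀ t ∈ I, a ∈ A t → t ≤ u := by
    intro a
    by_cases ha : a ∈ U
    · obtain ⟨t, ht, hat⟩ := (Finset.mem_filter.1 ha).2
      obtain ⟨u, hu, hmax⟩ := Finset.exists_max_image (I.filter fun t => a ∈ A t) id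
        ⟨t, Finset.mem_filter.2 ⟨ht, hat⟩⟩
      rw [Finset.mem_filter] at hu
      exact ⟨u, fun _ => ⟨hu.1, hu.2, fun t ht hat => hmax t (Finset.mem_filter.2 ⟨ht, hat⟩)⟩⟩
    · exact ⟨0, fun h => absurd h ha⟩
  choose u hu using hlast
  have hcard : ∀ k, (U.filter fun a => (A (u a)).card ≤ k).card ≤ k := by
    intro k
    rcases (U.filter fun a => (A (u a)).card ≤ k).eq_empty_or_nonempty with hV | hV
    · simp [hV]
    · obtain ⟨a₀, ha₀, hmin⟩ := Finset.exists_min_image _ u hV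
      rw [Finset.mem_filter] at ha₀
      refine (Finset.card_le_card fun a ha => ?_).trans ha₀.2
      have h₁ := hmin a ha
      obtain ⟨h₂, h₃, -⟩ := hu a (Finset.mem_filter.1 ha).1
      exact hA _ (hu a₀ ha₀.1).1 _ h₂ h₁ h₃
  have hpos : (0 : ℝ) < K := Nat.cast_pos.2 (NeZero.pos K)
  calc ∑ t ∈ I, (∑ a ∈ A t, x t a) / (A t).card
      = ∑ t ∈ I, ∑ a ∈ A t, x t a * ((A t).card : ℝ)⁻¹ := by
        simp_rw [div_eq_mul_inv, Finset.sum_mul]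
    _ ≤ ∑ t ∈ I, ∑ a ∈ A t, x t a * ((A (u a)).card : ℝ)⁻¹ := by
        refine Finset.sum_le_sum fun t ht => Finset.sum_le_sum fun a ha => ?_
        have haU : a ∈ U := Finset.mem_filter.2 ⟨Finset.mem_univ _, t, ht, ha⟩
        obtain ⟨h₁, h₂, h₃⟩ := hu a haU
        refine mul_le_mul_of_nonneg_left (inv_anti₀ ?_ ?_) (hx t a)
        · exact Nat.cast_pos.2 (Finset.card_pos.2 ⟨a, h₂⟩)
        · exact Nat.cast_le.2 (Finset.card_le_card (hA t ht _ h₁ (h₃ t ht ha)))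
    _ = ∑ a ∈ U, (∑ t ∈ I with a ∈ A t, x t a) * ((A (u a)).card : ℝ)⁻¹ := by
        simp_rw [Finset.sum_mul]
        refine Finset.sum_comm' fun t a => ?_
        rw [hU, Finset.mem_filter, Finset.mem_filter]
        exact ⟨fun h => ⟨h, Finset.mem_univ _, t, h⟩, fun h => h.1⟩
    _ ≤ ∑ a ∈ U, M * ((A (u a)).card : ℝ)⁻¹ :=
        Finset.sum_le_sum fun a _ => mul_le_mul_of_nonneg_right (h a) (by positivity)
    _ = M * ∑ a ∈ U, ((A (u a)).card : ℝ)⁻¹ := (Finset.mul_sum _ _ _).symm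
    _ ≤ M * (1 + Real.log K) := by
        refine mul_le_mul_of_nonneg_left ?_ hM
        refine (sum_inv_le_harmonic (fun a => (A (u a)).card) U hcard).trans ?_
        refine (harmonic_le_one_add_log _).trans ?_
        rcases Nat.eq_zero_or_pos U.card with h0 | h0
        · rw [h0, Nat.cast_zero, Real.log_zero]
          have := Real.log_nonneg (x := (K : ℝ)) (by exact_mod_cast NeZero.pos K)
          linarith
        · have hle : U.card ≤ K := by simpa using Finset.card_le_univ U
          gcongr
    _ = (1 + Real.log K) * M := mul_comm _ _

/-! ### Intervals cut at threshold crossings -/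

section segments

variable (x θ : ℕ → ℝ) (φ : ℕ → ℕ) (e : ℕ)

open Classical in
/-- The rounds from `e` on are cut into segments: a new segment is started at a round in which the
label `φ` changes, and after a round in which the sum of `x` over the current segment reaches the
threshold `θ`.  The value at `t` is the first round of the segment of `t`. -/
def segStart : ℕ → ℕ
  | 0 => e
  | t + 1 =>
    if t + 1 ≤ e then e
    else if φ (t + 1) ≠ φ t ∨ θ (t - segStart t) ≤ ∑ r ∈ Finset.Icc (segStart t) t, x r then t + 1
    else segStart t

/-- The segment of round `t` is completed at round `t`, since the threshold is reached. -/
def IsSegEnd (t : ℕ) : Prop :=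
  θ (t - segStart x θ φ e t) ≤ ∑ r ∈ Finset.Icc (segStart x θ φ e t) t, x r

variable {x θ φ e}

lemma segStart_of_le {t : ℕ} (h : t ≤ e) : segStart x θ φ e t = e := by
  cases t with
  | zero => rfl
  | succ t => rw [segStart, if_pos h]

lemma segStart_succ {t : ℕ} (h : e ≤ t) : φ (t + 1) ≠ φ t ∨ IsSegEnd x θ φ e t ∧
      segStart x θ φ e (t + 1) = t + 1 ∨
    φ (t + 1) = φ t ∧ ¬ IsSegEnd x θ φ e t ∧ segStart x θ φ e (t + 1) = segStart x θ φ e t := by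
  by_cases h₁ : φ (t + 1) = φ t
  · by_cases h₂ : IsSegEnd x θ φ e t
    · refine Or.inr (Or.inl ⟨h₂, ?_⟩)
      rw [segStart, if_neg (by omega)]
      exact if_pos (Or.inr h₂)
    · refine Or.inr (Or.inr ⟨h₁, h₂, ?_⟩)
      rw [segStart, if_neg (by omega), if_neg]
      rintro (h | h)
      · exact h h₁
      · exact h₂ h
  · exact Or.inl h₁

lemma segStart_succ_of_ne {t : ℕ} (h : e ≤ t) (h₁ : φ (t + 1) ≠ φ t) :
    segStart x θ φ e (t + 1) = t + 1 := by
  rw [segStart, if_neg (by omega), if_pos (Or.inl h₁)]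

lemma segStart_mem {t : ℕ} (h : e ≤ t) : e ≤ segStart x θ φ e t ∧ segStart x θ φ e t ≤ t := by
  induction t, h using Nat.le_induction with
  | base => rw [segStart_of_le le_rfl]; exact ⟨le_rfl, le_rfl⟩
  | succ t ht ih =>
    rcases segStart_succ (x := x) (θ := θ) (φ := φ) ht with h | ⟨-, h⟩ | ⟨-, -, h⟩
    · rw [segStart_succ_of_ne ht h]; omega
    · rw [h]; omega
    · rw [h]; omega

/-- The rounds between the first round of the segment of `t` and `t` belong to this segment. -/
lemma segStart_eq {t u : ℕ} (h : e ≤ t) (h₁ : segStart x θ φ e t ≤ u) (h₂ : u ≤ t) :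
    segStart x θ φ e u = segStart x θ φ e t := by
  induction t, h using Nat.le_induction with
  | base =>
    rw [segStart_of_le le_rfl, segStart_of_le h₂]
  | succ t ht ih =>
    rcases Nat.lt_or_ge t u with h | h
    · rw [show u = t + 1 by omega]
    · rcases segStart_succ (x := x) (θ := θ) (φ := φ) ht with h' | ⟨-, h'⟩ | ⟨-, -, h'⟩
      · rw [segStart_succ_of_ne ht h'] at h₁; omega
      · omega
      · rw [h'] at h₁ ⊢
        exact ih h₁ h

lemma not_isSegEnd_of_lt {t u : ℕ} (h : e ≤ t) (h₁ : segStart x θ φ e t ≤ u) (h₂ : u < t) :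
    ¬ IsSegEnd x θ φ e u ∧ φ (u + 1) = φ u := by
  have hu := (segStart_mem (x := x) (θ := θ) (φ := φ) h).1.trans h₁
  have h₃ := segStart_eq h h₁ h₂.le
  have h₄ : segStart x θ φ e (u + 1) = segStart x θ φ e t :=
    segStart_eq h (h₁.trans (Nat.le_succ u)) h₂
  rcases segStart_succ (x := x) (θ := θ) (φ := φ) hu with h' | ⟨-, h'⟩ | ⟨h', h'', -⟩
  · rw [segStart_succ_of_ne hu h'] at h₄; omega
  · omega
  · exact ⟨h'', h'⟩

lemma segStart_label {t : ℕ} (h : e ≤ t) : φ (segStart x θ φ e t) = φ t := by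
  have : ∀ k, segStart x θ φ e t + k ≤ t →
      φ (segStart x θ φ e t + k) = φ (segStart x θ φ e t) := by
    intro k
    induction k with
    | zero => intro _; rfl
    | succ k ih =>
      intro hk
      rw [← ih (by omega), ← (not_isSegEnd_of_lt (x := x) (θ := θ) (φ := φ) h
        (Nat.le_add_right _ k) (by omega)).2]
      rfl
  have h' := (segStart_mem (x := x) (θ := θ) (φ := φ) h).2
  rw [← this (t - segStart x θ φ e t) (by omega)]
  congr 1
  omega

lemma sum_lt_of_segStart_le {t u : ℕ} (h : e ≤ t) (h₁ : segStart x θ φ e t ≤ u) (h₂ : u < t) :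
    ∑ r ∈ Finset.Icc (segStart x θ φ e t) u, x r < θ (u - segStart x θ φ e t) := by
  have := (not_isSegEnd_of_lt h h₁ h₂).1
  rw [IsSegEnd, segStart_eq h h₁ h₂.le] at this
  exact not_le.1 this

/-- The last round of a segment exceeds the threshold by at most `1`. -/
lemma sum_segment_le {t : ℕ} (h : e ≤ t) (hx : ∀ r, x r ≤ 1) (hθ : Monotone θ)
    (hθ0 : 0 ≤ θ 0) : ∑ r ∈ Finset.Icc (segStart x θ φ e t) t, x r ≤
      θ (t - segStart x θ φ e t) + 1 := by
  have hm := (segStart_mem (x := x) (θ := θ) (φ := φ) h).2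
  rcases hm.eq_or_lt with h' | h'
  · rw [h', Finset.Icc_self, Finset.sum_singleton, Nat.sub_self]
    linarith [hx t]
  · obtain ⟨s, rfl⟩ : ∃ s, t = s + 1 := ⟨t - 1, by omega⟩
    rw [Finset.sum_Icc_succ_top (by omega)]
    have h₁ := sum_lt_of_segStart_le (x := x) (θ := θ) (φ := φ) (u := s) h (by omega) (by omega)
    have h₂ : θ (s - segStart x θ φ e (s + 1)) ≤ θ (s + 1 - segStart x θ φ e (s + 1)) :=
      hθ (by omega)
    linarith [hx (s + 1)]

/-- Distinct completed segments are disjoint. -/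
lemma eq_of_isSegEnd {t t' s : ℕ} (ht : e ≤ t) (ht' : e ≤ t') (h : IsSegEnd x θ φ e t)
    (h' : IsSegEnd x θ φ e t') (hs : segStart x θ φ e t ≤ s) (hst : s ≤ t)
    (hs' : segStart x θ φ e t' ≤ s) (hst' : s ≤ t') : t = t' := by
  have h₁ := segStart_eq ht hs hst
  have h₂ := segStart_eq ht' hs' hst'
  rcases lt_trichotomy t t' with h₃ | h₃ | h₃
  · exact absurd h (not_isSegEnd_of_lt ht' (by omega) h₃).1
  · exact h₃
  · exact absurd h' (not_isSegEnd_of_lt ht (by omega) h₃).1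

open Classical in
/-- An interval on which the label is constant consists of completed segments and of at most one
incomplete one. -/
lemma sum_le_segments {u v : ℕ} (he : e ≤ u) (huv : u < v) (hu : segStart x θ φ e u = u)
    (hφ : ∀ r, u ≤ r → r < v → φ r = φ u)
    (hx : ∀ r, x r ≤ 1) (hθ : Monotone θ) (hθ0 : 0 ≤ θ 0) :
    ∑ r ∈ Finset.Ico u v, x r ≤
      ∑ t ∈ Finset.Ico u v with IsSegEnd x θ φ e t, (θ (t - segStart x θ φ e t) + 1) +
        θ (v - 1 - u) := by
  have hθn : ∀ n, 0 ≤ θ n := fun n => hθ0.trans (hθ (Nat.zero_le n))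
  have hsplit : ∀ t, u ≤ t → u ≤ segStart x θ φ e t →
      ∑ r ∈ Finset.Ico u (segStart x θ φ e t), x r ≤
        ∑ t ∈ Finset.Ico u (segStart x θ φ e t) with IsSegEnd x θ φ e t,
          (θ (t - segStart x θ φ e t) + 1) → IsSegEnd x θ φ e t →
      ∑ r ∈ Finset.Ico u (t + 1), x r ≤
        ∑ t ∈ Finset.Ico u (t + 1) with IsSegEnd x θ φ e t,
          (θ (t - segStart x θ φ e t) + 1) := by
    intro t ht h₁ h₂ h₃
    have hm := segStart_mem (x := x) (θ := θ) (φ := φ) (he.trans ht)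
    have h₄ := sum_segment_le (φ := φ) (he.trans ht) hx hθ hθ0
    rw [← Finset.sum_Ico_consecutive _ h₁ (hm.2.trans (Nat.le_succ t))]
    have h₅ : Finset.Ico (segStart x θ φ e t) (t + 1) = Finset.Icc (segStart x θ φ e t) t := rfl
    rw [h₅]
    refine (add_le_add h₂ h₄).trans ?_
    rw [add_comm, ← Finset.sum_insert (f := fun t => θ (t - segStart x θ φ e t) + 1)]
    · refine Finset.sum_le_sum_of_subset_of_nonneg ?_ fun i _ _ => by linarith [hθn (i -
        segStart x θ φ e i)]
      intro r hr
      simp only [Finset.mem_insert, Finset.mem_filter, Finset.mem_Ico] at hr ⊢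
      rcases hr with rfl | hr
      · exact ⟨⟨ht, Nat.lt_succ_self _⟩, h₃⟩
      · exact ⟨⟨hr.1.1, by omega⟩, hr.2⟩
    · simp only [Finset.mem_filter, Finset.mem_Ico]
      omega
  have key : ∀ t, u ≤ t → t < v →
      u ≤ segStart x θ φ e t ∧ ∑ r ∈ Finset.Ico u (segStart x θ φ e t), x r ≤
        ∑ t ∈ Finset.Ico u (segStart x θ φ e t) with IsSegEnd x θ φ e t,
          (θ (t - segStart x θ φ e t) + 1) := by
    intro t ht
    induction t, ht using Nat.le_induction with
    | base => intro _; rw [hu]; simp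
    | succ t ht ih =>
      intro htv
      obtain ⟨h₁, h₂⟩ := ih (by omega)
      rcases segStart_succ (x := x) (θ := θ) (φ := φ) (he.trans ht) with h | ⟨h, h'⟩ | ⟨-, -, h'⟩
      · exact absurd ((hφ (t + 1) (by omega) htv).trans (hφ t ht (by omega)).symm) h
      · rw [h']
        exact ⟨by omega, hsplit t ht h₁ h₂ h⟩
      · rw [h']
        exact ⟨h₁, h₂⟩
  obtain ⟨w, rfl⟩ : ∃ w, v = w + 1 := ⟨v - 1, by omega⟩
  obtain ⟨h₁, h₂⟩ := key w (by omega) (Nat.lt_succ_self w)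
  rw [Nat.add_sub_cancel]
  by_cases h : IsSegEnd x θ φ e w
  · exact (hsplit w (by omega) h₁ h₂ h).trans (le_add_of_nonneg_right (hθn _))
  · have hm := segStart_mem (x := x) (θ := θ) (φ := φ) (show e ≤ w by omega)
    rw [← Finset.sum_Ico_consecutive _ h₁ (hm.2.trans (Nat.le_succ w))]
    have h₅ : Finset.Ico (segStart x θ φ e w) (w + 1) = Finset.Icc (segStart x θ φ e w) w := rfl
    rw [h₅]
    refine add_le_add (h₂.trans ?_) ((not_le.1 h).le.trans (hθ (by omega)))
    refine Finset.sum_le_sum_of_subset_of_nonneg ?_ fun i _ _ => by linarith [hθn (i -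
        segStart x θ φ e i)]
    exact Finset.filter_subset_filter _ (Finset.Ico_subset_Ico_right (by omega))

end segments

/-! ### The good event and its consequences for evictions -/

/-- The deviation of the importance-weighted reward of arm `a` at round `r` from its conditional
mean, given the past. -/
def estError {K : ℕ} (μ : ℕ → Fin K → ℝ) (lg : ℕ → Finset (Fin K) × Fin K × ℝ) (a : Fin K)
    (r : ℕ) : ℝ :=
  ((lg r).1.card : ℝ) * (if (lg r).2.1 = a then (lg r).2.2 else 0) -
    if a ∈ (lg r).1 then μ r a else 0

/-- The rounds `1, …, N` are labelled by phases such that every phase has a safe arm, one which has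
no significant regret on any interval of the phase.  The labels increase over time. -/
structure SafePhases {K : ℕ} (μ : ℕ → Fin K → ℝ) (N : ℕ) (φ : ℕ → ℕ) (safe : ℕ → Fin K) :
    Prop where
  mono : Monotone φ
  lt : ∀ s₁ s₂, 1 ≤ s₁ → s₁ < s₂ → s₂ ≤ N → φ s₁ = φ s₂ →
    ∑ t ∈ Finset.Icc s₁ s₂, gap μ t (safe (φ s₁)) < √((K : ℝ) * (s₂ - s₁ : ℕ))

/-- The threshold for the sum of the gaps of an arm over a segment of `n + 1` rounds.  It is more than
twice the threshold for evictions, so that it is still exceeded by enough after the first quarter of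
the segment. -/
def segThreshold (K : ℕ) (C₀ : ℝ) (T n : ℕ) : ℝ :=
  (2 * √C₀ + 20) * Real.log T * radius K n

/-- The rounds at which a segment of arm `a` is completed, in `[e, w)`. -/
def segEnds {K : ℕ} (C₀ : ℝ) (T : ℕ) (μ : ℕ → Fin K → ℝ) (φ : ℕ → ℕ) (e : ℕ) (a : Fin K)
    (w : ℕ) : Finset ℕ :=
  open Classical in
  (Finset.Ico e w).filter (IsSegEnd (fun t => gap μ t a) (segThreshold K C₀ T) φ e)

/-- The first round of the segment of arm `a` that contains round `t`, in an episode which starts at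
round `e`. -/
def armSegStart {K : ℕ} (C₀ : ℝ) (T : ℕ) (μ : ℕ → Fin K → ℝ) (φ : ℕ → ℕ) (e : ℕ) (a : Fin K)
    (t : ℕ) : ℕ :=
  segStart (fun t => gap μ t a) (segThreshold K C₀ T) φ e t

/-- The replays (start and logarithm of the length) each of which makes sure that arm `a` is
recognized as bad before round `w`, in an episode which starts at round `e`: they start in the first
quarter of a completed segment, and last until its end. -/
def detectingReplays {K : ℕ} (C₀ : ℝ) (T : ℕ) (μ : ℕ → Fin K → ℝ) (φ : ℕ → ℕ) (e : ℕ) (a : Fin K)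
    (w : ℕ) : Finset (ℕ × ℕ) :=
  (segEnds C₀ T μ φ e a w).biUnion fun t =>
    Finset.Ioc (armSegStart C₀ T μ φ e a t)
      (armSegStart C₀ T μ φ e a t + (t - armSegStart C₀ T μ φ e a t) / 4) ×ˢ
        {Nat.clog 2 (t - armSegStart C₀ T μ φ e a t)}

/-- The probability that a replay of length `2 ^ j` is scheduled at round `s` of an episode which
starts at round `e`. -/
def replayProb (e s j : ℕ) : ℝ := 1 / √((2 : ℝ) ^ j * ((s : ℝ) - (e : ℝ)))

/-- The properties of the replays that hold with high probability: there are not many more of them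
than expected on any interval, and if many replays that detect a bad arm were to be expected, then
there is at least one. -/
structure GoodReplays {K : ℕ} (C₀ : ℝ) (T N : ℕ) (μ : ℕ → Fin K → ℝ) (φ : ℕ → ℕ)
    (b : ℕ × ℕ × ℕ → Bool) : Prop where
  count : ∀ e j u v, 1 ≤ e → j ∈ Finset.Icc 1 (Nat.clog 2 T) → u ≤ v → e + v ≤ N →
    (((Finset.Ioc (e + u) (e + v)).filter fun s => b (e, s, j) = true).card : ℝ) ≤
      4 * √((v - u : ℕ) / (2 : ℝ) ^ j) + 5 * Real.log T
  detect : ∀ e a w, 1 ≤ e → e ≤ w → w ≤ N →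
    ∑ q ∈ detectingReplays C₀ T μ φ e a w, replayProb e q.1 q.2 ≤ 4 * Real.log T ∨
      ∃ q ∈ detectingReplays C₀ T μ φ e a w, b (e, q.1, q.2) = true

/-- All importance-weighted estimates of rewards are accurate. -/
def Accurate {K : ℕ} (T N : ℕ) (μ : ℕ → Fin K → ℝ) (lg : ℕ → Finset (Fin K) × Fin K × ℝ) : Prop :=
  ∀ a s₁ s₂, 1 ≤ s₁ → s₁ < s₂ → s₂ ≤ N →
    |∑ r ∈ Finset.Icc s₁ s₂, estError μ lg a r| ≤ 4 * Real.log T * radius K (s₂ - s₁)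

/-- The conditional mean, given the past, of the estimate of the gap of `a` to `a'` at round `r`: the
rewards of arms which are not candidates are not seen, and count as `0`. -/
def visibleGap {K : ℕ} (μ : ℕ → Fin K → ℝ) (lg : ℕ → Finset (Fin K) × Fin K × ℝ) (a' a : Fin K)
    (r : ℕ) : ℝ :=
  (if a' ∈ (lg r).1 then μ r a' else 0) - if a ∈ (lg r).1 then μ r a else 0

section accurate

variable {K : ℕ} {C₀ : ℝ} {T N : ℕ} {μ : ℕ → Fin K → ℝ}
  {lg : ℕ → Finset (Fin K) × Fin K × ℝ}

lemma abs_estimate_sub_le (hacc : Accurate T N μ lg) (a' a : Fin K) {s₁ s₂ : ℕ} (h₁ : 1 ≤ s₁)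
    (h₂ : s₁ < s₂) (h₃ : s₂ ≤ N) :
    |∑ r ∈ Finset.Icc s₁ s₂, gapEstimate (lg r) a' a -
      ∑ r ∈ Finset.Icc s₁ s₂, visibleGap μ lg a' a r| ≤
        8 * Real.log T * radius K (s₂ - s₁) := by
  have : ∑ r ∈ Finset.Icc s₁ s₂, gapEstimate (lg r) a' a -
      ∑ r ∈ Finset.Icc s₁ s₂, visibleGap μ lg a' a r =
      ∑ r ∈ Finset.Icc s₁ s₂, estError μ lg a' r - ∑ r ∈ Finset.Icc s₁ s₂, estError μ lg a r := by
    rw [← Finset.sum_sub_distrib, ← Finset.sum_sub_distrib]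
    refine Finset.sum_congr rfl fun r _ => ?_
    simp only [gapEstimate, visibleGap, estError]
    ring
  rw [this]
  have h₄ := hacc a' s₁ s₂ h₁ h₂ h₃
  have h₅ := hacc a s₁ s₂ h₁ h₂ h₃
  rw [abs_le] at *
  constructor <;> linarith [h₄.1, h₄.2, h₅.1, h₅.2]

lemma threshold_eq (hC : 0 ≤ C₀) {s₁ s₂ : ℕ} (h : s₁ < s₂) :
    Real.log T * √(C₀ * max ((K : ℝ) * ((s₂ : ℝ) - (s₁ : ℝ))) ((K : ℝ) ^ 2)) =
      √C₀ * Real.log T * radius K (s₂ - s₁) := by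
  rw [radius, Nat.cast_sub h.le, Real.sqrt_mul hC]
  ring

/-- Arms that were not recognized as bad are not much worse than any other arm. -/
lemma visibleGap_le (hC : 0 ≤ C₀) (hacc : Accurate T N μ lg) {s t s₁ s₂ : ℕ} {a : Fin K}
    (ha : a ∉ badArms C₀ T lg s t) (a' : Fin K) (h₁ : 1 ≤ s₁) (hs : s ≤ s₁) (h₂ : s₁ < s₂)
    (h₃ : s₂ < t) (h₄ : s₂ ≤ N) :
    ∑ r ∈ Finset.Icc s₁ s₂, visibleGap μ lg a' a r ≤
      (√C₀ + 8) * Real.log T * radius K (s₂ - s₁) := by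
  have h₅ : ¬ (Real.log T * √(C₀ * max ((K : ℝ) * ((s₂ : ℝ) - (s₁ : ℝ))) ((K : ℝ) ^ 2)) <
      ⨆ a' : Fin K, ∑ r ∈ Finset.Icc s₁ s₂, gapEstimate (lg r) a' a) := by
    intro h
    refine ha ?_
    simp only [badArms, Finset.mem_filter, Finset.mem_univ, true_and]
    exact ⟨s₁, s₂, hs, h₂, h₃, h⟩
  rw [threshold_eq hC h₂, not_lt] at h₅
  have h₆ := le_ciSup (f := fun a' => ∑ r ∈ Finset.Icc s₁ s₂, gapEstimate (lg r) a' a)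
    (Set.finite_range _).bddAbove a'
  have h₇ := abs_le.1 (abs_estimate_sub_le hacc a' a h₁ h₂ h₄)
  linarith [h₇.1]

lemma exists_of_mem_badArms [NeZero K] (hC : 0 ≤ C₀) (hacc : Accurate T N μ lg) {s t : ℕ}
    {a : Fin K} (ha : a ∈ badArms C₀ T lg s t) (hs : 1 ≤ s) (ht : t ≤ N + 1) :
    ∃ s₁ s₂ a', s ≤ s₁ ∧ s₁ < s₂ ∧ s₂ < t ∧ (√C₀ - 8) * Real.log T * radius K (s₂ - s₁) <
      ∑ r ∈ Finset.Icc s₁ s₂, visibleGap μ lg a' a r := by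
  simp only [badArms, Finset.mem_filter, Finset.mem_univ, true_and] at ha
  obtain ⟨s₁, s₂, h₁, h₂, h₃, h⟩ := ha
  rw [threshold_eq hC h₂] at h
  obtain ⟨a', ha'⟩ := exists_lt_of_lt_ciSup h
  refine ⟨s₁, s₂, a', h₁, h₂, h₃, ?_⟩
  have h₇ := abs_le.1 (abs_estimate_sub_le hacc a' a (hs.trans h₁) h₂ (by omega))
  linarith [h₇.2]

lemma mem_badArms_of_lt (hC : 0 ≤ C₀) (hacc : Accurate T N μ lg) {s t s₁ s₂ : ℕ} {a a' : Fin K}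
    (h₁ : 1 ≤ s₁) (hs : s ≤ s₁) (h₂ : s₁ < s₂) (h₃ : s₂ < t) (h₄ : s₂ ≤ N)
    (h : (√C₀ + 8) * Real.log T * radius K (s₂ - s₁) <
      ∑ r ∈ Finset.Icc s₁ s₂, visibleGap μ lg a' a r) : a ∈ badArms C₀ T lg s t := by
  by_contra ha
  exact absurd (visibleGap_le hC hacc ha a' h₁ hs h₂ h₃ h₄) (not_le.2 h)

lemma visibleGap_le_gap (hμ : ∀ t a, μ t a ∈ Set.Icc (0 : ℝ) 1) {a' a : Fin K} {r : ℕ}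
    (ha : a ∈ (lg r).1) : visibleGap μ lg a' a r ≤ gap μ r a := by
  refine le_trans ?_ (sub_le_gap r a' a)
  rw [visibleGap, if_pos ha]
  have := (hμ r a').1
  split_ifs <;> linarith

/-- A candidate that stays in the game turns the visible gap into a bound for the gap. -/
lemma gap_sub_gap_le_visibleGap (hμ : ∀ t a, μ t a ∈ Set.Icc (0 : ℝ) 1) [NeZero K] {a' a : Fin K}
    {r : ℕ} (ha' : a' ∈ (lg r).1) :
    (if a ∈ (lg r).1 then gap μ r a else 0) - gap μ r a' ≤ visibleGap μ lg a' a r := by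
  rw [visibleGap, if_pos ha', gap_eq, gap_eq]
  have h₁ : 0 ≤ ⨆ a', μ r a' :=
    (hμ r a').1.trans (le_ciSup (f := fun a => μ r a) (Set.finite_range _).bddAbove a')
  split_ifs <;> linarith

/-- A variant in which `a` need not be a candidate: an arm that is not seen looks even worse. -/
lemma gap_sub_gap_le_visibleGap' (hμ : ∀ t a, μ t a ∈ Set.Icc (0 : ℝ) 1) [NeZero K]
    {a' a : Fin K} {r : ℕ} (ha' : a' ∈ (lg r).1) :
    gap μ r a - gap μ r a' ≤ visibleGap μ lg a' a r := by
  rw [visibleGap, if_pos ha', gap_eq, gap_eq]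
  have h₁ := (hμ r a).1
  split_ifs <;> linarith

end accurate

section isRun

variable {K : ℕ} {C₀ : ℝ} {T N : ℕ} {b : ℕ × ℕ × ℕ → Bool}
  {lg : ℕ → Finset (Fin K) × Fin K × ℝ} {e : ℕ → ℕ}

lemma IsRun.episode_mem (h : IsRun C₀ T N b lg e) {t : ℕ} (h₁ : 1 ≤ t) (h₂ : t ≤ N) :
    1 ≤ e t ∧ e t ≤ t := by
  induction t, h₁ using Nat.le_induction with
  | base => rw [h.first]; exact ⟨le_rfl, le_rfl⟩
  | succ t ht ih =>
    have := ih (by omega)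
    rw [h.next t ht (by omega), nextEpisodeStart]
    split_ifs <;> omega

lemma IsRun.episode_succ (h : IsRun C₀ T N b lg e) {t : ℕ} (h₁ : 1 ≤ t) (h₂ : t < N) :
    e (t + 1) = t + 1 ∧ badArms C₀ T lg (e t) (t + 1) = Finset.univ ∨ e (t + 1) = e t := by
  rw [h.next t h₁ h₂, nextEpisodeStart]
  split_ifs with h'
  · exact Or.inl ⟨rfl, h'.2⟩
  · exact Or.inr rfl

lemma IsRun.episode_eq (h : IsRun C₀ T N b lg e) {t r : ℕ} (h₁ : 1 ≤ t) (h₂ : t ≤ N)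
    (hr : e t ≤ r) (hrt : r ≤ t) : e r = e t := by
  induction t, h₁ using Nat.le_induction with
  | base =>
    rw [h.first] at hr
    rw [show r = 1 by omega]
  | succ t ht ih =>
    rcases Nat.lt_or_ge t r with h' | h'
    · rw [show r = t + 1 by omega]
    · rcases h.episode_succ ht (by omega) with ⟨h₃, -⟩ | h₃
      · omega
      · rw [h₃] at hr ⊢
        exact ih (by omega) hr h'

/-- The start of the instance active at round `t` is a round of the same episode. -/
lemma IsRun.start_mem (h : IsRun C₀ T N b lg e) {t : ℕ} (h₁ : 1 ≤ t) (h₂ : t ≤ N) :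
    e t ≤ replayStart b T (e t) t ∧ replayStart b T (e t) t ≤ t :=
  ⟨le_replayStart (h.episode_mem h₁ h₂).2, replayStart_le⟩

lemma IsRun.mem_arms (h : IsRun C₀ T N b lg e) {t : ℕ} (h₁ : 1 ≤ t) (h₂ : t ≤ N) {a : Fin K} :
    a ∈ (lg t).1 ↔ a ∉ badArms C₀ T lg (replayStart b T (e t) t) t := by
  rw [h.arms t h₁ h₂]
  simp

/-- An instance is resumed only if not all arms were evicted from the master set. -/
lemma IsRun.badArms_ne_univ (h : IsRun C₀ T N b lg e) [NeZero K] {t : ℕ} (h₁ : 1 ≤ t)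
    (h₂ : t ≤ N) (h₃ : t = e t ∨ replayStart b T (e t) t < t) :
    badArms C₀ T lg (e t) t ≠ Finset.univ := by
  rcases (h.episode_mem h₁ h₂).2.eq_or_lt with h₄ | h₄
  · rw [h₄, badArms_self (by omega)]
    exact Finset.univ_nonempty.ne_empty.symm
  · have h₃ : replayStart b T (e t) t < t := by omega
    intro hbad
    have he := h.episode_mem h₁ h₂
    obtain ⟨s, rfl⟩ : ∃ s, t = s + 1 := ⟨t - 1, by omega⟩
    have hes : e s = e (s + 1) := h.episode_eq h₁ h₂ (by omega) (Nat.le_succ s)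
    have hnext := h.next s (by omega) (by omega)
    rw [hes, nextEpisodeStart, if_pos] at hnext
    · omega
    · refine ⟨fun j hj => ?_, hbad⟩
      by_contra hb
      have := le_replayStart_of_replay h₄ le_rfl hj (by simpa using hb) (Nat.le_add_right _ _)
      omega

end isRun

section safe

variable {K : ℕ} [NeZero K] {C₀ : ℝ} {T N : ℕ} {μ : ℕ → Fin K → ℝ} {b : ℕ × ℕ × ℕ → Bool}
  {lg : ℕ → Finset (Fin K) × Fin K × ℝ} {e φ : ℕ → ℕ} {safe : ℕ → Fin K}

lemma log_two_lt (hT : 2 ≤ T) : (0.69 : ℝ) < Real.log T := by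
  have h : Real.log 2 ≤ Real.log T := Real.log_le_log two_pos (by exact_mod_cast hT)
  linarith [Real.log_two_gt_d9]

/-- A safe arm is not recognized as bad if it was a candidate all the time. -/
lemma safe_notMem_badArms (hC : 100 ≤ C₀) (hT : 2 ≤ T) (hμ : ∀ t a, μ t a ∈ Set.Icc (0 : ℝ) 1)
    (hφ : SafePhases μ N φ safe) (hacc : Accurate T N μ lg) {s t p : ℕ} (hs : 1 ≤ s)
    (ht : t ≤ N + 1) (hp : ∀ r, s ≤ r → r < t → φ r = p ∧ safe p ∈ (lg r).1) :
    safe p ∉ badArms C₀ T lg s t := by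
  intro hbad
  obtain ⟨s₁, s₂, a', h₁, h₂, h₃, h⟩ := exists_of_mem_badArms (by linarith) hacc hbad hs ht
  have h₄ : ∑ r ∈ Finset.Icc s₁ s₂, visibleGap μ lg a' (safe p) r ≤
      ∑ r ∈ Finset.Icc s₁ s₂, gap μ r (safe p) := by
    refine Finset.sum_le_sum fun r hr => visibleGap_le_gap hμ (hp r ?_ ?_).2
    · exact h₁.trans (Finset.mem_Icc.1 hr).1
    · exact (Finset.mem_Icc.1 hr).2.trans_lt h₃
  have h₅ := hφ.lt s₁ s₂ (by omega) h₂ (by omega) (by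
    rw [(hp s₁ h₁ (by omega)).1, (hp s₂ (by omega) h₃).1])
  rw [(hp s₁ h₁ (by omega)).1] at h₅
  have h₆ := sqrt_le_radius (K := K) (n := s₂ - s₁)
  have h₇ : 10 ≤ √C₀ := Real.le_sqrt_of_sq_le (by norm_num; exact hC)
  have h₈ := log_two_lt hT
  -- `√C₀ ≥ 10` makes the threshold for evictions exceed the errors and the regret of a safe arm.
  have h₉ : 1 ≤ (√C₀ - 8) * Real.log T := by nlinarith
  nlinarith [radius_pos (K := K) (n := s₂ - s₁)]

/-- If the active instance was started in the current phase, then the safe arm of the phase is one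
of its candidates. -/
lemma safe_mem_arms (hC : 100 ≤ C₀) (hT : 2 ≤ T) (hμ : ∀ t a, μ t a ∈ Set.Icc (0 : ℝ) 1)
    (hφ : SafePhases μ N φ safe) (hacc : Accurate T N μ lg) (hrun : IsRun C₀ T N b lg e) {t : ℕ}
    (h₁ : 1 ≤ t) (h₂ : t ≤ N) (h : φ (replayStart b T (e t) t) = φ t) :
    safe (φ t) ∈ (lg t).1 := by
  induction t using Nat.strong_induction_on with
  | _ t ih =>
  have he := hrun.episode_mem h₁ h₂
  have hs := hrun.start_mem h₁ h₂
  rw [hrun.mem_arms h₁ h₂]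
  refine safe_notMem_badArms hC hT hμ hφ hacc (by omega) (by omega) fun r hr hrt => ?_
  have h₃ : e r = e t := hrun.episode_eq h₁ h₂ (hs.1.trans hr) hrt.le
  have h₄ : φ r = φ t := le_antisymm (hφ.mono hrt.le) (h ▸ hφ.mono hr)
  refine ⟨h₄, h₄ ▸ ih r hrt (by omega) (by omega) ?_⟩
  have h₅ := replayStart_nested (b := b) (T := T) he.2 hr hrt.le
  rw [h₃]
  refine le_antisymm (hφ.mono replayStart_le) ?_
  rw [h₄, ← h]
  exact hφ.mono h₅

/-- An episode that ends does not lie within a phase. -/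
lemma label_episode_ne (hC : 100 ≤ C₀) (hT : 2 ≤ T) (hμ : ∀ t a, μ t a ∈ Set.Icc (0 : ℝ) 1)
    (hφ : SafePhases μ N φ safe) (hacc : Accurate T N μ lg) (hrun : IsRun C₀ T N b lg e) {t : ℕ}
    (h₁ : 1 ≤ t) (h₂ : t < N) (h : e (t + 1) ≠ e t) : φ (e t) ≠ φ t := by
  intro hp
  have hbad : badArms C₀ T lg (e t) (t + 1) = Finset.univ := by
    rcases hrun.episode_succ h₁ h₂ with h' | h'
    · exact h'.2
    · exact absurd h' h
  have he := hrun.episode_mem h₁ h₂.le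
  refine safe_notMem_badArms hC hT hμ hφ hacc he.1 (by omega) (p := φ t) (fun r hr hrt => ?_)
    (hbad ▸ Finset.mem_univ _)
  have h₃ : e r = e t := hrun.episode_eq h₁ h₂.le hr (by omega)
  have h₄ : φ r = φ t := le_antisymm (hφ.mono (by omega)) (hp ▸ hφ.mono hr)
  refine ⟨h₄, h₄ ▸ safe_mem_arms hC hT hμ hφ hacc hrun (by omega) (by omega) ?_⟩
  have h₅ := (hrun.start_mem (t := r) (by omega) (by omega)).1
  refine le_antisymm (hφ.mono replayStart_le) ?_
  rw [h₄, ← hp]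
  exact hφ.mono (h₃ ▸ h₅)

/-- A phase meets at most two episodes. -/
lemma card_episodes_le_two (hC : 100 ≤ C₀) (hT : 2 ≤ T) (hμ : ∀ t a, μ t a ∈ Set.Icc (0 : ℝ) 1)
    (hφ : SafePhases μ N φ safe) (hacc : Accurate T N μ lg) (hrun : IsRun C₀ T N b lg e) (p : ℕ) :
    (((Finset.Icc 1 N).filter fun t => φ t = p).image e).card ≤ 2 := by
  by_contra hcard
  set S := (Finset.Icc 1 N).filter fun t => φ t = p with hS
  have hne : S.Nonempty := by
    rw [Finset.nonempty_iff_ne_empty]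
    intro h
    rw [h] at hcard
    simp at hcard
  have hmin := S.min'_mem hne
  have hmax := S.max'_mem hne
  have : ∃ x ∈ S.image e, x ≠ e (S.min' hne) ∧ x ≠ e (S.max' hne) := by
    by_contra! h
    refine hcard ((Finset.card_le_card (t := {e (S.min' hne), e (S.max' hne)}) ?_).trans
      Finset.card_le_two)
    intro x hx
    simp only [Finset.mem_insert, Finset.mem_singleton]
    by_cases hx' : x = e (S.min' hne)
    · exact Or.inl hx'
    · exact Or.inr (h x hx hx')
  obtain ⟨x, hx, h₁, h₂⟩ := this
  obtain ⟨t, ht, rfl⟩ := Finset.mem_image.1 hx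
  have hmem : ∀ r ∈ S, (1 ≤ r ∧ r ≤ N) ∧ φ r = p := fun r hr => by
    rwa [hS, Finset.mem_filter, Finset.mem_Icc] at hr
  have ht' := hmem t ht
  replace hmin := hmem _ hmin
  replace hmax := hmem _ hmax
  have hmint := S.min'_le t ht
  have hmaxt := S.le_max' t ht
  set t₀ := S.min' hne
  set t₁ := S.max' hne
  -- the last round `z` of the episode of `t`
  set Z := (Finset.Icc t t₁).filter fun r => e r = e t
  have hZne : Z.Nonempty := ⟨t, Finset.mem_filter.2 ⟨Finset.mem_Icc.2 ⟨le_rfl, hmaxt⟩, rfl⟩⟩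
  have hz := Finset.mem_filter.1 (Z.max'_mem hZne)
  have hzmax : ∀ r ∈ Z, r ≤ Z.max' hZne := fun r hr => Z.le_max' r hr
  set z := Z.max' hZne
  rw [Finset.mem_Icc] at hz
  have hzt : z < t₁ := by
    rcases hz.1.2.eq_or_lt with h | h
    · rw [h] at hz; exact absurd hz.2.symm h₂
    · exact h
  have hnext : e (z + 1) ≠ e z := by
    intro h
    have := hzmax (z + 1) (Finset.mem_filter.2 ⟨Finset.mem_Icc.2 ⟨by omega, by omega⟩,
      by rw [h, hz.2]⟩)
    omega
  refine label_episode_ne hC hT hμ hφ hacc hrun (t := z) (by omega) (by omega) hnext ?_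
  have h₃ : t₀ ≤ e z := by
    by_contra! h
    have := hrun.episode_eq (t := z) (r := t₀) (by omega) (by omega) h.le (by omega)
    rw [hz.2] at this
    exact h₁ this.symm
  have h₄ := (hrun.episode_mem (t := z) (by omega) (by omega)).2
  have h₅ : φ z = p := le_antisymm (hmax.2 ▸ hφ.mono hzt.le) (ht'.2 ▸ hφ.mono hz.1.1)
  rw [h₅]
  exact le_antisymm (h₅ ▸ hφ.mono h₄) (hmin.2 ▸ hφ.mono h₃)

end safe

/-! ### The regret of an arm that is never evicted -/

/-- On an interval, a label that increases is constant on intervals. -/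
lemma exists_filter_eq_Ico {φ : ℕ → ℕ} (hφ : Monotone φ) {e w p : ℕ}
    (hp : p ∈ (Finset.Ico e w).image φ) : ∃ u v, e ≤ u ∧ u < v ∧ v ≤ w ∧
      (Finset.Ico e w).filter (fun r => φ r = p) = Finset.Ico u v ∧
      (u = e ∨ φ (u - 1) ≠ φ u) := by
  obtain ⟨r, hr, hrp⟩ := Finset.mem_image.1 hp
  set F := (Finset.Ico e w).filter (fun r => φ r = p) with hF
  have hne : F.Nonempty := ⟨r, Finset.mem_filter.2 ⟨hr, hrp⟩⟩
  have hmem : ∀ s, s ∈ F ↔ (e ≤ s ∧ s < w) ∧ φ s = p := fun s => by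
    rw [hF, Finset.mem_filter, Finset.mem_Ico]
  have hu := (hmem _).1 (F.min'_mem hne)
  have hv := (hmem _).1 (F.max'_mem hne)
  have hle : F.min' hne ≤ F.max' hne := F.min'_le_max' hne
  refine ⟨F.min' hne, F.max' hne + 1, hu.1.1, by omega, by omega, ?_, ?_⟩
  · ext s
    rw [Finset.mem_Ico]
    constructor
    · intro hs
      exact ⟨F.min'_le s hs, Nat.lt_succ_of_le (F.le_max' s hs)⟩
    · rintro ⟨h₁, h₂⟩
      refine (hmem s).2 ⟨⟨by omega, by omega⟩, ?_⟩
      exact le_antisymm (hv.2 ▸ hφ (Nat.lt_succ_iff.1 h₂)) (hu.2 ▸ hφ h₁)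
  · by_contra! h
    have := F.min'_le (F.min' hne - 1) ((hmem _).2 ⟨⟨by omega, by omega⟩, by rw [h.2, hu.2]⟩)
    omega

section threshold

variable {K : ℕ} {C₀ : ℝ} {T : ℕ}

lemma segThreshold_mono (hT : 2 ≤ T) : Monotone (segThreshold K C₀ T) := by
  intro n m h
  have := log_two_lt hT
  have h₁ := radius_mono (K := K) h
  unfold segThreshold
  gcongr

lemma segThreshold_nonneg (hT : 2 ≤ T) (n : ℕ) : 0 ≤ segThreshold K C₀ T n := by
  have := log_two_lt hT
  have h₁ : 0 ≤ radius K n := Real.sqrt_nonneg _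
  unfold segThreshold
  positivity

/-- A segment that is completed is long. -/
lemma le_of_isSegEnd [NeZero K] (hT : 2 ≤ T) {x : ℕ → ℝ} (hx : ∀ r, x r ≤ 1) {φ : ℕ → ℕ}
    {e t : ℕ} (het : e ≤ t) (h : IsSegEnd x (segThreshold K C₀ T) φ e t) :
    4 * K ≤ t - segStart x (segThreshold K C₀ T) φ e t := by
  have hm := segStart_mem (x := x) (θ := segThreshold K C₀ T) (φ := φ) het
  unfold IsSegEnd at h
  set s := segStart x (segThreshold K C₀ T) φ e t
  have h₁ : ∑ r ∈ Finset.Icc s t, x r ≤ ((t - s : ℕ) : ℝ) + 1 := by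
    refine (Finset.sum_le_card_nsmul _ _ 1 fun r _ => hx r).trans ?_
    rw [Nat.card_Icc, nsmul_eq_mul, mul_one, show t + 1 - s = t - s + 1 by omega]
    push_cast
    exact le_rfl
  have h₂ := log_two_lt hT
  have h₃ := le_radius (K := K) (n := t - s)
  have h₄ : (1 : ℝ) ≤ K := by exact_mod_cast NeZero.pos K
  have h₅ : 13 * (K : ℝ) ≤ segThreshold K C₀ T (t - s) := by
    unfold segThreshold
    have : 13 ≤ (2 * √C₀ + 20) * Real.log T := by nlinarith [Real.sqrt_nonneg C₀]
    nlinarith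
  have h₆ : (4 * K : ℝ) ≤ (t - s : ℕ) := by linarith
  exact_mod_cast h₆

end threshold

lemma mem_segEnds {K : ℕ} {C₀ : ℝ} {T : ℕ} {μ : ℕ → Fin K → ℝ} {φ : ℕ → ℕ} {e₀ w t : ℕ}
    {a : Fin K} : t ∈ segEnds C₀ T μ φ e₀ a w ↔
    (e₀ ≤ t ∧ t < w) ∧ IsSegEnd (fun t => gap μ t a) (segThreshold K C₀ T) φ e₀ t := by
  classical rw [segEnds, Finset.mem_filter, Finset.mem_Ico]

section detection

variable {K : ℕ} [NeZero K] {C₀ : ℝ} {T N : ℕ} {μ : ℕ → Fin K → ℝ} {b : ℕ × ℕ × ℕ → Bool}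
  {lg : ℕ → Finset (Fin K) × Fin K × ℝ} {e φ : ℕ → ℕ} {safe : ℕ → Fin K}

/-- A detecting replay reveals that the arm is bad: while it runs, the safe arm of the phase is
always a candidate, so that the relative gap of the bad arm to the safe one becomes visible on the
last three quarters of the segment. -/
lemma mem_badArms_of_detectingReplay (hC : 100 ≤ C₀) (hT : 2 ≤ T) (hN : N ≤ T)
    (hμ : ∀ t a, μ t a ∈ Set.Icc (0 : ℝ) 1) (hφ : SafePhases μ N φ safe)
    (hacc : Accurate T N μ lg) (hrun : IsRun C₀ T N b lg e) {a : Fin K} {w : ℕ} {q : ℕ × ℕ}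
    (hw : 1 ≤ w) (hwN : w ≤ N) (hq : q ∈ detectingReplays C₀ T μ φ (e w) a w)
    (hb : b (e w, q.1, q.2) = true) : a ∈ badArms C₀ T lg (e w) w := by
  obtain ⟨t, ht, hq⟩ := Finset.mem_biUnion.1 hq
  obtain ⟨⟨het, htw⟩, hend⟩ := mem_segEnds.1 ht
  rw [Finset.mem_product, Finset.mem_Ioc, Finset.mem_singleton] at hq
  have hm := segStart_mem (x := fun t => gap μ t a) (θ := segThreshold K C₀ T) (φ := φ) het
  have hn := le_of_isSegEnd hT (gap_le_one hμ · a) het hend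
  have hlab := segStart_label (x := fun t => gap μ t a) (θ := segThreshold K C₀ T) (φ := φ) het
  have hlow : ∀ u, armSegStart C₀ T μ φ (e w) a t ≤ u → u < t → _ := fun u h₁ h₂ =>
    sum_lt_of_segStart_le (x := fun t => gap μ t a) (θ := segThreshold K C₀ T) (φ := φ) het h₁ h₂
  unfold IsSegEnd at hend
  change 4 * K ≤ t - armSegStart C₀ T μ φ (e w) a t at hn
  change φ (armSegStart C₀ T μ φ (e w) a t) = _ at hlab
  change _ ≤ armSegStart C₀ T μ φ (e w) a t ∧ armSegStart C₀ T μ φ (e w) a t ≤ _ at hm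
  change segThreshold K C₀ T (t - armSegStart C₀ T μ φ (e w) a t) ≤
    ∑ r ∈ Finset.Icc (armSegStart C₀ T μ φ (e w) a t) t, gap μ r a at hend
  change ∀ u, armSegStart C₀ T μ φ (e w) a t ≤ u → u < t →
    ∑ r ∈ Finset.Icc (armSegStart C₀ T μ φ (e w) a t) u, gap μ r a <
      segThreshold K C₀ T (u - armSegStart C₀ T μ φ (e w) a t) at hlow
  set x := armSegStart C₀ T μ φ (e w) a t
  set n := t - x with hn_def
  have hK : 1 ≤ K := NeZero.pos K
  have he₁ := (hrun.episode_mem hw hwN).1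
  set u := x + n / 4 with hu
  have hut : u + 1 < t := by omega
  -- the safe arm is a candidate while the replay runs
  have hsafe : ∀ r, u + 1 ≤ r → r ≤ t → safe (φ t) ∈ (lg r).1 := by
    intro r hr hrt
    have her : e r = e w := hrun.episode_eq hw hwN (by omega) (by omega)
    have hφr : φ r = φ t := le_antisymm (hφ.mono hrt) (hlab ▸ hφ.mono (by omega))
    rw [← hφr]
    refine safe_mem_arms hC hT hμ hφ hacc hrun (by omega) (by omega) ?_
    refine le_antisymm (hφ.mono replayStart_le) ?_
    rw [hφr, ← hlab]
    refine hφ.mono (le_trans (b := q.1) (by omega) ?_)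
    rw [her]
    refine le_replayStart_of_replay (j := q.2) (by omega) (by omega) ?_ hb ?_
    · rw [hq.2, Finset.mem_Icc]
      exact ⟨Nat.clog_pos (by norm_num) (by omega), Nat.clog_mono_right 2 (by omega)⟩
    · have : n ≤ 2 ^ Nat.clog 2 n := Nat.le_pow_clog (by norm_num) n
      rw [hq.2]
      omega
  have hlow' := hlow u (by omega) (by omega)
  have hsum : ∑ r ∈ Finset.Icc x u, gap μ r a + ∑ r ∈ Finset.Icc (u + 1) t, gap μ r a =
      ∑ r ∈ Finset.Icc x t, gap μ r a := by
    have := Finset.sum_Ico_consecutive (fun r => gap μ r a) (show x ≤ u + 1 by omega)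
      (show u + 1 ≤ t + 1 by omega)
    exact this
  have hgap := hφ.lt (u + 1) t (by omega) hut (by omega)
    (le_antisymm (hφ.mono (by omega)) (hlab ▸ hφ.mono (by omega)))
  have hφu : φ (u + 1) = φ t := le_antisymm (hφ.mono (by omega)) (hlab ▸ hφ.mono (by omega))
  rw [hφu] at hgap
  refine mem_badArms_of_lt (by linarith) hacc (s₁ := u + 1) (s₂ := t) (a' := safe (φ t))
    (by omega) (by omega) hut htw (by omega) ?_
  have h₁ : ∑ r ∈ Finset.Icc (u + 1) t, gap μ r a - ∑ r ∈ Finset.Icc (u + 1) t,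
      gap μ r (safe (φ t)) ≤ ∑ r ∈ Finset.Icc (u + 1) t, visibleGap μ lg (safe (φ t)) a r := by
    rw [← Finset.sum_sub_distrib]
    refine Finset.sum_le_sum fun r hr => gap_sub_gap_le_visibleGap' hμ ?_
    exact hsafe r (Finset.mem_Icc.1 hr).1 (Finset.mem_Icc.1 hr).2
  have h₂ := sqrt_le_radius (K := K) (n := t - (u + 1))
  have h₃ : radius K (t - (u + 1)) ≤ radius K n := radius_mono (by omega)
  -- A quarter of the rounds has half the radius, so that at most half the threshold was reached in
  -- the first quarter; the other half, `(√C₀ + 10) log T` radii, has to be seen by the replay.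
  have h₄ := radius_div_four hn
  have h₅ := log_two_lt hT
  have h₆ := radius_pos (K := K) (n := n)
  rw [show u - x = n / 4 by omega] at hlow'
  unfold segThreshold at hlow' hend
  have h₇ : (2 * √C₀ + 20) * Real.log T * radius K (n / 4) ≤
      (2 * √C₀ + 20) * Real.log T * (radius K n / 2) := by gcongr
  have h₈ : (√C₀ + 8) * Real.log T * radius K (t - (u + 1)) ≤
      (√C₀ + 8) * Real.log T * radius K n := by gcongr
  nlinarith [mul_lt_mul_of_pos_right h₅ h₆]

/-- The expected number of replays that detect a completed segment of `n + 1` rounds. -/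
lemma sum_replayProb_ge {e₀ w x n : ℕ} (hn : 4 ≤ n) (hx : e₀ ≤ x) (hw : x + n < w) :
    √(n : ℝ) / (12 * √((w - e₀ : ℕ) : ℝ)) ≤
      ∑ s ∈ Finset.Ioc x (x + n / 4), replayProb e₀ s (Nat.clog 2 n) := by
  have h₁ : ((2 : ℝ) ^ Nat.clog 2 n) ≤ 2 * n := by
    have h := Nat.pow_pred_clog_lt_self (b := 2) (by norm_num) (show 1 < n by omega)
    have h' : 1 ≤ Nat.clog 2 n := Nat.clog_pos (by norm_num) (by omega)
    have : 2 ^ Nat.clog 2 n ≤ 2 * n := by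
      obtain ⟨j, hj⟩ : ∃ j, Nat.clog 2 n = j + 1 := ⟨Nat.clog 2 n - 1, by omega⟩
      rw [hj] at h ⊢
      simp only [Nat.pred_eq_sub_one, Nat.add_sub_cancel] at h
      rw [pow_succ]
      omega
    exact_mod_cast this
  have hn' : (0 : ℝ) < n := by exact_mod_cast (show 0 < n by omega)
  have hW : (0 : ℝ) < (w - e₀ : ℕ) := by exact_mod_cast (show 0 < w - e₀ by omega)
  have h₂ : ∀ s ∈ Finset.Ioc x (x + n / 4),
      1 / (√(2 * n) * √((w - e₀ : ℕ) : ℝ)) ≤ replayProb e₀ s (Nat.clog 2 n) := by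
    intro s hs
    rw [Finset.mem_Ioc] at hs
    have hs₁ : (0 : ℝ) < (s : ℝ) - e₀ := by
      rw [sub_pos]; exact_mod_cast (show e₀ < s by omega)
    have hs₂ : (s : ℝ) - e₀ ≤ (w - e₀ : ℕ) := by
      rw [Nat.cast_sub (by omega)]
      gcongr
      omega
    unfold replayProb
    rw [← Real.sqrt_mul (by positivity)]
    refine one_div_le_one_div_of_le (Real.sqrt_pos.2 (by positivity)) (Real.sqrt_le_sqrt ?_)
    gcongr
  refine le_trans ?_ (Finset.card_nsmul_le_sum _ _ _ h₂)
  rw [Nat.card_Ioc, nsmul_eq_mul, Nat.add_sub_cancel_left]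
  have h₃ : (n : ℝ) / 8 ≤ (n / 4 : ℕ) := by
    rw [div_le_iff₀ (by norm_num)]
    exact_mod_cast (show n ≤ n / 4 * 8 by omega)
  have h₄ : √(2 : ℝ) ≤ 3 / 2 := Real.sqrt_le_iff.2 ⟨by norm_num, by norm_num⟩
  have h₅ : √(n : ℝ) * √(n : ℝ) = n := Real.mul_self_sqrt hn'.le
  have h₆ : 0 < √(n : ℝ) := Real.sqrt_pos.2 hn'
  have h₇ : 0 < √((w - e₀ : ℕ) : ℝ) := Real.sqrt_pos.2 hW
  calc √(n : ℝ) / (12 * √((w - e₀ : ℕ) : ℝ))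
      ≤ (n / 8 : ℝ) * (1 / (√(2 * n) * √((w - e₀ : ℕ) : ℝ))) := by
        rw [Real.sqrt_mul (by norm_num : (0 : ℝ) ≤ 2), mul_one_div,
          div_le_div_iff₀ (by positivity) (by positivity)]
        have : √(n : ℝ) * (√2 * √(n : ℝ) * √((w - e₀ : ℕ) : ℝ)) =
          √2 * (n * √((w - e₀ : ℕ) : ℝ)) := by
            linear_combination (√2 * √((w - e₀ : ℕ) : ℝ)) * h₅
        rw [this]
        have h8 : 0 < n * √((w - e₀ : ℕ) : ℝ) := by positivity
        nlinarith
    _ ≤ _ := by gcongr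

/-- By the end of an episode, all segments of an arm that was not evicted are short in total. -/
lemma sum_sqrt_segments_le (hC : 100 ≤ C₀) (hT : 2 ≤ T) (hN : N ≤ T)
    (hμ : ∀ t a, μ t a ∈ Set.Icc (0 : ℝ) 1) (hφ : SafePhases μ N φ safe)
    (hacc : Accurate T N μ lg) (hb : GoodReplays C₀ T N μ φ b) (hrun : IsRun C₀ T N b lg e)
    {a : Fin K} {w : ℕ} (hw : 1 ≤ w) (hwN : w ≤ N) (ha : a ∉ badArms C₀ T lg (e w) w) :
    ∑ t ∈ segEnds C₀ T μ φ (e w) a w, √((t - armSegStart C₀ T μ φ (e w) a t : ℕ) : ℝ) ≤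
      48 * Real.log T * √((w - e w : ℕ) : ℝ) := by
  have he := hrun.episode_mem hw hwN
  rcases he.2.eq_or_lt with h | h
  · rw [segEnds, h]
    simp
  have hW : (0 : ℝ) < √((w - e w : ℕ) : ℝ) :=
    Real.sqrt_pos.2 (by exact_mod_cast (show 0 < w - e w by omega))
  have h₁ : ∑ q ∈ detectingReplays C₀ T μ φ (e w) a w, replayProb (e w) q.1 q.2 ≤
      4 * Real.log T := by
    rcases hb.detect (e w) a w he.1 he.2 hwN with h | ⟨q, hq, hbq⟩
    · exact h
    · exact absurd (mem_badArms_of_detectingReplay hC hT hN hμ hφ hacc hrun hw hwN hq hbq) ha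
  rw [detectingReplays, Finset.sum_biUnion] at h₁
  · have h₂ : ∀ t ∈ segEnds C₀ T μ φ (e w) a w,
        √((t - armSegStart C₀ T μ φ (e w) a t : ℕ) : ℝ) / (12 * √((w - e w : ℕ) : ℝ)) ≤ _ :=
      fun t ht => by
        obtain ⟨⟨het, htw⟩, hend⟩ := mem_segEnds.1 ht
        have hm := segStart_mem (x := fun t => gap μ t a) (θ := segThreshold K C₀ T) (φ := φ) het
        have hn := le_of_isSegEnd hT (gap_le_one hμ · a) het hend
        have hK : 1 ≤ K := NeZero.pos K
        exact sum_replayProb_ge (e₀ := e w) (w := w) (x := armSegStart C₀ T μ φ (e w) a t)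
          (n := t - armSegStart C₀ T μ φ (e w) a t) (le_trans (by omega) hn) hm.1 (by
            change _ + (t - segStart _ _ _ _ _) < w
            unfold armSegStart
            omega)
    have h₃ := Finset.sum_le_sum h₂
    rw [← Finset.sum_div, div_le_iff₀ (by positivity)] at h₃
    refine h₃.trans ?_
    have h₄ : ∑ t ∈ segEnds C₀ T μ φ (e w) a w,
        ∑ s ∈ Finset.Ioc (armSegStart C₀ T μ φ (e w) a t) (armSegStart C₀ T μ φ (e w) a t +
          (t - armSegStart C₀ T μ φ (e w) a t) / 4),
            replayProb (e w) s (Nat.clog 2 (t - armSegStart C₀ T μ φ (e w) a t)) ≤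
        4 * Real.log T := by
      refine le_trans (le_of_eq (Finset.sum_congr rfl fun t _ => ?_)) h₁
      rw [Finset.sum_product]
      simp
    nlinarith
  · intro t ht t' ht' hne
    obtain ⟨⟨het, htw⟩, hend⟩ := mem_segEnds.1 ht
    obtain ⟨⟨het', htw'⟩, hend'⟩ := mem_segEnds.1 ht'
    have hm := segStart_mem (x := fun t => gap μ t a) (θ := segThreshold K C₀ T) (φ := φ) het
    have hm' := segStart_mem (x := fun t => gap μ t a) (θ := segThreshold K C₀ T) (φ := φ) het'
    rw [Function.onFun, Finset.disjoint_left]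
    rintro ⟨s, j⟩ hq hq'
    simp only [Finset.mem_product, Finset.mem_Ioc, armSegStart] at hq hq'
    exact hne (eq_of_isSegEnd het het' hend hend' (s := s) hq.1.1.le (by omega) hq'.1.1.le
      (by omega))

/-- The regret of an arm that is not evicted, up to a round `w` of the episode. -/
lemma sum_gap_le (hC : 100 ≤ C₀) (hT : 2 ≤ T) (hN : N ≤ T)
    (hμ : ∀ t a, μ t a ∈ Set.Icc (0 : ℝ) 1) (hφ : SafePhases μ N φ safe)
    (hacc : Accurate T N μ lg) (hb : GoodReplays C₀ T N μ φ b) (hrun : IsRun C₀ T N b lg e)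
    {a : Fin K} {w : ℕ} (hw : 1 ≤ w) (hwN : w ≤ N) (ha : a ∉ badArms C₀ T lg (e w) w) :
    ∑ r ∈ Finset.Ico (e w) w, gap μ r a ≤
      96 * (2 * √C₀ + 20) * Real.log T ^ 2 * √((K : ℝ) * (w - e w : ℕ)) +
      (2 * √C₀ + 20) * Real.log T * ∑ p ∈ (Finset.Ico (e w) w).image φ,
        √((K : ℝ) * ((Finset.Ico (e w) w).filter fun r => φ r = p).card) := by
  classical
  have hlog := log_two_lt hT
  have he := hrun.episode_mem hw hwN
  have hK : (1 : ℝ) ≤ K := by exact_mod_cast NeZero.pos K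
  have hD : 13 ≤ (2 * √C₀ + 20) * Real.log T := by nlinarith [Real.sqrt_nonneg C₀]
  -- the contribution of the completed segments
  have hseg : ∑ t ∈ segEnds C₀ T μ φ (e w) a w,
      (segThreshold K C₀ T (t - armSegStart C₀ T μ φ (e w) a t) + 1) ≤
        96 * (2 * √C₀ + 20) * Real.log T ^ 2 * √((K : ℝ) * (w - e w : ℕ)) := by
    have h₁ := sum_sqrt_segments_le hC hT hN hμ hφ hacc hb hrun hw hwN ha
    have h₂ : ∀ t ∈ segEnds C₀ T μ φ (e w) a w,
        segThreshold K C₀ T (t - armSegStart C₀ T μ φ (e w) a t) + 1 ≤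
        2 * (2 * √C₀ + 20) * Real.log T * √(K : ℝ) *
          √((t - armSegStart C₀ T μ φ (e w) a t : ℕ) : ℝ) := by
      intro t ht
      obtain ⟨⟨het, htw⟩, hend⟩ := mem_segEnds.1 ht
      have hn : 4 * K ≤ t - armSegStart C₀ T μ φ (e w) a t :=
        le_of_isSegEnd hT (gap_le_one hμ · a) het hend
      have h₃ := le_radius (K := K) (n := t - armSegStart C₀ T μ φ (e w) a t)
      unfold segThreshold
      have h₄ : 1 ≤ (2 * √C₀ + 20) * Real.log T *
          radius K (t - armSegStart C₀ T μ φ (e w) a t) := by nlinarith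
      rw [radius_eq (by omega), Real.sqrt_mul (by positivity)] at h₄ ⊢
      linarith
    refine (Finset.sum_le_sum h₂).trans ?_
    rw [← Finset.mul_sum, Real.sqrt_mul (by positivity)]
    calc 2 * (2 * √C₀ + 20) * Real.log T * √(K : ℝ) *
        ∑ t ∈ segEnds C₀ T μ φ (e w) a w, √((t - armSegStart C₀ T μ φ (e w) a t : ℕ) : ℝ)
        ≤ 2 * (2 * √C₀ + 20) * Real.log T * √(K : ℝ) *
          (48 * Real.log T * √((w - e w : ℕ) : ℝ)) := by gcongr
      _ = _ := by ring
  -- the regret within one phase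
  have hphase : ∀ p ∈ (Finset.Ico (e w) w).image φ,
      ∑ r ∈ Finset.Ico (e w) w with φ r = p, gap μ r a ≤
        ∑ t ∈ segEnds C₀ T μ φ (e w) a w with φ t = p,
          (segThreshold K C₀ T (t - armSegStart C₀ T μ φ (e w) a t) + 1) +
        (2 * √C₀ + 20) * Real.log T *
          √((K : ℝ) * ((Finset.Ico (e w) w).filter fun r => φ r = p).card) := by
    intro p hp
    obtain ⟨u, v, heu, huv, hvw, hF, hu⟩ := exists_filter_eq_Ico hφ.mono hp
    have hlab : ∀ r, u ≤ r → r < v → φ r = p := fun r h₁ h₂ => by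
      have : r ∈ (Finset.Ico (e w) w).filter (fun r => φ r = p) := by
        rw [hF]; exact Finset.mem_Ico.2 ⟨h₁, h₂⟩
      exact (Finset.mem_filter.1 this).2
    have hstart : segStart (fun t => gap μ t a) (segThreshold K C₀ T) φ (e w) u = u := by
      rcases hu with hu | hu
      · rw [segStart_of_le hu.le, hu]
      · rcases heu.eq_or_lt with h | h
        · rw [segStart_of_le h.symm.le, h]
        · obtain ⟨u', rfl⟩ : ∃ u', u = u' + 1 := ⟨u - 1, by omega⟩
          exact segStart_succ_of_ne (by omega) (Ne.symm hu)
    rw [hF, Nat.card_Ico]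
    have hsub : ∑ t ∈ Finset.Ico u v with
        IsSegEnd (fun t => gap μ t a) (segThreshold K C₀ T) φ (e w) t,
          (segThreshold K C₀ T (t - armSegStart C₀ T μ φ (e w) a t) + 1) =
        ∑ t ∈ segEnds C₀ T μ φ (e w) a w with φ t = p,
          (segThreshold K C₀ T (t - armSegStart C₀ T μ φ (e w) a t) + 1) := by
      refine Finset.sum_congr ?_ fun _ _ => rfl
      rw [← hF, segEnds, Finset.filter_filter, Finset.filter_filter]
      exact Finset.filter_congr fun _ _ => and_comm
    rw [← hsub]
    rcases Nat.lt_or_ge (v - u) K with hlt | hge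
    · -- on short intervals the trivial bound suffices
      have h₁ : ∑ r ∈ Finset.Ico u v, gap μ r a ≤ ((v - u : ℕ) : ℝ) := by
        refine (Finset.sum_le_card_nsmul _ _ 1 fun r _ => gap_le_one hμ r a).trans ?_
        rw [Nat.card_Ico, nsmul_eq_mul, mul_one]
      have h₂ : ((v - u : ℕ) : ℝ) ≤ √((K : ℝ) * (v - u : ℕ)) := by
        refine Real.le_sqrt_of_sq_le ?_
        rw [sq]
        gcongr
      have h₃ : 0 ≤ ∑ t ∈ Finset.Ico u v with
          IsSegEnd (fun t => gap μ t a) (segThreshold K C₀ T) φ (e w) t,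
            (segThreshold K C₀ T (t - armSegStart C₀ T μ φ (e w) a t) + 1) :=
        Finset.sum_nonneg fun t _ => by
          have := segThreshold_nonneg (K := K) (C₀ := C₀) hT
            (t - armSegStart C₀ T μ φ (e w) a t)
          linarith
      nlinarith [Real.sqrt_nonneg ((K : ℝ) * (v - u : ℕ))]
    · refine (sum_le_segments (φ := φ) heu huv hstart (fun r h₁ h₂ => ?_) (gap_le_one hμ · a)
        (segThreshold_mono hT) (segThreshold_nonneg hT 0)).trans (add_le_add le_rfl ?_)
      · rw [hlab r h₁ h₂, hlab u le_rfl huv]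
      · refine (segThreshold_mono hT (show v - 1 - u ≤ v - u by omega)).trans ?_
        rw [segThreshold, radius_eq hge]
  have hmaps : ∀ r ∈ Finset.Ico (e w) w, φ r ∈ (Finset.Ico (e w) w).image φ :=
    fun r hr => Finset.mem_image_of_mem _ hr
  rw [← Finset.sum_fiberwise_of_maps_to hmaps]
  refine (Finset.sum_le_sum hphase).trans ?_
  rw [Finset.sum_add_distrib, ← Finset.mul_sum]
  refine add_le_add ?_ le_rfl
  rw [Finset.sum_fiberwise_of_maps_to fun t ht => ?_]
  · exact hseg
  · exact hmaps t (Finset.mem_filter.1 ht).1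

end detection

/-! ### The regret of an episode -/

/-- The mean gap of an arm drawn from the candidate set of round `t`. -/
def averageGap {K : ℕ} (μ : ℕ → Fin K → ℝ) (A : Finset (Fin K)) (t : ℕ) : ℝ :=
  (∑ a ∈ A, gap μ t a) / A.card

lemma averageGap_nonneg {K : ℕ} {μ : ℕ → Fin K → ℝ} (A : Finset (Fin K)) (t : ℕ) :
    0 ≤ averageGap μ A t :=
  div_nonneg (Finset.sum_nonneg fun _ _ => gap_nonneg _ _) (Nat.cast_nonneg _)

lemma averageGap_le_one {K : ℕ} [NeZero K] {μ : ℕ → Fin K → ℝ}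
    (hμ : ∀ t a, μ t a ∈ Set.Icc (0 : ℝ) 1) (A : Finset (Fin K)) (t : ℕ) :
    averageGap μ A t ≤ 1 := by
  refine div_le_one_of_le₀ ?_ (Nat.cast_nonneg _)
  refine (Finset.sum_le_card_nsmul _ _ 1 fun a _ => gap_le_one hμ t a).trans ?_
  rw [nsmul_eq_mul, mul_one]

lemma sqrt_sum_le_sum_sqrt {ι : Type*} (s : Finset ι) (f : ι → ℝ) (hf : ∀ i, 0 ≤ f i) :
    √(∑ i ∈ s, f i) ≤ ∑ i ∈ s, √(f i) := by
  classical
  induction s using Finset.induction_on with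
  | empty => simp
  | insert a s ha ih =>
    rw [Finset.sum_insert ha, Finset.sum_insert ha]
    refine (Real.sqrt_le_iff.2 ⟨by positivity, ?_⟩).trans (add_le_add le_rfl ih)
    have h := Finset.sum_nonneg fun i (_ : i ∈ s) => hf i
    nlinarith [Real.sq_sqrt (hf a), Real.sq_sqrt h,
      mul_nonneg (Real.sqrt_nonneg (f a)) (Real.sqrt_nonneg (∑ i ∈ s, f i))]

lemma clog_le_three_mul_log {T : ℕ} (hT : 2 ≤ T) : (Nat.clog 2 T : ℝ) ≤ 3 * Real.log T := by
  have h := Nat.pow_pred_clog_lt_self (b := 2) (by norm_num) (show 1 < T by omega)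
  have h₁ : 1 ≤ Nat.clog 2 T := Nat.clog_pos (by norm_num) hT
  obtain ⟨j, hj⟩ : ∃ j, Nat.clog 2 T = j + 1 := ⟨Nat.clog 2 T - 1, by omega⟩
  rw [hj] at h ⊢
  simp only [Nat.pred_eq_sub_one, Nat.add_sub_cancel] at h
  have h₂ : (j : ℝ) * Real.log 2 ≤ Real.log T := by
    rw [← Real.log_pow]
    exact Real.log_le_log (by positivity) (by exact_mod_cast h.le)
  have h₃ := log_two_lt hT
  have h₄ := Real.log_two_gt_d9
  push_cast
  nlinarith [(Nat.cast_nonneg j : (0 : ℝ) ≤ j)]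

/-- The rounds of an episode form an interval. -/
lemma IsRun.episode_eq_Icc {K : ℕ} {C₀ : ℝ} {T N : ℕ} {b : ℕ × ℕ × ℕ → Bool}
    {lg : ℕ → Finset (Fin K) × Fin K × ℝ} {e : ℕ → ℕ} (hrun : IsRun C₀ T N b lg e) {e₀ : ℕ}
    (he₀ : e₀ ∈ (Finset.Icc 1 N).image e) : ∃ z, 1 ≤ e₀ ∧ e₀ ≤ z ∧ z ≤ N ∧
      (Finset.Icc 1 N).filter (fun t => e t = e₀) = Finset.Icc e₀ z := by
  obtain ⟨t, ht, hte⟩ := Finset.mem_image.1 he₀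
  set S := (Finset.Icc 1 N).filter (fun t => e t = e₀) with hS
  have hne : S.Nonempty := ⟨t, Finset.mem_filter.2 ⟨ht, hte⟩⟩
  have hmem : ∀ s, s ∈ S ↔ (1 ≤ s ∧ s ≤ N) ∧ e s = e₀ := fun s => by
    rw [hS, Finset.mem_filter, Finset.mem_Icc]
  have hz := (hmem _).1 (S.max'_mem hne)
  have hez := hrun.episode_mem hz.1.1 hz.1.2
  rw [hz.2] at hez
  refine ⟨S.max' hne, hez.1, hez.2, hz.1.2, ?_⟩
  ext s
  rw [hmem, Finset.mem_Icc]
  constructor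
  · intro hs
    exact ⟨hs.2 ▸ (hrun.episode_mem hs.1.1 hs.1.2).2, S.le_max' s ((hmem s).2 hs)⟩
  · rintro ⟨h₁, h₂⟩
    refine ⟨⟨by omega, by omega⟩, ?_⟩
    rw [hrun.episode_eq hz.1.1 hz.1.2 (by omega) h₂, hz.2]

section episode

variable {K : ℕ} {C₀ : ℝ} {T N : ℕ} {μ : ℕ → Fin K → ℝ} {b : ℕ × ℕ × ℕ → Bool}
  {lg : ℕ → Finset (Fin K) × Fin K × ℝ} {e φ : ℕ → ℕ} {safe : ℕ → Fin K}

/-- The cost of a single arm in the rounds in which the instance started at round `s` is active: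
while the arm is not evicted by that instance, it is not much worse than an arm `a₀` that is always
a candidate, unless that arm is bad as well. -/
lemma sum_gap_instance_le [NeZero K] (hC : 100 ≤ C₀) (hT : 2 ≤ T)
    (hμ : ∀ t a, μ t a ∈ Set.Icc (0 : ℝ) 1) (hacc : Accurate T N μ lg)
    {s m : ℕ} (hs : 1 ≤ s) (hm : m ≤ N) {I : Finset ℕ} (hI : ∀ t ∈ I, s ≤ t ∧ t ≤ m ∧
      (lg t).1 = Finset.univ \ badArms C₀ T lg s t)
    {a₀ : Fin K} (ha₀ : ∀ t ∈ I, s < t → ∀ r, s ≤ r → r < t → a₀ ∈ (lg r).1) (a : Fin K) :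
    ∑ t ∈ I with a ∈ (lg t).1, gap μ t a ≤
      (√C₀ + 8) * Real.log T * radius K (m - s) + 2 + ∑ r ∈ Finset.Ico s m, gap μ r a₀ := by
  have hlog := log_two_lt hT
  have hrad := radius_pos (K := K) (n := m - s)
  have h₀ : 0 ≤ (√C₀ + 8) * Real.log T * radius K (m - s) := by positivity
  have h₀' : 0 ≤ ∑ r ∈ Finset.Ico s m, gap μ r a₀ := Finset.sum_nonneg fun _ _ => gap_nonneg _ _
  rcases (I.filter fun t => a ∈ (lg t).1).eq_empty_or_nonempty with hJ | hJ
  · rw [hJ, Finset.sum_empty]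
    linarith
  set J := I.filter fun t => a ∈ (lg t).1 with hJ_def
  have hu := Finset.mem_filter.1 (J.max'_mem hJ)
  have hmax : ∀ t ∈ J, t ≤ J.max' hJ := fun t ht => J.le_max' t ht
  set u := J.max' hJ
  obtain ⟨hsu, hum, hA⟩ := hI u hu.1
  have ha : a ∉ badArms C₀ T lg s u := by
    have := hu.2
    rw [hA] at this
    simpa using this
  have h₁ : ∑ t ∈ J, gap μ t a ≤
      ∑ r ∈ Finset.Ico s u, (if a ∈ (lg r).1 then gap μ r a else 0) + 1 := by
    have : J ⊆ insert u ((Finset.Ico s u).filter fun r => a ∈ (lg r).1) := by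
      intro t ht
      have ht' := Finset.mem_filter.1 ht
      rcases (hmax t ht).eq_or_lt with h | h
      · rw [h]; exact Finset.mem_insert_self _ _
      · exact Finset.mem_insert_of_mem (Finset.mem_filter.2
          ⟨Finset.mem_Ico.2 ⟨(hI t ht'.1).1, h⟩, ht'.2⟩)
    refine (Finset.sum_le_sum_of_subset_of_nonneg this fun _ _ _ => gap_nonneg _ _).trans ?_
    rw [Finset.sum_insert (by simp), Finset.sum_filter, add_comm]
    exact add_le_add le_rfl (gap_le_one hμ u a)
  rcases Nat.lt_or_ge (s + 1) u with hlt | hge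
  · have h₂ : ∑ r ∈ Finset.Ico s u, (if a ∈ (lg r).1 then gap μ r a else 0) ≤
        ∑ r ∈ Finset.Icc s (u - 1), visibleGap μ lg a₀ a r + ∑ r ∈ Finset.Ico s u, gap μ r a₀ := by
      have : Finset.Icc s (u - 1) = Finset.Ico s u := by
        ext r; rw [Finset.mem_Icc, Finset.mem_Ico]; omega
      rw [this, ← Finset.sum_add_distrib]
      refine Finset.sum_le_sum fun r hr => ?_
      rw [Finset.mem_Ico] at hr
      have := gap_sub_gap_le_visibleGap (μ := μ) hμ (a := a)
        (ha₀ u hu.1 (by omega) r hr.1 hr.2)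
      linarith
    have h₃ := visibleGap_le (by linarith) hacc ha a₀ hs le_rfl (show s < u - 1 by omega)
      (by omega) (by omega)
    have h₄ : radius K (u - 1 - s) ≤ radius K (m - s) := radius_mono (by omega)
    have h₅ : (√C₀ + 8) * Real.log T * radius K (u - 1 - s) ≤
        (√C₀ + 8) * Real.log T * radius K (m - s) := by gcongr
    have h₆ : ∑ r ∈ Finset.Ico s u, gap μ r a₀ ≤ ∑ r ∈ Finset.Ico s m, gap μ r a₀ :=
      Finset.sum_le_sum_of_subset_of_nonneg (Finset.Ico_subset_Ico_right hum)
        fun _ _ _ => gap_nonneg _ _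
    linarith
  · have h₂ : ∑ r ∈ Finset.Ico s u, (if a ∈ (lg r).1 then gap μ r a else 0) ≤ 1 := by
      refine (Finset.sum_le_card_nsmul _ _ 1 fun r _ => ?_).trans ?_
      · split_ifs
        · exact gap_le_one hμ r a
        · exact zero_le_one
      · rw [Nat.card_Ico, nsmul_eq_mul, mul_one]
        exact_mod_cast (show u - s ≤ 1 by omega)
    linarith

/-- The cost of all arms in the rounds in which the instance started at round `s` is active. -/
lemma sum_averageGap_instance_le [NeZero K] (hC : 100 ≤ C₀) (hT : 2 ≤ T) (hKT : K ≤ T)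
    (hμ : ∀ t a, μ t a ∈ Set.Icc (0 : ℝ) 1) (hacc : Accurate T N μ lg)
    {s m : ℕ} (hs : 1 ≤ s) (hm : m ≤ N) {I : Finset ℕ} (hI : ∀ t ∈ I, s ≤ t ∧ t ≤ m ∧
      (lg t).1 = Finset.univ \ badArms C₀ T lg s t)
    {a₀ : Fin K} (ha₀ : ∀ t ∈ I, s < t → ∀ r, s ≤ r → r < t → a₀ ∈ (lg r).1) :
    ∑ t ∈ I, averageGap μ (lg t).1 t ≤ (1 + Real.log T) *
      ((√C₀ + 13) * Real.log T * √((K : ℝ) * (max (m - s) 1 : ℕ)) +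
        ∑ r ∈ Finset.Ico s m, gap μ r a₀) := by
  have hlog := log_two_lt hT
  have hK : 1 ≤ K := NeZero.pos K
  have h₀' : 0 ≤ ∑ r ∈ Finset.Ico s m, gap μ r a₀ := Finset.sum_nonneg fun _ _ => gap_nonneg _ _
  set R := √((K : ℝ) * (max (m - s) 1 : ℕ)) with hR
  have hR1 : 1 ≤ R := by
    refine Real.one_le_sqrt.2 ?_
    exact_mod_cast Nat.mul_pos hK (lt_of_lt_of_le one_pos (le_max_right _ _))
  rcases Nat.lt_or_ge (m - s) K with hlt | hge
  · have h₁ : ∑ t ∈ I, averageGap μ (lg t).1 t ≤ 2 * (max (m - s) 1 : ℕ) := by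
      refine (Finset.sum_le_card_nsmul _ _ 1 fun t _ => averageGap_le_one hμ _ t).trans ?_
      rw [nsmul_eq_mul, mul_one]
      have : I.card ≤ m + 1 - s := by
        rw [← Nat.card_Icc]
        exact Finset.card_le_card fun t ht => Finset.mem_Icc.2 ⟨(hI t ht).1, (hI t ht).2.1⟩
      exact_mod_cast (show I.card ≤ 2 * max (m - s) 1 by omega)
    have h₂ : ((max (m - s) 1 : ℕ) : ℝ) ≤ R := by
      refine Real.le_sqrt_of_sq_le ?_
      rw [sq]
      gcongr
      exact max_le hlt.le hK
    have h₃ : 2 ≤ (√C₀ + 13) * Real.log T := by nlinarith [Real.sqrt_nonneg C₀]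
    have h₄ : 2 * R ≤ (√C₀ + 13) * Real.log T * R + ∑ r ∈ Finset.Ico s m, gap μ r a₀ := by
      nlinarith
    nlinarith
  · have h₁ := sum_average_le I (fun t => (lg t).1) (fun t a => gap μ t a)
      (fun t a => gap_nonneg t a)
      ((√C₀ + 8) * Real.log T * radius K (m - s) + 2 + ∑ r ∈ Finset.Ico s m, gap μ r a₀)
      (by have := radius_pos (K := K) (n := m - s); positivity)
      (fun t ht t' ht' htt' => by
        rw [(hI t ht).2.2, (hI t' ht').2.2]
        exact Finset.sdiff_subset_sdiff le_rfl (badArms_mono le_rfl htt'))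
      (sum_gap_instance_le hC hT hμ hacc hs hm hI ha₀)
    refine h₁.trans ?_
    have h₂ : radius K (m - s) = R := by
      rw [radius_eq hge, hR, max_eq_left (hK.trans hge)]
    rw [h₂]
    have h₃ : Real.log K ≤ Real.log T :=
      Real.log_le_log (by exact_mod_cast hK) (by exact_mod_cast hKT)
    have h₄ : 0 ≤ (√C₀ + 8) * Real.log T * R + 2 + ∑ r ∈ Finset.Ico s m, gap μ r a₀ := by
      positivity
    refine mul_le_mul (by linarith) ?_ h₄ (by linarith)
    nlinarith

/-- Up to a logarithmic factor, the replays of an episode cost as much as its outermost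
instance. -/
lemma sum_sqrt_replays_le (hb : GoodReplays C₀ T N μ φ b) {e₀ z : ℕ}
    (he₀ : 1 ≤ e₀) (hz : e₀ ≤ z) (hzN : z ≤ N) (U : Finset ℕ) (len : ℕ → ℕ)
    (hU : ∀ s ∈ U, e₀ ≤ s ∧ s ≤ z ∧ len s ≤ z + 1 - e₀ ∧ (s = e₀ ∨ e₀ < s ∧
      ∃ j ∈ Finset.Icc 1 (Nat.clog 2 T), b (e₀, s, j) = true ∧ len s ≤ 2 ^ j)) :
    ∑ s ∈ U, √((K : ℝ) * (len s : ℕ)) ≤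
      (1 + Nat.clog 2 T * (4 + 5 * Real.log T)) * √((K : ℝ) * (z + 1 - e₀ : ℕ)) := by
  set n := z + 1 - e₀ with hn
  set R := √((K : ℝ) * (n : ℕ)) with hR
  have hlog : 0 ≤ Real.log T := Real.log_natCast_nonneg T
  have h₁ : ∀ s ∈ U, √((K : ℝ) * (len s : ℕ)) ≤ (if s = e₀ then R else 0) +
      ∑ j ∈ Finset.Icc 1 (Nat.clog 2 T),
        if e₀ < s ∧ b (e₀, s, j) = true then √((K : ℝ) * (min (2 ^ j) n : ℕ)) else 0 := by
    intro s hs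
    obtain ⟨-, -, h₂, h₃⟩ := hU s hs
    have hnn : ∀ j ∈ Finset.Icc 1 (Nat.clog 2 T), 0 ≤
        if e₀ < s ∧ b (e₀, s, j) = true then √((K : ℝ) * (min (2 ^ j) n : ℕ)) else 0 :=
      fun j _ => by split_ifs <;> positivity
    rcases h₃ with h₃ | ⟨h₃, j, hj, hbj, hlen⟩
    · rw [if_pos h₃]
      refine le_trans ?_ (le_add_of_nonneg_right (Finset.sum_nonneg hnn))
      rw [hR]; gcongr
    · refine le_trans ?_ (le_add_of_nonneg_left (by split_ifs <;> positivity))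
      refine le_trans ?_ (Finset.single_le_sum hnn hj)
      rw [if_pos ⟨h₃, hbj⟩]
      gcongr
      exact le_min hlen h₂
  refine (Finset.sum_le_sum h₁).trans ?_
  rw [Finset.sum_add_distrib, Finset.sum_comm, add_mul, one_mul]
  refine add_le_add ?_ ?_
  · rw [Finset.sum_ite_eq']
    split_ifs
    · exact le_rfl
    · positivity
  · have h₂ : ∀ j ∈ Finset.Icc 1 (Nat.clog 2 T), ∑ s ∈ U,
        (if e₀ < s ∧ b (e₀, s, j) = true then √((K : ℝ) * (min (2 ^ j) n : ℕ)) else 0) ≤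
          (4 + 5 * Real.log T) * R := by
      intro j hj
      rw [← Finset.sum_filter, Finset.sum_const, nsmul_eq_mul]
      have h₃ := hb.count e₀ j 0 (n - 1) he₀ hj (Nat.zero_le _) (by omega)
      have h₄ : ((U.filter fun s => e₀ < s ∧ b (e₀, s, j) = true).card : ℝ) ≤
          ((Finset.Ioc (e₀ + 0) (e₀ + (n - 1))).filter fun s => b (e₀, s, j) = true).card := by
        refine Nat.cast_le.2 (Finset.card_le_card fun s hs => ?_)
        rw [Finset.mem_filter] at hs ⊢
        obtain ⟨-, h₄, -, -⟩ := hU s hs.1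
        exact ⟨Finset.mem_Ioc.2 ⟨by omega, by omega⟩, hs.2.2⟩
      have h₅ : √((K : ℝ) * (min (2 ^ j) n : ℕ)) ≤ R := by
        rw [hR]; gcongr; exact min_le_right _ _
      have h₆ : √((n - 1 - 0 : ℕ) / (2 : ℝ) ^ j) * √((K : ℝ) * (min (2 ^ j) n : ℕ)) ≤ R := by
        rw [← Real.sqrt_mul (by positivity), hR]
        refine Real.sqrt_le_sqrt ?_
        have h₇ : ((min (2 ^ j) n : ℕ) : ℝ) ≤ 2 ^ j := by exact_mod_cast min_le_left _ _
        have h₈ : ((n - 1 - 0 : ℕ) : ℝ) ≤ n := Nat.cast_le.2 (by omega)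
        rw [div_mul_eq_mul_div, div_le_iff₀ (by positivity)]
        calc ((n - 1 - 0 : ℕ) : ℝ) * ((K : ℝ) * (min (2 ^ j) n : ℕ))
            ≤ n * ((K : ℝ) * 2 ^ j) := by gcongr
          _ = _ := by ring
      have h₉ := h₄.trans h₃
      calc ((U.filter fun s => e₀ < s ∧ b (e₀, s, j) = true).card : ℝ) *
          √((K : ℝ) * (min (2 ^ j) n : ℕ))
          ≤ (4 * √((n - 1 - 0 : ℕ) / (2 : ℝ) ^ j) + 5 * Real.log T) *
            √((K : ℝ) * (min (2 ^ j) n : ℕ)) := by gcongr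
        _ = 4 * (√((n - 1 - 0 : ℕ) / (2 : ℝ) ^ j) * √((K : ℝ) * (min (2 ^ j) n : ℕ))) +
            5 * Real.log T * √((K : ℝ) * (min (2 ^ j) n : ℕ)) := by ring
        _ ≤ 4 * R + 5 * Real.log T * R := by gcongr
        _ = _ := by ring
    refine (Finset.sum_le_card_nsmul _ _ _ h₂).trans (le_of_eq ?_)
    rw [Nat.card_Icc, nsmul_eq_mul, Nat.add_sub_cancel]
    ring

/-- Every round lies in the span of few instances. -/
lemma card_running_le (hb : GoodReplays C₀ T N μ φ b) {e₀ r : ℕ} (he₀ : 1 ≤ e₀) (her : e₀ ≤ r)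
    (hrN : r ≤ N) (U : Finset ℕ) (hU : ∀ s ∈ U, e₀ ≤ s ∧ s ≤ r ∧ (s = e₀ ∨ e₀ < s ∧
      ∃ j ∈ Finset.Icc 1 (Nat.clog 2 T), b (e₀, s, j) = true ∧ r < s + 2 ^ j)) :
    (U.card : ℝ) ≤ 1 + Nat.clog 2 T * (4 + 5 * Real.log T) := by
  set V : ℕ → Finset ℕ := fun j => (Finset.Ioc (e₀ + (r - e₀ - 2 ^ j)) (e₀ + (r - e₀))).filter
    fun s => b (e₀, s, j) = true with hV
  have hsub : U ⊆ insert e₀ ((Finset.Icc 1 (Nat.clog 2 T)).biUnion V) := by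
    intro s hs
    obtain ⟨h₁, h₂, h₃⟩ := hU s hs
    rcases h₃ with h₃ | ⟨h₃, j, hj, hbj, hr⟩
    · rw [h₃]; exact Finset.mem_insert_self _ _
    · refine Finset.mem_insert_of_mem (Finset.mem_biUnion.2 ⟨j, hj, ?_⟩)
      rw [hV, Finset.mem_filter, Finset.mem_Ioc]
      exact ⟨⟨by omega, by omega⟩, hbj⟩
  have h₁ : (U.card : ℝ) ≤ 1 + ∑ j ∈ Finset.Icc 1 (Nat.clog 2 T), ((V j).card : ℝ) := by
    have := (Finset.card_le_card hsub).trans (Finset.card_insert_le _ _)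
    have h := this.trans (Nat.add_le_add_right Finset.card_biUnion_le 1)
    rw [add_comm]
    exact_mod_cast h
  refine h₁.trans (add_le_add le_rfl ?_)
  have h₂ : ∀ j ∈ Finset.Icc 1 (Nat.clog 2 T), ((V j).card : ℝ) ≤ 4 + 5 * Real.log T := by
    intro j hj
    refine (hb.count e₀ j _ _ he₀ hj (Nat.sub_le _ _) (by omega)).trans ?_
    have h₃ : √((r - e₀ - (r - e₀ - 2 ^ j) : ℕ) / (2 : ℝ) ^ j) ≤ 1 := by
      refine Real.sqrt_le_one.2 (div_le_one_of_le₀ ?_ (by positivity))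
      have h₄ : r - e₀ - (r - e₀ - 2 ^ j) ≤ 2 ^ j := tsub_tsub_le
      exact_mod_cast h₄
    linarith
  refine (Finset.sum_le_card_nsmul _ _ _ h₂).trans (le_of_eq ?_)
  rw [Nat.card_Icc, nsmul_eq_mul, Nat.add_sub_cancel]

end episode

section total

variable {K : ℕ} [NeZero K] {C₀ : ℝ} {T N : ℕ} {μ : ℕ → Fin K → ℝ} {b : ℕ × ℕ × ℕ → Bool}
  {lg : ℕ → Finset (Fin K) × Fin K × ℝ} {e φ : ℕ → ℕ} {safe : ℕ → Fin K}

lemma episode_constant_le (hT : 2 ≤ T) :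
    (1 + Real.log T) * ((1 + Nat.clog 2 T * (4 + 5 * Real.log T)) *
      ((√C₀ + 13) * Real.log T + 96 * (2 * √C₀ + 20) * Real.log T ^ 2 +
        (2 * √C₀ + 20) * Real.log T)) ≤
      15 * (195 * √C₀ + 1953) * (1 + Real.log T) ^ 5 := by
  have h₁ := clog_le_three_mul_log hT
  have h₂ := log_two_lt hT
  have h₃ := Real.sqrt_nonneg C₀
  have h₄ : 1 + Nat.clog 2 T * (4 + 5 * Real.log T) ≤ 15 * (1 + Real.log T) ^ 2 := by
    have : Nat.clog 2 T * (4 + 5 * Real.log T) ≤ 3 * Real.log T * (4 + 5 * Real.log T) := by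
      gcongr
    nlinarith
  have h₅ : (√C₀ + 13) * Real.log T + 96 * (2 * √C₀ + 20) * Real.log T ^ 2 +
      (2 * √C₀ + 20) * Real.log T ≤ (195 * √C₀ + 1953) * (1 + Real.log T) ^ 2 := by
    have h₆ : Real.log T ≤ (1 + Real.log T) ^ 2 := by nlinarith
    have h₇ : Real.log T ^ 2 ≤ (1 + Real.log T) ^ 2 := by gcongr; linarith
    calc _ ≤ (√C₀ + 13) * (1 + Real.log T) ^ 2 +
          96 * (2 * √C₀ + 20) * (1 + Real.log T) ^ 2 +
          (2 * √C₀ + 20) * (1 + Real.log T) ^ 2 := by gcongr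
      _ = _ := by ring
  calc _ ≤ (1 + Real.log T) * (15 * (1 + Real.log T) ^ 2 *
        ((195 * √C₀ + 1953) * (1 + Real.log T) ^ 2)) := by gcongr
    _ = _ := by ring

/-- The cost of an episode is, up to logarithms, that of restarting an optimal algorithm at every
change of the phase. -/
lemma sum_averageGap_episode_le (hC : 100 ≤ C₀) (hT : 2 ≤ T) (hKT : K ≤ T) (hN : N ≤ T)
    (hμ : ∀ t a, μ t a ∈ Set.Icc (0 : ℝ) 1) (hφ : SafePhases μ N φ safe)
    (hacc : Accurate T N μ lg) (hb : GoodReplays C₀ T N μ φ b) (hrun : IsRun C₀ T N b lg e)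
    {e₀ : ℕ} (he₀ : e₀ ∈ (Finset.Icc 1 N).image e) :
    ∑ t ∈ Finset.Icc 1 N with e t = e₀, averageGap μ (lg t).1 t ≤
      15 * (195 * √C₀ + 1953) * (1 + Real.log T) ^ 5 *
        ∑ p ∈ ((Finset.Icc 1 N).filter fun t => e t = e₀).image φ,
          √((K : ℝ) * ((Finset.Icc 1 N).filter fun t => e t = e₀ ∧ φ t = p).card) := by
  classical
  obtain ⟨z, he1, hez, hzN, hS⟩ := hrun.episode_eq_Icc he₀
  have hlog := log_two_lt hT
  have hmemS : ∀ t, e₀ ≤ t → t ≤ z → e t = e₀ := fun t h₁ h₂ => by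
    have : t ∈ (Finset.Icc 1 N).filter (fun t => e t = e₀) := by
      rw [hS]; exact Finset.mem_Icc.2 ⟨h₁, h₂⟩
    exact (Finset.mem_filter.1 this).2
  simp_rw [← Finset.filter_filter]
  rw [hS]
  set σ : ℕ → ℕ := fun t => replayStart b T e₀ t with hσ
  have hσmem : ∀ t, e₀ ≤ t → e₀ ≤ σ t ∧ σ t ≤ t := fun t h => ⟨le_replayStart h, replayStart_le⟩
  -- the last round `ρ` at which an instance was resumed, and an arm `a₀` not evicted by then
  obtain ⟨ρ, hρ, hρmax⟩ := Finset.exists_max_image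
    ((Finset.Icc e₀ z).filter fun t => t = e₀ ∨ σ t < t) id
    ⟨e₀, Finset.mem_filter.2 ⟨Finset.mem_Icc.2 ⟨le_rfl, hez⟩, Or.inl rfl⟩⟩
  rw [Finset.mem_filter, Finset.mem_Icc] at hρ
  have heρ : e ρ = e₀ := hmemS ρ hρ.1.1 hρ.1.2
  have hbad : badArms C₀ T lg e₀ ρ ≠ Finset.univ := by
    rw [← heρ]
    refine hrun.badArms_ne_univ (by omega) (by omega) ?_
    rw [heρ]
    exact hρ.2
  obtain ⟨a₀, ha₀⟩ : ∃ a₀, a₀ ∉ badArms C₀ T lg e₀ ρ := by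
    by_contra! h
    exact hbad (Finset.eq_univ_iff_forall.2 h)
  have hlast : ∀ r, e₀ ≤ r → r ≤ ρ → a₀ ∈ (lg r).1 := by
    intro r h₁ h₂
    rw [hrun.mem_arms (by omega) (by omega), hmemS r h₁ (by omega)]
    exact fun h => ha₀ (badArms_mono (le_replayStart h₁) h₂ h)
  -- the rounds grouped by the active instance
  set U := (Finset.Icc e₀ z).image σ with hU
  set I : ℕ → Finset ℕ := fun s => (Finset.Icc e₀ z).filter fun t => σ t = s with hI
  have hImem : ∀ s t, t ∈ I s ↔ (e₀ ≤ t ∧ t ≤ z) ∧ σ t = s := fun s t => by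
    rw [hI, Finset.mem_filter, Finset.mem_Icc]
  have hend : ∀ s, ∃ m, s ∈ U → m ∈ I s ∧ ∀ t ∈ I s, t ≤ m := by
    intro s
    by_cases hs : s ∈ U
    · obtain ⟨t, ht, hts⟩ := Finset.mem_image.1 hs
      obtain ⟨m, hm, hmax⟩ := Finset.exists_max_image (I s) id ⟨t, Finset.mem_filter.2 ⟨ht, hts⟩⟩
      exact ⟨m, fun _ => ⟨hm, hmax⟩⟩
    · exact ⟨0, fun h => absurd h hs⟩
  choose m hm using hend
  have hUmem : ∀ s ∈ U, e₀ ≤ s ∧ s ≤ m s ∧ m s ≤ z ∧ (s < m s → m s ≤ ρ) ∧ (s = e₀ ∨ e₀ < s ∧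
      ∃ j ∈ Finset.Icc 1 (Nat.clog 2 T), b (e₀, s, j) = true ∧ m s ≤ s + 2 ^ j) := by
    intro s hs
    obtain ⟨hms, -⟩ := hm s hs
    rw [hImem] at hms
    have h := hσmem (m s) hms.1.1
    have hspec := replayStart_spec (b := b) (T := T) hms.1.1
    have : replayStart b T e₀ (m s) = s := hms.2
    rw [hms.2] at h
    rw [this] at hspec
    refine ⟨h.1, h.2, hms.1.2, fun hlt => ?_, hspec⟩
    exact hρmax (m s) (Finset.mem_filter.2 ⟨Finset.mem_Icc.2 hms.1, Or.inr (by rw [hms.2]; exact hlt)⟩)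
  set Q : ℝ := 1 + Nat.clog 2 T * (4 + 5 * Real.log T) with hQ
  set R : ℝ := √((K : ℝ) * (z + 1 - e₀ : ℕ)) with hR
  have hQ0 : 0 ≤ Q := by positivity
  have hinst : ∀ s ∈ U, ∑ t ∈ I s, averageGap μ (lg t).1 t ≤ (1 + Real.log T) *
      ((√C₀ + 13) * Real.log T * √((K : ℝ) * (max (m s - s) 1 : ℕ)) +
        ∑ r ∈ Finset.Ico s (m s), gap μ r a₀) := by
    intro s hs
    obtain ⟨h₁, h₂, h₃, h₄, -⟩ := hUmem s hs
    refine sum_averageGap_instance_le hC hT hKT hμ hacc (by omega) (by omega) ?_ ?_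
    · intro t ht
      have ht' := (hImem s t).1 ht
      refine ⟨ht'.2 ▸ (hσmem t ht'.1.1).2, (hm s hs).2 t ht, ?_⟩
      rw [hrun.arms t (by omega) (by omega), hmemS t ht'.1.1 ht'.1.2, ← ht'.2]
    · intro t ht hst r hr hrt
      have h₅ := (hm s hs).2 t ht
      have h₆ := h₄ (by omega)
      exact hlast r (by omega) (by omega)
  have hlen : ∑ s ∈ U, √((K : ℝ) * (max (m s - s) 1 : ℕ)) ≤ Q * R := by
    refine sum_sqrt_replays_le hb he1 hez hzN U _ fun s hs => ?_
    obtain ⟨h₁, h₂, h₃, -, h₅⟩ := hUmem s hs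
    refine ⟨h₁, h₂.trans h₃, max_le (by omega) (by omega), ?_⟩
    refine h₅.imp_right fun h => ⟨h.1, ?_⟩
    obtain ⟨j, hj, hbj, hmj⟩ := h.2
    exact ⟨j, hj, hbj, max_le (by omega) Nat.one_le_two_pow⟩
  have hdepth : ∑ s ∈ U, ∑ r ∈ Finset.Ico s (m s), gap μ r a₀ ≤
      Q * ∑ r ∈ Finset.Ico e₀ ρ, gap μ r a₀ := by
    have : ∑ s ∈ U, ∑ r ∈ Finset.Ico s (m s), gap μ r a₀ =
        ∑ r ∈ Finset.Ico e₀ ρ, ∑ s ∈ U with s ≤ r ∧ r < m s, gap μ r a₀ := by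
      refine Finset.sum_comm' fun s r => ?_
      rw [Finset.mem_Ico, Finset.mem_filter, Finset.mem_Ico]
      constructor
      · rintro ⟨hs, h₁, h₂⟩
        obtain ⟨h₃, h₄, h₅, h₆, -⟩ := hUmem s hs
        exact ⟨⟨hs, h₁, h₂⟩, by omega, by have := h₆ (by omega); omega⟩
      · rintro ⟨⟨hs, h₁, h₂⟩, -⟩
        exact ⟨hs, h₁, h₂⟩
    rw [this, Finset.mul_sum]
    refine Finset.sum_le_sum fun r hr => ?_
    rw [Finset.mem_Ico] at hr
    rw [Finset.sum_const, nsmul_eq_mul]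
    refine mul_le_mul_of_nonneg_right ?_ (gap_nonneg r a₀)
    refine card_running_le hb he1 hr.1 (by omega) _ fun s hs => ?_
    obtain ⟨hs, h₁, h₂⟩ := Finset.mem_filter.1 hs
    obtain ⟨h₃, h₄, h₅, h₆, h₇⟩ := hUmem s hs
    refine ⟨h₃, h₁, h₇.imp_right fun h => ⟨h.1, ?_⟩⟩
    obtain ⟨j, hj, hbj, hmj⟩ := h.2
    exact ⟨j, hj, hbj, h₂.trans_le hmj⟩
  have hgap := sum_gap_le hC hT hN hμ hφ hacc hb hrun (a := a₀) (w := ρ) (by omega) (by omega)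
    (heρ.symm ▸ ha₀)
  rw [heρ] at hgap
  set Φ := ∑ p ∈ (Finset.Icc e₀ z).image φ,
    √((K : ℝ) * ((Finset.Icc e₀ z).filter fun t => φ t = p).card) with hΦ
  have hsub : Finset.Ico e₀ ρ ⊆ Finset.Icc e₀ z := fun r hr => by
    rw [Finset.mem_Ico] at hr
    exact Finset.mem_Icc.2 ⟨hr.1, by omega⟩
  have hΦ₁ : ∑ p ∈ (Finset.Ico e₀ ρ).image φ,
      √((K : ℝ) * ((Finset.Ico e₀ ρ).filter fun r => φ r = p).card) ≤ Φ := by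
    refine (Finset.sum_le_sum_of_subset_of_nonneg (Finset.image_subset_image hsub)
      fun _ _ _ => Real.sqrt_nonneg _).trans ?_
    refine Finset.sum_le_sum fun p _ => ?_
    gcongr
  have hΦ₂ : R ≤ Φ := by
    rw [hR, hΦ]
    have h₁ : ((z + 1 - e₀ : ℕ) : ℝ) =
        ∑ p ∈ (Finset.Icc e₀ z).image φ, (((Finset.Icc e₀ z).filter fun t => φ t = p).card : ℝ) := by
      rw [← Nat.card_Icc]
      exact_mod_cast Finset.card_eq_sum_card_image φ _
    rw [h₁, Finset.mul_sum]
    exact sqrt_sum_le_sum_sqrt _ _ fun _ => mul_nonneg (Nat.cast_nonneg _) (Nat.cast_nonneg _)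
  have hR₁ : √((K : ℝ) * (ρ - e₀ : ℕ)) ≤ Φ := by
    refine le_trans ?_ hΦ₂
    rw [hR]
    gcongr
    omega
  have hΦ0 : 0 ≤ Φ := Finset.sum_nonneg fun _ _ => Real.sqrt_nonneg _
  have hgap' : ∑ r ∈ Finset.Ico e₀ ρ, gap μ r a₀ ≤
      (96 * (2 * √C₀ + 20) * Real.log T ^ 2 + (2 * √C₀ + 20) * Real.log T) * Φ := by
    refine hgap.trans (le_of_le_of_eq (add_le_add (mul_le_mul_of_nonneg_left hR₁ ?_)
      (mul_le_mul_of_nonneg_left hΦ₁ ?_)) (add_mul _ _ _).symm) <;> positivity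
  have hmaps : ∀ t ∈ Finset.Icc e₀ z, σ t ∈ U := fun t ht => Finset.mem_image_of_mem _ ht
  calc ∑ t ∈ Finset.Icc e₀ z, averageGap μ (lg t).1 t
      = ∑ s ∈ U, ∑ t ∈ I s, averageGap μ (lg t).1 t :=
        (Finset.sum_fiberwise_of_maps_to hmaps _).symm
    _ ≤ ∑ s ∈ U, (1 + Real.log T) *
      ((√C₀ + 13) * Real.log T * √((K : ℝ) * (max (m s - s) 1 : ℕ)) +
        ∑ r ∈ Finset.Ico s (m s), gap μ r a₀) := Finset.sum_le_sum hinst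
    _ = (1 + Real.log T) * ((√C₀ + 13) * Real.log T *
          ∑ s ∈ U, √((K : ℝ) * (max (m s - s) 1 : ℕ)) +
        ∑ s ∈ U, ∑ r ∈ Finset.Ico s (m s), gap μ r a₀) := by
        rw [← Finset.mul_sum, Finset.sum_add_distrib, ← Finset.mul_sum]
    _ ≤ (1 + Real.log T) * ((√C₀ + 13) * Real.log T * (Q * Φ) +
        Q * ((96 * (2 * √C₀ + 20) * Real.log T ^ 2 + (2 * √C₀ + 20) * Real.log T) * Φ)) := by
        have h₁ := hlen.trans (mul_le_mul_of_nonneg_left hΦ₂ hQ0)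
        have h₂ := hdepth.trans (mul_le_mul_of_nonneg_left hgap' hQ0)
        gcongr
    _ = (1 + Real.log T) * (Q * ((√C₀ + 13) * Real.log T +
          96 * (2 * √C₀ + 20) * Real.log T ^ 2 + (2 * √C₀ + 20) * Real.log T)) * Φ := by ring
    _ ≤ _ := mul_le_mul_of_nonneg_right (episode_constant_le hT) hΦ0

/-- On the good event, the expected regret of the draws of all rounds is bounded in terms of the
lengths of the phases: every phase meets at most two episodes. -/
theorem sum_averageGap_le (hC : 100 ≤ C₀) (hT : 2 ≤ T) (hKT : K ≤ T) (hN : N ≤ T)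
    (hμ : ∀ t a, μ t a ∈ Set.Icc (0 : ℝ) 1) (hφ : SafePhases μ N φ safe)
    (hacc : Accurate T N μ lg) (hb : GoodReplays C₀ T N μ φ b) (hrun : IsRun C₀ T N b lg e) :
    ∑ t ∈ Finset.Icc 1 N, averageGap μ (lg t).1 t ≤
      30 * (195 * √C₀ + 1953) * (1 + Real.log T) ^ 5 * ∑ p ∈ (Finset.Icc 1 N).image φ,
        √((K : ℝ) * ((Finset.Icc 1 N).filter fun t => φ t = p).card) := by
  classical
  have hlog := log_two_lt hT
  rw [← Finset.sum_fiberwise_of_maps_to (t := (Finset.Icc 1 N).image e) (g := e)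
    fun t ht => Finset.mem_image_of_mem _ ht]
  refine (Finset.sum_le_sum fun e₀ he₀ =>
    sum_averageGap_episode_le hC hT hKT hN hμ hφ hacc hb hrun he₀).trans ?_
  rw [← Finset.mul_sum]
  have : ∑ e₀ ∈ (Finset.Icc 1 N).image e,
      ∑ p ∈ ((Finset.Icc 1 N).filter fun t => e t = e₀).image φ,
        √((K : ℝ) * ((Finset.Icc 1 N).filter fun t => e t = e₀ ∧ φ t = p).card) =
      ∑ p ∈ (Finset.Icc 1 N).image φ,
        ∑ e₀ ∈ ((Finset.Icc 1 N).filter fun t => φ t = p).image e,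
        √((K : ℝ) * ((Finset.Icc 1 N).filter fun t => e t = e₀ ∧ φ t = p).card) := by
    refine Finset.sum_comm' fun e₀ p => ?_
    simp only [Finset.mem_image, Finset.mem_filter]
    constructor
    · rintro ⟨-, t, ⟨ht, h₁⟩, h₂⟩
      exact ⟨⟨t, ⟨ht, h₂⟩, h₁⟩, t, ht, h₂⟩
    · rintro ⟨⟨t, ⟨ht, h₂⟩, h₁⟩, -⟩
      exact ⟨⟨t, ht, h₁⟩, t, ⟨ht, h₁⟩, h₂⟩
  rw [this]
  have hp : ∀ p ∈ (Finset.Icc 1 N).image φ,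
      ∑ e₀ ∈ ((Finset.Icc 1 N).filter fun t => φ t = p).image e,
        √((K : ℝ) * ((Finset.Icc 1 N).filter fun t => e t = e₀ ∧ φ t = p).card) ≤
      2 * √((K : ℝ) * ((Finset.Icc 1 N).filter fun t => φ t = p).card) := by
    intro p _
    refine (Finset.sum_le_card_nsmul _ _
      (√((K : ℝ) * ((Finset.Icc 1 N).filter fun t => φ t = p).card)) fun e₀ _ => ?_).trans ?_
    · gcongr
      exact fun h => h.2
    · rw [nsmul_eq_mul]
      gcongr
      exact_mod_cast card_episodes_le_two hC hT hμ hφ hacc hrun p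
  calc _ ≤ 15 * (195 * √C₀ + 1953) * (1 + Real.log T) ^ 5 * ∑ p ∈ (Finset.Icc 1 N).image φ,
        2 * √((K : ℝ) * ((Finset.Icc 1 N).filter fun t => φ t = p).card) := by
        gcongr with p hp'
        exact hp p hp'
    _ = _ := by rw [← Finset.mul_sum]; ring

end total

/-! ### Measurability of the runs -/

section measurability

variable {K : ℕ} {C₀ : ℝ} {T : ℕ} {Ω : Type*} [MeasurableSpace Ω]

lemma measurable_apply_countable {ι β : Type*} [MeasurableSpace ι] [Countable ι]
    [MeasurableSingletonClass ι] [MeasurableSpace β] {f : Ω → ι} (hf : Measurable f)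
    {g : ι → Ω → β} (hg : ∀ i, Measurable (g i)) : Measurable fun ω => g (f ω) ω :=
  (measurable_from_prod_countable_right (f := fun p : ι × Ω => g p.1 p.2) hg).comp
    (hf.prodMk measurable_id)

lemma measurable_gapEstimate (a' a : Fin K) :
    Measurable fun x : Finset (Fin K) × Fin K × ℝ => gapEstimate x a' a := by
  refine measurable_from_prod_countable_right fun A => ?_
  refine measurable_from_prod_countable_right fun i => ?_
  unfold gapEstimate
  simp only
  split_ifs <;> fun_prop

lemma measurable_badArms {lg : Ω → ℕ → Finset (Fin K) × Fin K × ℝ} {s t : ℕ}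
    (h : ∀ r, s ≤ r → r < t → Measurable fun ω => lg ω r) :
    Measurable fun ω => badArms C₀ T (lg ω) s t := by
  refine measurable_finset_iff.2 fun a => ?_
  simp only [badArms, Finset.mem_filter, Finset.mem_univ, true_and]
  refine Measurable.exists fun s₁ => Measurable.exists fun s₂ => ?_
  by_cases h' : s ≤ s₁ ∧ s₁ < s₂ ∧ s₂ < t
  · simp only [h'.1, h'.2.1, h'.2.2, true_and]
    refine measurableSet_setOfPred.1 (measurableSet_lt measurable_const ?_)
    refine Measurable.iSup fun a' => Finset.measurable_sum _ fun r hr => ?_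
    rw [Finset.mem_Icc] at hr
    exact (measurable_gapEstimate a' a).comp (h r (by omega) (by omega))
  · have : ∀ P : Prop, (s ≤ s₁ ∧ s₁ < s₂ ∧ s₂ < t ∧ P) = False := by
      intro P
      simp only [eq_iff_iff, iff_false]
      tauto
    simp only [this]
    exact measurable_const

lemma measurable_replayStart (e t : ℕ) :
    Measurable fun b : ℕ × ℕ × ℕ → Bool => replayStart b T e t := by
  classical
  unfold replayStart
  refine measurable_findGreatest fun s _ => measurableSet_setOfPred.2 ?_
  unfold IsRunningStart
  refine Measurable.or measurable_const (Measurable.and measurable_const ?_)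
  refine Measurable.exists fun j => Measurable.and measurable_const (Measurable.and ?_
    measurable_const)
  exact measurableSet_setOfPred.1 ((measurable_pi_apply (X := fun _ : ℕ × ℕ × ℕ => Bool) (e, s, j))
    (measurableSet_singleton true))

lemma measurable_nextEpisodeStart {lg : Ω → ℕ → Finset (Fin K) × Fin K × ℝ}
    {b : Ω → ℕ × ℕ × ℕ → Bool} (hb : Measurable b) {e t : ℕ}
    (h : ∀ r, e ≤ r → r < t → Measurable fun ω => lg ω r) :
    Measurable fun ω => nextEpisodeStart C₀ T (b ω) (lg ω) e t := by
  unfold nextEpisodeStart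
  refine Measurable.ite ?_ measurable_const measurable_const
  refine MeasurableSet.inter (measurableSet_setOfPred.2 ?_) ?_
  · refine Measurable.forall fun j => Measurable.imp measurable_const ?_
    exact measurableSet_setOfPred.1
      (((measurable_pi_apply (e, t, j)).comp hb) (measurableSet_singleton false))
  · exact measurable_badArms h (measurableSet_singleton _)

end measurability

section run

variable {K : ℕ} [NeZero K] {C₀ : ℝ} {T : ℕ}

/-- The draws of META together with the reward vectors. -/
abbrev Outcome (K : ℕ) : Type := MetaSeed K × (ℕ → Fin K → ℝ)

/-- By induction on the round, since the explicit description of the runs expresses everything in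
terms of earlier rounds by functions of countable variables. -/
lemma measurable_run (t : ℕ) (h₁ : 1 ≤ t) (h₂ : t ≤ T) :
    (Measurable fun p : Outcome K => runEpisode C₀ T p.1 p.2 t) ∧
    (Measurable fun p : Outcome K => runLog C₀ T p.1 p.2 t) := by
  induction t using Nat.strong_induction_on with
  | _ t ih =>
  have hlog : ∀ r, 1 ≤ r → r < t → Measurable fun p : Outcome K => runLog C₀ T p.1 p.2 r :=
    fun r hr hrt => (ih r hrt hr (by omega)).2
  have hrun : ∀ p : Outcome K, IsRun C₀ T T p.1.2 (runLog C₀ T p.1 p.2) (runEpisode C₀ T p.1 p.2) :=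
    fun p => isRun_run le_rfl
  have hbits : Measurable fun p : Outcome K => p.1.2 := measurable_fst.snd
  have hepi : Measurable fun p : Outcome K => runEpisode C₀ T p.1 p.2 t := by
    rcases h₁.eq_or_lt with h | h
    · subst h
      simp only [(hrun _).first]
      exact measurable_const
    · obtain ⟨s, rfl⟩ : ∃ s, t = s + 1 := ⟨t - 1, by omega⟩
      have h₃ : ∀ p : Outcome K, runEpisode C₀ T p.1 p.2 (s + 1) =
          nextEpisodeStart C₀ T p.1.2 (runLog C₀ T p.1 p.2) (max 1 (runEpisode C₀ T p.1 p.2 s))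
            (s + 1) := by
        intro p
        rw [max_eq_right ((hrun p).episode_mem (by omega) (by omega)).1]
        exact (hrun p).next s (by omega) (by omega)
      simp only [h₃]
      refine measurable_apply_countable (g := fun e (p : Outcome K) =>
        nextEpisodeStart C₀ T p.1.2 (runLog C₀ T p.1 p.2) (max 1 e) (s + 1))
        (ih s (by omega) (by omega) (by omega)).1 fun e => ?_
      exact measurable_nextEpisodeStart hbits fun r hr hrt => hlog r (by omega) hrt
  refine ⟨hepi, ?_⟩
  have hstart : Measurable fun p : Outcome K => replayStart p.1.2 T (runEpisode C₀ T p.1 p.2 t) t :=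
    measurable_apply_countable (g := fun e (p : Outcome K) => replayStart p.1.2 T e t) hepi
      fun e => (measurable_replayStart e t).comp hbits
  have harms : Measurable fun p : Outcome K => runArms C₀ T p.1 p.2 t := by
    have h₃ : ∀ p : Outcome K, runArms C₀ T p.1 p.2 t = Finset.univ \ badArms C₀ T
        (runLog C₀ T p.1 p.2) (max 1 (replayStart p.1.2 T (runEpisode C₀ T p.1 p.2 t) t)) t := by
      intro p
      rw [max_eq_right (((hrun p).episode_mem h₁ h₂).1.trans ((hrun p).start_mem h₁ h₂).1)]
      exact (hrun p).arms t h₁ h₂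
    simp only [h₃]
    refine measurable_apply_countable (g := fun s (p : Outcome K) => Finset.univ \ badArms C₀ T
        (runLog C₀ T p.1 p.2) (max 1 s) t) hstart fun s => ?_
    exact (Measurable.of_discrete (f := fun A : Finset (Fin K) => Finset.univ \ A)).comp
      (measurable_badArms fun r hr hrt => hlog r (by omega) hrt)
  have harm : Measurable fun p : Outcome K => runArm C₀ T p.1 p.2 t := by
    obtain ⟨s, rfl⟩ : ∃ s, t = s + 1 := ⟨t - 1, by omega⟩
    have h₃ : ∀ p : Outcome K, runArm C₀ T p.1 p.2 (s + 1) =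
        p.1.1 (s + 1, runArms C₀ T p.1 p.2 (s + 1)) := fun p => runArm_eq s (by omega)
    simp only [h₃]
    exact measurable_apply_countable (g := fun A (p : Outcome K) => p.1.1 (s + 1, A)) harms
      fun A => (measurable_pi_apply (s + 1, A)).comp measurable_fst.fst
  have hreward : Measurable fun p : Outcome K => p.2 t (runArm C₀ T p.1 p.2 t) :=
    measurable_apply_countable (g := fun a (p : Outcome K) => p.2 t a) harm
      fun a => (measurable_pi_apply a).comp ((measurable_pi_apply t).comp measurable_snd)
  exact harms.prodMk (harm.prodMk hreward)

/-- The history of the first `s` rounds depends only on the replays, and on the choices and rewards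
of these rounds. -/
lemma history_congr {c c' : ℕ × Finset (Fin K) → Fin K} {b : ℕ × ℕ × ℕ → Bool}
    {y y' : ℕ → Fin K → ℝ} (s : ℕ) (hs : s ≤ T)
    (hc : ∀ r A, 1 ≤ r → r ≤ s → c (r, A) = c' (r, A)) (hy : ∀ r, 1 ≤ r → r ≤ s → y r = y' r) :
    (metaPolicy K C₀ T).history (c, b) y s = (metaPolicy K C₀ T).history (c', b) y' s := by
  induction s with
  | zero => rfl
  | succ s ih =>
    have ih' := ih (by omega) (fun r A h₁ h₂ => hc r A h₁ (by omega))
      (fun r h₁ h₂ => hy r h₁ (by omega))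
    have hact : (metaPolicy K C₀ T).act (c, b) ((metaPolicy K C₀ T).history (c, b) y s) =
        (metaPolicy K C₀ T).act (c', b) ((metaPolicy K C₀ T).history (c', b) y' s) := by
      have h₁ := (runState_spec (C₀ := C₀) (T := T) (ω := (c, b)) (y := y) s (by omega)).1
      have h₂ := (runState_spec (C₀ := C₀) (T := T) (ω := (c', b)) (y := y') s (by omega)).1
      change c ((runState C₀ T (c, b) y s).round, (runState C₀ T (c, b) y s).activeArms) =
        c' ((runState C₀ T (c', b) y' s).round, (runState C₀ T (c', b) y' s).activeArms)
      have h₃ : runState C₀ T (c, b) y s = runState C₀ T (c', b) y' s := by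
        unfold runState
        rw [ih']
        rfl
      rw [h₁, h₂, h₃]
      exact hc (s + 1) _ (by omega) le_rfl
    change (metaPolicy K C₀ T).history (c, b) y s ++ [(_, y (s + 1) _)] =
      (metaPolicy K C₀ T).history (c', b) y' s ++ [(_, y' (s + 1) _)]
    rw [hact, ih', hy (s + 1) (by omega) le_rfl]

lemma runState_congr {c c' : ℕ × Finset (Fin K) → Fin K} {b : ℕ × ℕ × ℕ → Bool}
    {y y' : ℕ → Fin K → ℝ} (s : ℕ) (hs : s ≤ T)
    (hc : ∀ r A, 1 ≤ r → r ≤ s → c (r, A) = c' (r, A)) (hy : ∀ r, 1 ≤ r → r ≤ s → y r = y' r) :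
    runState C₀ T (c, b) y s = runState C₀ T (c', b) y' s := by
  unfold runState
  rw [history_congr s hs hc hy]
  rfl

end run

/-! ### Resampling one coordinate of a product measure -/

section resample

variable {ι : Type*} [DecidableEq ι] {X : ι → Type*} [∀ i, MeasurableSpace (X i)]
  (m : ∀ i, Measure (X i)) [∀ i, IsProbabilityMeasure (m i)]

/-- A product measure does not change if one coordinate is replaced by an independent copy. -/
lemma map_update_infinitePi (i : ι) :
    ((Measure.infinitePi m).prod (m i)).map (fun p => Function.update p.1 i p.2) =
      Measure.infinitePi m := by
  refine Measure.eq_infinitePi m fun s t ht => ?_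
  rw [Measure.map_apply measurable_update' (MeasurableSet.pi s.countable_toSet fun i _ => ht i)]
  by_cases hi : i ∈ s
  · have : (fun p : (∀ i, X i) × X i => Function.update p.1 i p.2) ⁻¹' (Set.pi s t) =
        (Set.pi (s.erase i : Finset ι) t) ×ˢ (t i) := by
      ext p
      simp only [Set.mem_preimage, Set.mem_pi, Set.mem_prod, Finset.mem_coe, Finset.mem_erase]
      constructor
      · intro h
        refine ⟨fun j hj => ?_, ?_⟩
        · have := h j hj.2
          rwa [Function.update_of_ne hj.1] at this
        · have := h i hi
          rwa [Function.update_self] at this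
      · rintro ⟨h₁, h₂⟩ j hj
        by_cases hji : j = i
        · subst hji; rwa [Function.update_self]
        · rw [Function.update_of_ne hji]; exact h₁ j ⟨hji, hj⟩
    rw [this, Measure.prod_prod, Measure.infinitePi_pi _ fun i _ => ht i, mul_comm,
      Finset.mul_prod_erase s (fun i => m i (t i)) hi]
  · have : (fun p : (∀ i, X i) × X i => Function.update p.1 i p.2) ⁻¹' (Set.pi s t) =
        (Set.pi (s : Set ι) t) ×ˢ Set.univ := by
      ext p
      simp only [Set.mem_preimage, Set.mem_pi, Set.mem_prod, Finset.mem_coe, Set.mem_univ, and_true]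
      refine forall₂_congr fun j hj => ?_
      rw [Function.update_of_ne (by rintro rfl; exact hi hj)]
    rw [this, Measure.prod_prod, Measure.infinitePi_pi _ fun i _ => ht i, measure_univ, mul_one]

lemma lintegral_update_infinitePi (i : ι) {f : (∀ i, X i) → ENNReal} (hf : Measurable f) :
    ∫⁻ ω, f ω ∂Measure.infinitePi m =
      ∫⁻ ω, ∫⁻ x, f (Function.update ω i x) ∂(m i) ∂Measure.infinitePi m := by
  have hm : Measurable fun p : (∀ i, X i) × X i => f (Function.update p.1 i p.2) :=
    hf.comp measurable_update'
  conv_lhs => rw [← map_update_infinitePi m i]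
  rw [lintegral_map hf measurable_update', lintegral_prod _ hm.aemeasurable]

end resample

section oneStep

variable {K : ℕ} [NeZero K] (ν : ℕ → Measure (Fin K → ℝ)) [∀ t, IsProbabilityMeasure (ν t)]

/-- The joint law of the draws of META and of the reward vectors. -/
def outcomeLaw : Measure (Outcome K) := (metaLaw K).prod (Measure.infinitePi ν)

instance : IsProbabilityMeasure (outcomeLaw ν) := by
  unfold outcomeLaw
  infer_instance

/-- Replace the draw from the candidate set `A` at round `t`, and the reward vector of this
round. -/
def resample (t : ℕ) (A : Finset (Fin K)) (p : Outcome K) (x : Fin K) (v : Fin K → ℝ) :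
    Outcome K :=
  ((Function.update p.1.1 (t, A) x, p.1.2), Function.update p.2 t v)

lemma lintegral_resample (t : ℕ) (A : Finset (Fin K)) {F : Outcome K → ENNReal}
    (hF : Measurable F) :
    ∫⁻ p, F p ∂outcomeLaw ν =
      ∫⁻ p, ∫⁻ v, ∫⁻ x, F (resample t A p x v) ∂choiceLaw A ∂ν t ∂outcomeLaw ν := by
  have h₁ : ∫⁻ p, F p ∂outcomeLaw ν =
      ∫⁻ p : Outcome K, ∫⁻ v, F (p.1, Function.update p.2 t v) ∂ν t ∂outcomeLaw ν := by
    have hm : Measurable fun q : Outcome K × (Fin K → ℝ) =>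
        F (q.1.1, Function.update q.1.2 t q.2) := by
      refine hF.comp (measurable_fst.fst.prodMk ?_)
      exact (measurable_update' (a := t) (X := fun _ : ℕ => Fin K → ℝ)).comp
        (measurable_fst.snd.prodMk measurable_snd)
    unfold outcomeLaw
    rw [lintegral_prod _ hF.aemeasurable, lintegral_prod _ hm.lintegral_prod_right'.aemeasurable]
    refine lintegral_congr fun ω => ?_
    exact lintegral_update_infinitePi ν t (hF.comp (measurable_const.prodMk measurable_id))
  have h₂ : ∀ G : Outcome K → ENNReal, Measurable G → ∫⁻ p, G p ∂outcomeLaw ν =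
      ∫⁻ p : Outcome K, ∫⁻ x, G ((Function.update p.1.1 (t, A) x, p.1.2), p.2) ∂choiceLaw A
        ∂outcomeLaw ν := by
    intro G hG
    have hm : Measurable fun q : Outcome K × Fin K =>
        G ((Function.update q.1.1.1 (t, A) q.2, q.1.1.2), q.1.2) := by
      refine hG.comp ((Measurable.prodMk ?_ measurable_fst.fst.snd).prodMk measurable_fst.snd)
      exact (measurable_update' (a := (t, A)) (X := fun _ : ℕ × Finset (Fin K) => Fin K)).comp
        (measurable_fst.fst.fst.prodMk measurable_snd)
    have hm' := hm.lintegral_prod_right' (ν := choiceLaw A)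
    unfold outcomeLaw metaLaw
    rw [lintegral_prod_symm _ hG.aemeasurable, lintegral_prod_symm _ hm'.aemeasurable]
    refine lintegral_congr fun y => ?_
    have hG' : Measurable fun ω : MetaSeed K => G (ω, y) :=
      hG.comp (measurable_id.prodMk measurable_const)
    have hm'' := hm'.comp (f := fun ω : MetaSeed K => (ω, y)) (measurable_id.prodMk measurable_const)
    rw [lintegral_prod_symm _ hG'.aemeasurable]
    refine Eq.trans ?_ (lintegral_prod_symm _ hm''.aemeasurable).symm
    refine lintegral_congr fun b => ?_
    exact lintegral_update_infinitePi (fun i : ℕ × Finset (Fin K) => choiceLaw i.2) (t, A)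
      (hG'.comp (measurable_id.prodMk measurable_const))
  rw [h₁, h₂]
  · refine lintegral_congr fun p => ?_
    rw [lintegral_lintegral_swap]
    · rfl
    · refine Measurable.aemeasurable ?_
      refine hF.comp (Measurable.prodMk (Measurable.prodMk ?_ measurable_const) ?_)
      · exact (measurable_update (X := fun _ : ℕ × Finset (Fin K) => Fin K) p.1.1).comp
          measurable_fst
      · exact (measurable_update (X := fun _ : ℕ => Fin K → ℝ) p.2).comp measurable_snd
  · have hm : Measurable fun q : Outcome K × (Fin K → ℝ) =>
        F (q.1.1, Function.update q.1.2 t q.2) := by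
      refine hF.comp (measurable_fst.fst.prodMk ?_)
      exact (measurable_update' (a := t) (X := fun _ : ℕ => Fin K → ℝ)).comp
        (measurable_fst.snd.prodMk measurable_snd)
    exact hm.lintegral_prod_right'

/-- Given the past of a round, the arm played is uniformly distributed on the candidate set, and
independent of the reward vector. -/
lemma lintegral_oneStep {C₀ : ℝ} {T : ℕ} {t : ℕ} (h₁ : 1 ≤ t) (h₂ : t ≤ T)
    {G : Outcome K → ENNReal} (hG : Measurable G)
    (hinv : ∀ A p x v, G (resample t A p x v) = G p)
    {h : Finset (Fin K) → Fin K → (Fin K → ℝ) → ENNReal}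
    (hh : ∀ A a, Measurable (h A a)) :
    ∫⁻ p, G p * h (runArms C₀ T p.1 p.2 t) (runArm C₀ T p.1 p.2 t) (p.2 t) ∂outcomeLaw ν =
      ∫⁻ p, G p * ∫⁻ v, ∫⁻ x, h (runArms C₀ T p.1 p.2 t) x v
        ∂choiceLaw (runArms C₀ T p.1 p.2 t) ∂ν t ∂outcomeLaw ν := by
  classical
  have harms : Measurable fun p : Outcome K => runArms C₀ T p.1 p.2 t :=
    (measurable_run t h₁ h₂).2.fst
  have hset : ∀ A, MeasurableSet {p : Outcome K | runArms C₀ T p.1 p.2 t = A} :=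
    fun A => harms (measurableSet_singleton A)
  have hinvA : ∀ (A : Finset (Fin K)) (p : Outcome K) (x : Fin K) (v : Fin K → ℝ),
      runArms C₀ T (resample t A p x v).1 (resample t A p x v).2 t =
      runArms C₀ T p.1 p.2 t := by
    intro A p x v
    unfold runArms
    refine congrArg State.activeArms (runState_congr (T := T) (c := (resample t A p x v).1.1)
      (c' := p.1.1) (b := p.1.2) (y := (resample t A p x v).2) (y' := p.2) (t - 1) (by omega)
      (fun r B _ hr => ?_) fun r _ hr => ?_)
    · exact Function.update_of_ne (by rw [Ne, Prod.mk.injEq]; omega) _ _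
    · exact Function.update_of_ne (by omega) _ _
  have hHm : ∀ A, Measurable fun q : Fin K × (Fin K → ℝ) => h A q.1 q.2 :=
    fun A => measurable_from_prod_countable_right fun a => hh A a
  have key : ∀ A, ∫⁻ p in {p : Outcome K | runArms C₀ T p.1 p.2 t = A},
        G p * h (runArms C₀ T p.1 p.2 t) (runArm C₀ T p.1 p.2 t) (p.2 t) ∂outcomeLaw ν =
      ∫⁻ p in {p : Outcome K | runArms C₀ T p.1 p.2 t = A}, G p * ∫⁻ v, ∫⁻ x,
        h (runArms C₀ T p.1 p.2 t) x v ∂choiceLaw (runArms C₀ T p.1 p.2 t) ∂ν t ∂outcomeLaw ν := by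
    intro A
    have hchoice : Measurable fun p : Outcome K => p.1.1 (t, A) :=
      (measurable_pi_apply (X := fun _ : ℕ × Finset (Fin K) => Fin K) (t, A)).comp
        measurable_fst.fst
    have hreward : Measurable fun p : Outcome K => p.2 t :=
      (measurable_pi_apply (X := fun _ : ℕ => Fin K → ℝ) t).comp measurable_snd
    have hmeas : Measurable fun p : Outcome K => h A (p.1.1 (t, A)) (p.2 t) :=
      (hHm A).comp (hchoice.prodMk hreward)
    have hL : ∫⁻ p in {p : Outcome K | runArms C₀ T p.1 p.2 t = A},
        G p * h (runArms C₀ T p.1 p.2 t) (runArm C₀ T p.1 p.2 t) (p.2 t) ∂outcomeLaw ν =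
        ∫⁻ p in {p : Outcome K | runArms C₀ T p.1 p.2 t = A},
          G p * h A (p.1.1 (t, A)) (p.2 t) ∂outcomeLaw ν := by
      refine setLIntegral_congr_fun (hset A) fun p hp => ?_
      have hp' : runArms C₀ T p.1 p.2 t = A := hp
      obtain ⟨s, rfl⟩ : ∃ s, t = s + 1 := ⟨t - 1, by omega⟩
      have := runArm_eq (C₀ := C₀) (T := T) (ω := p.1) (y := p.2) s (by omega)
      rw [hp'] at this
      simp only [this, hp']
    have hR : ∫⁻ p in {p : Outcome K | runArms C₀ T p.1 p.2 t = A}, G p * ∫⁻ v, ∫⁻ x,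
        h (runArms C₀ T p.1 p.2 t) x v ∂choiceLaw (runArms C₀ T p.1 p.2 t) ∂ν t ∂outcomeLaw ν =
        ∫⁻ p in {p : Outcome K | runArms C₀ T p.1 p.2 t = A},
          G p * ∫⁻ v, ∫⁻ x, h A x v ∂choiceLaw A ∂ν t ∂outcomeLaw ν := by
      refine setLIntegral_congr_fun (hset A) fun p hp => ?_
      have hp' : runArms C₀ T p.1 p.2 t = A := hp
      simp only [hp']
    have hind : Measurable ({p : Outcome K | runArms C₀ T p.1 p.2 t = A}.indicator
        fun p => G p * h A (p.1.1 (t, A)) (p.2 t)) := (hG.mul hmeas).indicator (hset A)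
    rw [hL, hR, ← lintegral_indicator (hset A), ← lintegral_indicator (hset A),
      lintegral_resample ν t A hind]
    refine lintegral_congr fun p => ?_
    by_cases hp : runArms C₀ T p.1 p.2 t = A
    · have hp' : p ∈ {p : Outcome K | runArms C₀ T p.1 p.2 t = A} := hp
      rw [Set.indicator_of_mem hp']
      have : ∀ v x, ({p : Outcome K | runArms C₀ T p.1 p.2 t = A}.indicator
          (fun p => G p * h A (p.1.1 (t, A)) (p.2 t))) (resample t A p x v) =
          G p * h A x v := by
        intro v x
        rw [Set.indicator_of_mem (by
          change runArms C₀ T (resample t A p x v).1 (resample t A p x v).2 t = A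
          rw [hinvA, hp])]
        rw [hinv]
        simp [resample]
      change ∫⁻ v, ∫⁻ x, ({p : Outcome K | runArms C₀ T p.1 p.2 t = A}.indicator
          (fun p => G p * h A (p.1.1 (t, A)) (p.2 t))) (resample t A p x v)
            ∂choiceLaw A ∂ν t = _
      simp_rw [this]
      have h₃ : ∀ v, ∫⁻ x, G p * h A x v ∂choiceLaw A = G p * ∫⁻ x, h A x v ∂choiceLaw A :=
        fun v => lintegral_const_mul _ ((hHm A).comp (measurable_id.prodMk measurable_const))
      simp_rw [h₃]
      refine lintegral_const_mul _ ?_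
      exact Measurable.lintegral_prod_right' (f := fun q : (Fin K → ℝ) × Fin K => h A q.2 q.1)
        ((hHm A).comp measurable_swap)
    · have hp' : p ∉ {p : Outcome K | runArms C₀ T p.1 p.2 t = A} := hp
      rw [Set.indicator_of_notMem hp']
      refine lintegral_eq_zero_of_ae_eq_zero (Filter.Eventually.of_forall fun v => ?_)
      refine lintegral_eq_zero_of_ae_eq_zero (Filter.Eventually.of_forall fun x => ?_)
      exact Set.indicator_of_notMem (by
        change ¬ runArms C₀ T (resample t A p x v).1 (resample t A p x v).2 t = A
        rw [hinvA]; exact hp) _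
  have hsum : ∀ F : Outcome K → ENNReal, ∫⁻ p, F p ∂outcomeLaw ν =
      ∑ A : Finset (Fin K), ∫⁻ p in {p : Outcome K | runArms C₀ T p.1 p.2 t = A}, F p
        ∂outcomeLaw ν := by
    intro F
    rw [← lintegral_biUnion_finset (fun A _ B _ hAB => ?_) fun A _ => hset A]
    · have : (⋃ A ∈ (Finset.univ : Finset (Finset (Fin K))),
          {p : Outcome K | runArms C₀ T p.1 p.2 t = A}) = Set.univ := by
        ext p; simp
      rw [this, setLIntegral_univ]
    · rw [Function.onFun, Set.disjoint_left]
      intro p hp hp'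
      exact hAB (hp.symm.trans hp')
  rw [hsum, hsum (fun p => G p * ∫⁻ v, ∫⁻ x, h (runArms C₀ T p.1 p.2 t) x v
        ∂choiceLaw (runArms C₀ T p.1 p.2 t) ∂ν t)]
  exact Finset.sum_congr rfl fun A _ => key A

end oneStep

/-! ### Concentration of the importance-weighted estimates -/

section choiceLaw

variable {K : ℕ}

lemma lintegral_choiceLaw {A : Finset (Fin K)} (hA : A.Nonempty) (f : Fin K → ENNReal) :
    ∫⁻ x, f x ∂choiceLaw A = (∑ x ∈ A, f x) / A.card := by
  classical
  have h₁ : ∀ x, choiceLaw A {x} = if x ∈ A then (A.card : ENNReal)⁻¹ else 0 := by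
    intro x
    have := uniformOn_apply_finset (s := A) (t := {x})
    rw [Finset.coe_singleton] at this
    rw [choiceLaw, if_pos hA, this]
    split_ifs with h
    · rw [Finset.inter_singleton_of_mem h]
      simp
    · rw [Finset.inter_singleton_of_notMem h]
      simp
  rw [lintegral_fintype]
  simp only [h₁, mul_ite, mul_zero, Finset.sum_ite_mem, Finset.univ_inter]
  rw [← Finset.sum_mul, div_eq_mul_inv]

lemma lintegral_choiceLaw_ofReal {A : Finset (Fin K)} (hA : A.Nonempty) {f : Fin K → ℝ}
    (hf : ∀ x, 0 ≤ f x) : ∫⁻ x, ENNReal.ofReal (f x) ∂choiceLaw A =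
      ENNReal.ofReal ((∑ x ∈ A, f x) / A.card) := by
  rw [lintegral_choiceLaw hA, ← ENNReal.ofReal_sum_of_nonneg fun x _ => hf x,
    ENNReal.ofReal_div_of_pos (by exact_mod_cast hA.card_pos), ENNReal.ofReal_natCast]

/-- The second order bound for the exponential moment of the error of the importance-weighted
estimate: `v` is the reward of the arm `a`, and `m` is its mean.  The bound is linear in `v`, since
`v² ≤ v`. -/
lemma average_exp_le {A : Finset (Fin K)} {a : Fin K} (ha : a ∈ A) {l v m : ℝ} (hl : |l| * K ≤ 1)
    (hv : v ∈ Set.Icc (0 : ℝ) 1) (hm : m ∈ Set.Icc (0 : ℝ) 1) :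
    (∑ x ∈ A, Real.exp (l * (A.card * (if x = a then v else 0) - m))) / A.card ≤
      1 + l * (v - m) + l ^ 2 * (A.card * v - 2 * m * v + m ^ 2) := by
  have hn : (1 : ℝ) ≤ A.card := by exact_mod_cast Finset.card_pos.2 ⟨a, ha⟩
  have hnK : (A.card : ℝ) ≤ K := by
    exact_mod_cast (Finset.card_le_univ A).trans (Fintype.card_fin K).le
  set n : ℝ := (A.card : ℝ) with hnd
  have hterm : ∀ x ∈ A, Real.exp (l * (n * (if x = a then v else 0) - m)) ≤
      (1 - l * m + l ^ 2 * m ^ 2) +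
        (if x = a then l * n * v + l ^ 2 * (n ^ 2 * v - 2 * n * m * v) else 0) := by
    intro x _
    have habs : |n * (if x = a then v else 0) - m| ≤ K := by
      rw [abs_le]
      split_ifs
      · constructor <;> nlinarith [hv.1, hv.2, hm.1, hm.2]
      · constructor <;> nlinarith [hv.1, hv.2, hm.1, hm.2]
    have h₁ : |l * (n * (if x = a then v else 0) - m)| ≤ 1 := by
      rw [abs_mul]
      exact (mul_le_mul_of_nonneg_left habs (abs_nonneg l)).trans hl
    have h₂ := (abs_le.1 (Real.abs_exp_sub_one_sub_id_le h₁)).2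
    have h₃ : 0 ≤ l ^ 2 * n ^ 2 * (v * (1 - v)) :=
      mul_nonneg (by positivity) (mul_nonneg hv.1 (by linarith [hv.2]))
    split_ifs with hx
    · rw [if_pos hx] at h₂
      nlinarith
    · rw [if_neg hx] at h₂
      nlinarith
  rw [div_le_iff₀ (by linarith)]
  refine (Finset.sum_le_sum hterm).trans (le_of_eq ?_)
  rw [Finset.sum_add_distrib, Finset.sum_const, Finset.sum_ite_eq' A a, if_pos ha, nsmul_eq_mul,
    ← hnd]
  ring

end choiceLaw

section mean

variable {K : ℕ} (ν : ℕ → Measure (Fin K → ℝ)) [∀ t, IsProbabilityMeasure (ν t)]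

lemma integrable_reward (hν : ∀ t, ∀ᵐ y ∂(ν t), ∀ a, y a ∈ Set.Icc (0 : ℝ) 1) (t : ℕ)
    (a : Fin K) : Integrable (fun y => y a) (ν t) := by
  refine Integrable.of_bound (measurable_pi_apply a).aestronglyMeasurable 1 ?_
  filter_upwards [hν t] with y hy
  rw [Real.norm_eq_abs, abs_of_nonneg (hy a).1]
  exact (hy a).2

lemma mean_mem_Icc (hν : ∀ t, ∀ᵐ y ∂(ν t), ∀ a, y a ∈ Set.Icc (0 : ℝ) 1) (t : ℕ) (a : Fin K) :
    mean ν t a ∈ Set.Icc (0 : ℝ) 1 := by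
  refine ⟨integral_nonneg_of_ae ?_, ?_⟩
  · filter_upwards [hν t] with y hy using (hy a).1
  · calc mean ν t a ≤ ∫ _, (1 : ℝ) ∂(ν t) := by
          refine integral_mono_ae (integrable_reward ν hν t a) (integrable_const _) ?_
          filter_upwards [hν t] with y hy using (hy a).2
      _ = 1 := by simp

end mean

section concentration

variable {K : ℕ} [NeZero K] (ν : ℕ → Measure (Fin K → ℝ)) [∀ t, IsProbabilityMeasure (ν t)]

/-- The log of a round depends only on the draws and the reward vectors up to this round. -/
lemma runLog_resample {C₀ : ℝ} {T r t : ℕ} (A : Finset (Fin K)) (p : Outcome K) (x : Fin K)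
    (v : Fin K → ℝ) (h₁ : 1 ≤ r) (h₂ : r < t) (h₃ : r ≤ T) :
    runLog C₀ T (resample t A p x v).1 (resample t A p x v).2 r = runLog C₀ T p.1 p.2 r := by
  obtain ⟨s, rfl⟩ : ∃ s, r = s + 1 := ⟨r - 1, by omega⟩
  have hs : runArms C₀ T (resample t A p x v).1 (resample t A p x v).2 (s + 1) =
      runArms C₀ T p.1 p.2 (s + 1) := by
    unfold runArms
    refine congrArg State.activeArms (runState_congr (T := T) (c := (resample t A p x v).1.1)
      (c' := p.1.1) (b := p.1.2) (y := (resample t A p x v).2) (y' := p.2) s (by omega)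
      (fun r B _ hr => ?_) fun r _ hr => ?_)
    · exact Function.update_of_ne (by rw [Ne, Prod.mk.injEq]; omega) _ _
    · exact Function.update_of_ne (by omega) _ _
  have harm : runArm C₀ T (resample t A p x v).1 (resample t A p x v).2 (s + 1) =
      runArm C₀ T p.1 p.2 (s + 1) := by
    rw [runArm_eq s (by omega), runArm_eq s (by omega), hs]
    exact Function.update_of_ne (by rw [Ne, Prod.mk.injEq]; omega) _ _
  have hy : (resample t A p x v).2 (s + 1) = p.2 (s + 1) :=
    Function.update_of_ne (by omega) _ _
  unfold runLog
  rw [hs, harm, hy]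

/-- The exponential moment of the error of one estimate; the linear term vanishes in the mean. -/
lemma lintegral_exp_error_le (hν : ∀ t, ∀ᵐ y ∂(ν t), ∀ a, y a ∈ Set.Icc (0 : ℝ) 1) (t : ℕ)
    (a : Fin K) (A : Finset (Fin K)) {l : ℝ} (hl : |l| * K ≤ 1) :
    ∫⁻ v, ∫⁻ x, ENNReal.ofReal (Real.exp (l * (A.card * (if x = a then v a else 0) -
      if a ∈ A then mean ν t a else 0))) ∂choiceLaw A ∂ν t ≤
        ENNReal.ofReal (Real.exp (l ^ 2 * K)) := by
  have h1 : ENNReal.ofReal 1 ≤ ENNReal.ofReal (Real.exp (l ^ 2 * K)) :=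
    ENNReal.ofReal_le_ofReal (Real.one_le_exp (by positivity))
  rcases A.eq_empty_or_nonempty with rfl | hA
  · simpa using h1
  simp only [lintegral_choiceLaw_ofReal hA fun x => (Real.exp_pos _).le]
  have hn : (0 : ℝ) < A.card := by exact_mod_cast hA.card_pos
  by_cases ha : a ∈ A
  · simp only [if_pos ha]
    set m := mean ν t a with hmd
    have hm : m ∈ Set.Icc (0 : ℝ) 1 := mean_mem_Icc ν hν t a
    have hint := integrable_reward ν hν t a
    have hbound : ∀ᵐ v ∂ν t,
        (∑ x ∈ A, Real.exp (l * (A.card * (if x = a then v a else 0) - m))) / A.card ≤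
          1 + l * (v a - m) + l ^ 2 * (A.card * v a - 2 * m * v a + m ^ 2) := by
      filter_upwards [hν t] with v hv using average_exp_le ha hl (hv a) hm
    have hlin' : ∀ v : Fin K → ℝ, 1 + l * (v a - m) +
        l ^ 2 * (A.card * v a - 2 * m * v a + m ^ 2) =
        (1 - l * m + l ^ 2 * m ^ 2) + (l + l ^ 2 * (A.card - 2 * m)) * v a := by
      intro v; ring
    have hlin : Integrable (fun v => 1 + l * (v a - m) +
        l ^ 2 * (A.card * v a - 2 * m * v a + m ^ 2)) (ν t) := by
      simp only [hlin']
      exact (integrable_const _).add (hint.const_mul _)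
    calc ∫⁻ v, ENNReal.ofReal ((∑ x ∈ A, Real.exp (l * (A.card * (if x = a then v a else 0) - m))) /
            A.card) ∂ν t
        ≤ ∫⁻ v, ENNReal.ofReal (1 + l * (v a - m) +
            l ^ 2 * (A.card * v a - 2 * m * v a + m ^ 2)) ∂ν t := by
          refine lintegral_mono_ae ?_
          filter_upwards [hbound] with v hv using ENNReal.ofReal_le_ofReal hv
      _ = ENNReal.ofReal (∫ v, (1 + l * (v a - m) +
            l ^ 2 * (A.card * v a - 2 * m * v a + m ^ 2)) ∂ν t) := by
          refine (ofReal_integral_eq_lintegral_ofReal hlin ?_).symm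
          filter_upwards [hbound] with v hv using
            (div_nonneg (Finset.sum_nonneg fun x _ => (Real.exp_pos _).le) hn.le).trans hv
      _ = ENNReal.ofReal (1 + l ^ 2 * (A.card * m - m ^ 2)) := by
          congr 1
          simp only [hlin']
          rw [integral_add (integrable_const _) (hint.const_mul _), integral_const_mul]
          change _ + _ * m = _
          simp
          ring
      _ ≤ ENNReal.ofReal (Real.exp (l ^ 2 * K)) := by
          refine ENNReal.ofReal_le_ofReal ?_
          have hnK : (A.card : ℝ) ≤ K := by
            exact_mod_cast (Finset.card_le_univ A).trans (Fintype.card_fin K).le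
          have : l ^ 2 * (A.card * m - m ^ 2) ≤ l ^ 2 * K := by
            refine mul_le_mul_of_nonneg_left ?_ (sq_nonneg l)
            nlinarith [hm.1, hm.2, sq_nonneg m]
          linarith [Real.add_one_le_exp (l ^ 2 * K)]
  · have : ∀ v : Fin K → ℝ, (∑ x ∈ A, Real.exp (l * (A.card * (if x = a then v a else 0) -
        if a ∈ A then mean ν t a else 0))) / A.card = 1 := by
      intro v
      rw [Finset.sum_congr rfl fun x hx => by
        rw [if_neg (by rintro rfl; exact ha hx), if_neg ha]]
      simp [hn.ne']
    simp only [this, lintegral_const, measure_univ, mul_one]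
    exact h1

lemma measurable_estError {t : ℕ} (μ : ℕ → Fin K → ℝ) {C₀ : ℝ} {T : ℕ} (a : Fin K) (h₁ : 1 ≤ t)
    (h₂ : t ≤ T) : Measurable fun p : Outcome K => estError μ (runLog C₀ T p.1 p.2) a t := by
  have : Measurable fun x : Finset (Fin K) × Fin K × ℝ =>
      (x.1.card : ℝ) * (if x.2.1 = a then x.2.2 else 0) - if a ∈ x.1 then μ t a else 0 := by
    refine measurable_from_prod_countable_right fun A => ?_
    refine measurable_from_prod_countable_right fun i => ?_
    simp only
    split_ifs <;> fun_prop
  exact this.comp (measurable_run t h₁ h₂).2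

/-- The exponential moment of the sum of the errors over an interval. -/
lemma lintegral_exp_sum_estError_le (hν : ∀ t, ∀ᵐ y ∂(ν t), ∀ a, y a ∈ Set.Icc (0 : ℝ) 1)
    {C₀ : ℝ} {T : ℕ} (a : Fin K) {l : ℝ} (hl : |l| * K ≤ 1) {s : ℕ} (hs : 1 ≤ s) (n : ℕ)
    (hn : s + n ≤ T + 1) :
    ∫⁻ p, ENNReal.ofReal (Real.exp (l * ∑ r ∈ Finset.Ico s (s + n),
      estError (mean ν) (runLog C₀ T p.1 p.2) a r)) ∂outcomeLaw ν ≤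
        ENNReal.ofReal (Real.exp (l ^ 2 * K)) ^ n := by
  induction n with
  | zero => simp
  | succ n ih =>
    set c := ENNReal.ofReal (Real.exp (l ^ 2 * K)) with hc
    let G : Outcome K → ENNReal := fun p => ENNReal.ofReal (Real.exp (l *
      ∑ r ∈ Finset.Ico s (s + n), estError (mean ν) (runLog C₀ T p.1 p.2) a r))
    let h : Finset (Fin K) → Fin K → (Fin K → ℝ) → ENNReal := fun A x v =>
      ENNReal.ofReal (Real.exp (l * (A.card * (if x = a then v x else 0) -
        if a ∈ A then mean ν (s + n) a else 0)))
    have hG : Measurable G := by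
      refine ENNReal.measurable_ofReal.comp (Real.measurable_exp.comp (Measurable.const_mul ?_ l))
      refine Finset.measurable_sum _ fun r hr => ?_
      rw [Finset.mem_Ico] at hr
      exact measurable_estError _ a (by omega) (by omega)
    have hinv : ∀ A p x v, G (resample (s + n) A p x v) = G p := by
      intro A p x v
      have : ∀ r ∈ Finset.Ico s (s + n), estError (mean ν)
          (runLog C₀ T (resample (s + n) A p x v).1 (resample (s + n) A p x v).2) a r =
          estError (mean ν) (runLog C₀ T p.1 p.2) a r := by
        intro r hr
        rw [Finset.mem_Ico] at hr
        unfold estError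
        rw [runLog_resample A p x v (by omega) hr.2 (by omega)]
      simp only [G]
      rw [Finset.sum_congr rfl this]
    have hh : ∀ A x, Measurable (h A x) := by
      intro A x
      simp only [h]
      split_ifs <;> fun_prop
    calc ∫⁻ p, ENNReal.ofReal (Real.exp (l * ∑ r ∈ Finset.Ico s (s + (n + 1)),
          estError (mean ν) (runLog C₀ T p.1 p.2) a r)) ∂outcomeLaw ν
        = ∫⁻ p, G p * h (runArms C₀ T p.1 p.2 (s + n)) (runArm C₀ T p.1 p.2 (s + n))
            (p.2 (s + n)) ∂outcomeLaw ν := by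
          refine lintegral_congr fun p => ?_
          rw [← ENNReal.ofReal_mul (Real.exp_pos _).le, ← Real.exp_add, ← mul_add, ← add_assoc,
            Finset.sum_Ico_succ_top (Nat.le_add_right s n)]
          rfl
      _ = ∫⁻ p, G p * ∫⁻ v, ∫⁻ x, h (runArms C₀ T p.1 p.2 (s + n)) x v
            ∂choiceLaw (runArms C₀ T p.1 p.2 (s + n)) ∂ν (s + n) ∂outcomeLaw ν :=
          lintegral_oneStep ν (by omega) (by omega) hG hinv hh
      _ ≤ ∫⁻ p, G p * c ∂outcomeLaw ν := by
          refine lintegral_mono fun p => mul_le_mul_right ?_ _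
          have : ∀ (A : Finset (Fin K)) (x : Fin K) (v : Fin K → ℝ), h A x v =
              ENNReal.ofReal (Real.exp (l * (A.card * (if x = a then v a else 0) -
                if a ∈ A then mean ν (s + n) a else 0))) := by
            intro A x v
            simp only [h]
            by_cases hx : x = a
            · subst hx; rfl
            · rw [if_neg hx, if_neg hx]
          simp only [this]
          exact lintegral_exp_error_le ν hν (s + n) a _ hl
      _ ≤ c ^ (n + 1) := by
          rw [lintegral_mul_const _ hG, pow_succ]
          exact mul_le_mul_left (ih (by omega)) _

/-- With high probability, all estimates are accurate: the exponential moment of the error, divided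
by the radius, is at most `exp 2 ≤ 8`, and there are at most `T³` pairs of an arm and an
interval. -/
lemma outcomeLaw_not_accurate_le (hν : ∀ t, ∀ᵐ y ∂(ν t), ∀ a, y a ∈ Set.Icc (0 : ℝ) 1) (C₀ : ℝ)
    {T N : ℕ} (hT : 2 ≤ T) (hKT : K ≤ T) (hN : N ≤ T) :
    outcomeLaw ν {p | ¬ Accurate T N (mean ν) (runLog C₀ T p.1 p.2)} ≤ ENNReal.ofReal (16 / T) := by
  have hT0 : (0 : ℝ) < T := by exact_mod_cast (by omega : 0 < T)
  have hK0 : (0 : ℝ) < K := Nat.cast_pos.2 (NeZero.pos K)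
  have htail : ∀ (l : ℝ) (a : Fin K) (s₁ s₂ : ℕ), 1 ≤ s₁ → s₁ < s₂ → s₂ ≤ N →
      |l| = (radius K (s₂ - s₁))⁻¹ →
      outcomeLaw ν {p : Outcome K | 4 * Real.log T ≤ l * ∑ r ∈ Finset.Icc s₁ s₂,
        estError (mean ν) (runLog C₀ T p.1 p.2) a r} ≤ ENNReal.ofReal (8 / T ^ 4) := by
    intro l a s₁ s₂ h₁ h₂ h₃ hl
    have hR : 0 < radius K (s₂ - s₁) := radius_pos
    have hlK : |l| * K ≤ 1 := by
      rw [hl, inv_mul_le_iff₀ hR, mul_one]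
      exact le_radius
    have hlsq : l ^ 2 * K * (s₂ + 1 - s₁ : ℕ) ≤ 2 := by
      have h₄ : (K : ℝ) * (s₂ - s₁ : ℕ) ≤ radius K (s₂ - s₁) ^ 2 := by
        rw [radius, Real.sq_sqrt (by positivity)]
        exact le_max_left _ _
      have h₅ : ((s₂ + 1 - s₁ : ℕ) : ℝ) ≤ 2 * (s₂ - s₁ : ℕ) := by
        exact_mod_cast (by omega : s₂ + 1 - s₁ ≤ 2 * (s₂ - s₁))
      rw [← sq_abs, hl, inv_pow, mul_assoc, inv_mul_le_iff₀ (by positivity)]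
      nlinarith
    have hexp := lintegral_exp_sum_estError_le ν hν (C₀ := C₀) (T := T) a hlK h₁ (s₂ + 1 - s₁)
      (by omega)
    rw [show s₁ + (s₂ + 1 - s₁) = s₂ + 1 by omega, Finset.Ico_add_one_right_eq_Icc,
      ← ENNReal.ofReal_pow (Real.exp_pos _).le, ← Real.exp_nat_mul] at hexp
    have hle : Real.exp ((s₂ + 1 - s₁ : ℕ) * (l ^ 2 * K)) ≤ 8 := by
      have h8 : Real.exp 2 ≤ 8 := by
        have := Real.exp_one_lt_d9
        rw [show (2 : ℝ) = 1 + 1 by norm_num, Real.exp_add]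
        nlinarith [Real.exp_pos 1]
      exact (Real.exp_le_exp.2 (by linarith)).trans h8
    have hmarkov := mul_meas_ge_le_lintegral₀ (μ := outcomeLaw ν)
      (f := fun p => ENNReal.ofReal (Real.exp (l * ∑ r ∈ Finset.Icc s₁ s₂,
        estError (mean ν) (runLog C₀ T p.1 p.2) a r))) (Measurable.aemeasurable (by
          refine ENNReal.measurable_ofReal.comp (Real.measurable_exp.comp (Measurable.const_mul ?_ l))
          refine Finset.measurable_sum _ fun r hr => ?_
          rw [Finset.mem_Icc] at hr
          exact measurable_estError _ a (by omega) (by omega))) (ENNReal.ofReal (T ^ 4))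
    have hsub : {p : Outcome K | 4 * Real.log T ≤ l * ∑ r ∈ Finset.Icc s₁ s₂,
        estError (mean ν) (runLog C₀ T p.1 p.2) a r} ⊆ {p | ENNReal.ofReal (T ^ 4) ≤
          ENNReal.ofReal (Real.exp (l * ∑ r ∈ Finset.Icc s₁ s₂,
            estError (mean ν) (runLog C₀ T p.1 p.2) a r))} := by
      intro p hp
      refine ENNReal.ofReal_le_ofReal ?_
      have h₄ : (T : ℝ) ^ 4 = Real.exp (4 * Real.log T) := by
        rw [mul_comm, Real.exp_mul, Real.exp_log hT0]; norm_cast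
      rw [h₄]
      exact Real.exp_le_exp.2 hp
    rw [ENNReal.ofReal_div_of_pos (by positivity)]
    rw [ENNReal.le_div_iff_mul_le (Or.inl (by positivity)) (Or.inl ENNReal.ofReal_ne_top), mul_comm]
    refine (mul_le_mul_right (measure_mono hsub) _).trans (hmarkov.trans (hexp.trans ?_))
    exact ENNReal.ofReal_le_ofReal hle
  have hunion : {p | ¬ Accurate T N (mean ν) (runLog C₀ T p.1 p.2)} ⊆
      ⋃ i ∈ (Finset.univ : Finset (Fin K)) ×ˢ ((Finset.Icc 1 N ×ˢ Finset.Icc 1 N).filter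
        fun s => s.1 < s.2),
        ({p : Outcome K | 4 * Real.log T ≤ (radius K (i.2.2 - i.2.1))⁻¹ * ∑ r ∈ Finset.Icc i.2.1 i.2.2,
          estError (mean ν) (runLog C₀ T p.1 p.2) i.1 r} ∪
        {p : Outcome K | 4 * Real.log T ≤ -(radius K (i.2.2 - i.2.1))⁻¹ * ∑ r ∈ Finset.Icc i.2.1 i.2.2,
          estError (mean ν) (runLog C₀ T p.1 p.2) i.1 r}) := by
    intro p hp
    simp only [Set.mem_ofPred_eq, Accurate, not_forall, not_le] at hp
    obtain ⟨a, s₁, s₂, h₁, h₂, h₃, h⟩ := hp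
    refine Set.mem_biUnion (x := (a, s₁, s₂)) (by simp; omega) ?_
    have hR : 0 < radius K (s₂ - s₁) := radius_pos
    rcases le_abs.1 h.le with h' | h'
    · left
      simp only [Set.mem_ofPred_eq]
      rw [inv_mul_eq_div, le_div_iff₀ hR]
      exact h'
    · right
      simp only [Set.mem_ofPred_eq]
      rw [neg_mul, ← mul_neg, inv_mul_eq_div, le_div_iff₀ hR]
      exact h'
  refine (measure_mono hunion).trans ((measure_biUnion_finset_le _ _).trans ?_)
  have hcard : ((Finset.univ : Finset (Fin K)) ×ˢ ((Finset.Icc 1 N ×ˢ Finset.Icc 1 N).filter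
        fun s => s.1 < s.2)).card ≤ T ^ 3 := by
    rw [Finset.card_product, Finset.card_univ, Fintype.card_fin]
    have := Finset.card_filter_le (Finset.Icc 1 N ×ˢ Finset.Icc 1 N) fun s => s.1 < s.2
    rw [Finset.card_product, Nat.card_Icc, Nat.add_sub_cancel] at this
    calc _ ≤ T * (T * T) := Nat.mul_le_mul hKT (this.trans (Nat.mul_le_mul hN hN))
      _ = T ^ 3 := by ring
  have hbound : ∀ i ∈ (Finset.univ : Finset (Fin K)) ×ˢ ((Finset.Icc 1 N ×ˢ Finset.Icc 1 N).filter
        fun s => s.1 < s.2), outcomeLaw ν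
        ({p : Outcome K | 4 * Real.log T ≤ (radius K (i.2.2 - i.2.1))⁻¹ * ∑ r ∈ Finset.Icc i.2.1 i.2.2,
          estError (mean ν) (runLog C₀ T p.1 p.2) i.1 r} ∪
        {p : Outcome K | 4 * Real.log T ≤ -(radius K (i.2.2 - i.2.1))⁻¹ * ∑ r ∈ Finset.Icc i.2.1 i.2.2,
          estError (mean ν) (runLog C₀ T p.1 p.2) i.1 r}) ≤ ENNReal.ofReal (16 / T ^ 4) := by
    rintro ⟨a, s₁, s₂⟩ hi
    simp only [Finset.mem_product, Finset.mem_univ, Finset.mem_filter, Finset.mem_Icc,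
      true_and] at hi
    have hR : 0 < radius K (s₂ - s₁) := radius_pos
    refine (measure_union_le _ _).trans ?_
    rw [show (16 : ℝ) / T ^ 4 = 8 / T ^ 4 + 8 / T ^ 4 by ring,
      ENNReal.ofReal_add (by positivity) (by positivity)]
    refine add_le_add (htail _ a s₁ s₂ hi.1.1.1 hi.2 hi.1.2.2 ?_)
      (htail _ a s₁ s₂ hi.1.1.1 hi.2 hi.1.2.2 ?_)
    · exact abs_of_pos (inv_pos.2 hR)
    · rw [abs_neg, abs_of_pos (inv_pos.2 hR)]
  refine (Finset.sum_le_card_nsmul _ _ _ hbound).trans ?_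
  rw [nsmul_eq_mul, ← ENNReal.ofReal_natCast, ← ENNReal.ofReal_mul (by positivity)]
  refine ENNReal.ofReal_le_ofReal ?_
  have hcard' : (((Finset.univ : Finset (Fin K)) ×ˢ ((Finset.Icc 1 N ×ˢ Finset.Icc 1 N).filter
        fun s => s.1 < s.2)).card : ℝ) ≤ T ^ 3 := by exact_mod_cast hcard
  calc _ ≤ (T : ℝ) ^ 3 * (16 / T ^ 4) := by gcongr
    _ = 16 / T := by field_simp

/-- The candidate sets are not empty: an instance is resumed only if its episode continues. -/
lemma runArms_nonempty {C₀ : ℝ} {T t : ℕ} (ω : MetaSeed K) (y : ℕ → Fin K → ℝ) (h₁ : 1 ≤ t)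
    (h₂ : t ≤ T) : (runArms C₀ T ω y t).Nonempty := by
  have hrun := isRun_run (C₀ := C₀) (ω := ω) (y := y) (le_refl T)
  have hmem := hrun.start_mem h₁ h₂
  change (runLog C₀ T ω y t).1.Nonempty
  rw [hrun.arms t h₁ h₂, Finset.sdiff_nonempty]
  intro h
  rcases hmem.2.eq_or_lt with h₃ | h₃
  · rw [h₃, badArms_self (by omega)] at h
    exact Finset.univ_nonempty.ne_empty (Finset.subset_empty.1 h)
  · refine hrun.badArms_ne_univ h₁ h₂ (Or.inr h₃) (Finset.univ_subset_iff.1 (h.trans ?_))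
    exact badArms_mono hmem.1 le_rfl

/-- The expected gap of the arm played is the average gap of the candidates. -/
lemma lintegral_gap_runArm (μ : ℕ → Fin K → ℝ) {C₀ : ℝ} {T t : ℕ} (h₁ : 1 ≤ t) (h₂ : t ≤ T) :
    ∫⁻ p, ENNReal.ofReal (gap μ t (runArm C₀ T p.1 p.2 t)) ∂outcomeLaw ν =
      ∫⁻ p, ENNReal.ofReal (averageGap μ (runArms C₀ T p.1 p.2 t) t) ∂outcomeLaw ν := by
  have := lintegral_oneStep ν (C₀ := C₀) h₁ h₂ (G := fun _ => 1) measurable_const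
    (fun _ _ _ _ => rfl) (h := fun _ a _ => ENNReal.ofReal (gap μ t a)) fun _ _ => measurable_const
  simp only [one_mul, lintegral_const, measure_univ, mul_one] at this
  rw [this]
  refine lintegral_congr fun p => ?_
  rw [lintegral_choiceLaw_ofReal (runArms_nonempty p.1 p.2 h₁ h₂) fun x => gap_nonneg t x]
  rfl

end concentration

/-! ### The number of replays, and the probability of missing all of them -/

section product

variable {ι : Type*} [DecidableEq ι] {X : ι → Type*} [∀ i, MeasurableSpace (X i)]
  (m : ∀ i, Measure (X i)) [∀ i, IsProbabilityMeasure (m i)]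

/-- The coordinates of a product measure are independent. -/
lemma lintegral_prod_infinitePi (F : Finset ι) {g : ∀ i, X i → ENNReal}
    (hg : ∀ i, Measurable (g i)) :
    ∫⁻ ω, ∏ i ∈ F, g i (ω i) ∂Measure.infinitePi m = ∏ i ∈ F, ∫⁻ x, g i x ∂m i := by
  have hmeas : ∀ F : Finset ι, Measurable fun ω : ∀ i, X i => ∏ i ∈ F, g i (ω i) :=
    fun F => Finset.measurable_prod _ fun i _ => (hg i).comp (measurable_pi_apply i)
  induction F using Finset.induction_on with
  | empty => simp
  | insert i F hi ih =>
    rw [Finset.prod_insert hi, lintegral_update_infinitePi m i (hmeas _), ← ih,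
      ← lintegral_const_mul _ (hmeas F)]
    refine lintegral_congr fun ω => ?_
    rw [← lintegral_mul_const _ (hg i)]
    refine lintegral_congr fun x => ?_
    rw [Finset.prod_insert hi, Function.update_self]
    congr 1
    exact Finset.prod_congr rfl fun j hj => by
      rw [Function.update_of_ne (by rintro rfl; exact hi hj)]

end product

section replays

lemma replayProb_mem_Icc {e s : ℕ} (h : e < s) (j : ℕ) : replayProb e s j ∈ Set.Icc (0 : ℝ) 1 := by
  have h₁ : (1 : ℝ) ≤ (s : ℝ) - e := by
    have : ((e + 1 : ℕ) : ℝ) ≤ s := by exact_mod_cast h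
    push_cast at this
    linarith
  have h₂ : (1 : ℝ) ≤ 2 ^ j * ((s : ℝ) - e) := one_le_mul_of_one_le_of_one_le (one_le_pow₀ one_le_two) h₁
  refine ⟨by unfold replayProb; positivity, ?_⟩
  rw [replayProb, div_le_one (by positivity)]
  exact Real.one_le_sqrt.2 h₂

lemma replayLaw_true {e s : ℕ} (h : e < s) (j : ℕ) :
    replayLaw (e, s, j) {true} = ENNReal.ofReal (replayProb e s j) := by
  have hp := replayProb_mem_Icc h j
  rw [replayLaw, bernoulliMeasure_apply_of_mem_of_notMem _ (by measurability) (by simp) (by simp)]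
  change _ = ENNReal.ofReal _
  rw [show (1 / √((2 : ℝ) ^ j * ((s : ℝ) - (e : ℝ)))) = replayProb e s j from rfl,
    Set.projIcc_of_mem _ hp]
  rw [ENNReal.ofReal]
  congr 1
  ext
  simp [hp.1]

lemma replayLaw_false {e s : ℕ} (h : e < s) (j : ℕ) :
    replayLaw (e, s, j) {false} = ENNReal.ofReal (1 - replayProb e s j) := by
  have hp := replayProb_mem_Icc h j
  have h₁ : replayLaw (e, s, j) {false} = 1 - replayLaw (e, s, j) {true} := by
    rw [← prob_compl_eq_one_sub (by measurability)]
    congr 1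
    ext b
    cases b <;> simp
  rw [h₁, replayLaw_true h, ENNReal.ofReal_sub _ hp.1, ENNReal.ofReal_one]

lemma replayLaw_no_replay_le (F : Finset (ℕ × ℕ)) {e : ℕ} (h : ∀ q ∈ F, e < q.1) :
    Measure.infinitePi replayLaw {b | ∀ q ∈ F, b (e, q.1, q.2) = false} ≤
      ENNReal.ofReal (Real.exp (-∑ q ∈ F, replayProb e q.1 q.2)) := by
  classical
  have hinj : Set.InjOn (fun q : ℕ × ℕ => (e, q.1, q.2)) F := by
    rintro ⟨a, b⟩ _ ⟨c, d⟩ _ h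
    simpa using h
  have hset : {b : ℕ × ℕ × ℕ → Bool | ∀ q ∈ F, b (e, q.1, q.2) = false} =
      Set.pi (F.image fun q => (e, q.1, q.2) : Finset (ℕ × ℕ × ℕ)) fun _ => {false} := by
    ext b
    simp only [Set.mem_ofPred_eq, Set.mem_pi, Finset.mem_coe, Set.mem_singleton_iff,
      Finset.forall_mem_image]
  rw [hset, Measure.infinitePi_pi _ fun _ _ => by measurability, Finset.prod_image hinj,
    ← Finset.sum_neg_distrib, Real.exp_sum, ENNReal.ofReal_prod_of_nonneg
      fun q _ => (Real.exp_pos _).le]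
  refine Finset.prod_le_prod' fun q hq => ?_
  rw [replayLaw_false (h q hq)]
  refine ENNReal.ofReal_le_ofReal ?_
  linarith [Real.add_one_le_exp (-replayProb e q.1 q.2)]

/-- The upper tail of the number of replays of a given length, by the exponential moment; the factor
`2` bounds `exp 1 - 1`. -/
lemma replayLaw_count_le (F : Finset ℕ) {e : ℕ} (h : ∀ s ∈ F, e < s) (j : ℕ) (x : ℝ) :
    Measure.infinitePi replayLaw {b | x ≤ ((F.filter fun s => b (e, s, j) = true).card : ℝ)} ≤
      ENNReal.ofReal (Real.exp (2 * ∑ s ∈ F, replayProb e s j - x)) := by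
  classical
  let g : ℕ × ℕ × ℕ → Bool → ENNReal := fun _ b =>
    ENNReal.ofReal (Real.exp (if b = true then 1 else 0))
  have hinj : Set.InjOn (fun s : ℕ => (e, s, j)) F := by
    intro a _ b _ h
    simpa using h
  have hprod : ∀ b : ℕ × ℕ × ℕ → Bool, ∏ i ∈ F.image fun s => (e, s, j), g i (b i) =
      ENNReal.ofReal (Real.exp ((F.filter fun s => b (e, s, j) = true).card)) := by
    intro b
    rw [Finset.prod_image hinj, ← ENNReal.ofReal_prod_of_nonneg fun q _ => (Real.exp_pos _).le,
      ← Real.exp_sum, Finset.sum_boole]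
  have hg : ∀ s ∈ F, ∫⁻ b, g (e, s, j) b ∂replayLaw (e, s, j) ≤
      ENNReal.ofReal (Real.exp (2 * replayProb e s j)) := by
    intro s hs
    have hp := replayProb_mem_Icc (h s hs) j
    rw [lintegral_fintype, Fintype.sum_bool, replayLaw_true (h s hs), replayLaw_false (h s hs)]
    simp only [g, if_true, Bool.false_eq_true, if_false, Real.exp_zero]
    rw [← ENNReal.ofReal_mul (Real.exp_pos _).le, ← ENNReal.ofReal_mul zero_le_one,
      ← ENNReal.ofReal_add (mul_nonneg (Real.exp_pos _).le hp.1) (by linarith [hp.2])]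
    refine ENNReal.ofReal_le_ofReal ?_
    have h₁ := Real.add_one_le_exp (2 * replayProb e s j)
    have h₂ := Real.exp_one_lt_d9
    nlinarith [hp.1]
  have hint : ∫⁻ b, ENNReal.ofReal (Real.exp ((F.filter fun s => b (e, s, j) = true).card))
      ∂Measure.infinitePi replayLaw ≤
        ENNReal.ofReal (Real.exp (2 * ∑ s ∈ F, replayProb e s j)) := by
    simp only [← hprod]
    rw [lintegral_prod_infinitePi replayLaw _ fun _ => Measurable.of_discrete,
      Finset.prod_image hinj, Finset.mul_sum, Real.exp_sum,
      ENNReal.ofReal_prod_of_nonneg fun q _ => (Real.exp_pos _).le]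
    exact Finset.prod_le_prod' hg
  have hmeas : Measurable fun b : ℕ × ℕ × ℕ → Bool =>
      ENNReal.ofReal (Real.exp ((F.filter fun s => b (e, s, j) = true).card)) := by
    simp only [← hprod]
    exact Finset.measurable_prod _ fun i _ =>
      (Measurable.of_discrete (f := g i)).comp (measurable_pi_apply i)
  have hmarkov := mul_meas_ge_le_lintegral (μ := Measure.infinitePi replayLaw) hmeas
    (ENNReal.ofReal (Real.exp x))
  rw [Real.exp_sub, ENNReal.ofReal_div_of_pos (Real.exp_pos _), ENNReal.le_div_iff_mul_le
    (Or.inl (by simpa using Real.exp_pos x)) (Or.inl ENNReal.ofReal_ne_top), mul_comm]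
  refine (mul_le_mul_right (measure_mono fun b hb => ?_) _).trans (hmarkov.trans hint)
  exact ENNReal.ofReal_le_ofReal (Real.exp_le_exp.2 hb)

/-- The expected number of replays of length `2 ^ j` in an interval, by comparison of the sum of
`1 / √k` with the telescoping sum of `2 (√k - √(k - 1))`. -/
lemma sum_replayProb_le (e j u v : ℕ) (huv : u ≤ v) :
    ∑ s ∈ Finset.Ioc (e + u) (e + v), replayProb e s j ≤ 2 * √((v - u : ℕ) / (2 : ℝ) ^ j) := by
  have h₁ : ∀ n, ∑ s ∈ Finset.Ioc (e + u) (e + (u + n)), replayProb e s j ≤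
      2 * (√((u + n : ℕ) : ℝ) - √(u : ℝ)) / √((2 : ℝ) ^ j) := by
    intro n
    induction n with
    | zero => simp
    | succ n ih =>
      have hIoc : Finset.Ioc (e + u) (e + (u + (n + 1))) =
          insert (e + (u + n) + 1) (Finset.Ioc (e + u) (e + (u + n))) := by
        ext s; simp only [Finset.mem_Ioc, Finset.mem_insert]; omega
      rw [hIoc, Finset.sum_insert (by simp)]
      have h₂ : replayProb e (e + (u + n) + 1) j ≤
          2 * (√((u + (n + 1) : ℕ) : ℝ) - √((u + n : ℕ) : ℝ)) / √((2 : ℝ) ^ j) := by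
        have hc : ((e + (u + n) + 1 : ℕ) : ℝ) - e = ((u + (n + 1) : ℕ) : ℝ) := by push_cast; ring
        rw [replayProb, hc, Real.sqrt_mul (by positivity), mul_comm, ← div_div]
        refine div_le_div_of_nonneg_right ?_ (Real.sqrt_nonneg _)
        have hc' : ((u + (n + 1) : ℕ) : ℝ) = ((u + n : ℕ) : ℝ) + 1 := by push_cast; ring
        rw [hc']
        set k : ℝ := ((u + n : ℕ) : ℝ)
        have hk : 0 ≤ k := Nat.cast_nonneg _
        rw [div_le_iff₀ (Real.sqrt_pos.2 (by linarith))]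
        have ha := Real.sq_sqrt hk
        have hb := Real.sq_sqrt (show (0 : ℝ) ≤ k + 1 by linarith)
        have hle := Real.sqrt_le_sqrt (show k ≤ k + 1 by linarith)
        nlinarith [Real.sqrt_nonneg k, sq_nonneg (√(k + 1) - √k)]
      calc _ ≤ _ := add_le_add h₂ ih
        _ = _ := by ring
  have h₂ := h₁ (v - u)
  rw [Nat.add_sub_cancel' huv] at h₂
  refine h₂.trans ?_
  rw [Real.sqrt_div (Nat.cast_nonneg _), mul_div_assoc]
  have h₃ : √(v : ℝ) - √(u : ℝ) ≤ √((v - u : ℕ) : ℝ) := by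
    rw [sub_le_iff_le_add]
    have : (v : ℝ) = (v - u : ℕ) + (u : ℝ) := by rw [Nat.cast_sub huv]; ring
    conv_lhs => rw [this]
    refine Real.sqrt_le_iff.2 ⟨by positivity, ?_⟩
    nlinarith [Real.sq_sqrt (Nat.cast_nonneg (α := ℝ) (v - u)),
      Real.sq_sqrt (Nat.cast_nonneg (α := ℝ) u), Real.sqrt_nonneg ((v - u : ℕ) : ℝ),
      Real.sqrt_nonneg (u : ℝ)]
  gcongr

variable {K : ℕ} {C₀ : ℝ} {T N : ℕ} {μ : ℕ → Fin K → ℝ} {φ : ℕ → ℕ}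

lemma lt_of_mem_detectingReplays {e w : ℕ} {a : Fin K} {q : ℕ × ℕ}
    (hq : q ∈ detectingReplays C₀ T μ φ e a w) : e < q.1 := by
  classical
  simp only [detectingReplays, Finset.mem_biUnion, segEnds, Finset.mem_filter, Finset.mem_Ico,
    Finset.mem_product, Finset.mem_Ioc] at hq
  obtain ⟨t, ⟨⟨h₁, -⟩, -⟩, ⟨h₂, -⟩, -⟩ := hq
  exact (segStart_mem h₁).1.trans_lt h₂

lemma exp_neg_nat_mul_log (hT : 0 < T) (k : ℕ) :
    Real.exp (-(k * Real.log T)) = 1 / (T : ℝ) ^ k := by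
  rw [Real.exp_neg, mul_comm, Real.exp_mul, Real.exp_log (by exact_mod_cast hT),
    Real.rpow_natCast, one_div]

/-- With high probability, the replays are as they should be: the first property can fail in at
most `T⁴` ways, each of probability at most `1 / T⁵`, and the second one in at most `T³` ways, each
of probability at most `1 / T⁴`. -/
lemma replayLaw_not_goodReplays_le (hT : 2 ≤ T) (hKT : K ≤ T) (hN : N ≤ T) :
    Measure.infinitePi replayLaw {b | ¬ GoodReplays C₀ T N μ φ b} ≤ ENNReal.ofReal (2 / T) := by
  have hT0 : (0 : ℝ) < T := by exact_mod_cast (by omega : 0 < T)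
  set P := Measure.infinitePi replayLaw
  have hcount : P (⋃ i ∈ (Finset.Icc 1 N ×ˢ Finset.Icc 1 (Nat.clog 2 T)) ×ˢ
      ((Finset.range N ×ˢ Finset.range N).filter fun w => w.1 ≤ w.2),
      {b | 4 * √((i.2.2 - i.2.1 : ℕ) / (2 : ℝ) ^ i.1.2) + 5 * Real.log T ≤
        (((Finset.Ioc (i.1.1 + i.2.1) (i.1.1 + i.2.2)).filter
          fun s => b (i.1.1, s, i.1.2) = true).card : ℝ)}) ≤ ENNReal.ofReal (1 / T) := by
    refine (measure_biUnion_finset_le _ _).trans ?_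
    have hbound : ∀ i ∈ (Finset.Icc 1 N ×ˢ Finset.Icc 1 (Nat.clog 2 T)) ×ˢ
        ((Finset.range N ×ˢ Finset.range N).filter fun w => w.1 ≤ w.2),
        P {b | 4 * √((i.2.2 - i.2.1 : ℕ) / (2 : ℝ) ^ i.1.2) + 5 * Real.log T ≤
        (((Finset.Ioc (i.1.1 + i.2.1) (i.1.1 + i.2.2)).filter
          fun s => b (i.1.1, s, i.1.2) = true).card : ℝ)} ≤ ENNReal.ofReal (1 / T ^ 5) := by
      rintro ⟨⟨e, j⟩, u, v⟩ hi
      simp only [Finset.mem_product, Finset.mem_filter] at hi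
      refine (replayLaw_count_le (Finset.Ioc (e + u) (e + v)) (fun s hs => ?_) j _).trans ?_
      · change e < s
        have := (Finset.mem_Ioc.1 hs).1
        omega
      · rw [← exp_neg_nat_mul_log (by omega)]
        refine ENNReal.ofReal_le_ofReal (Real.exp_le_exp.2 ?_)
        have := sum_replayProb_le e j u v hi.2.2
        push_cast
        linarith
    refine (Finset.sum_le_card_nsmul _ _ _ hbound).trans ?_
    rw [nsmul_eq_mul, ← ENNReal.ofReal_natCast, ← ENNReal.ofReal_mul (by positivity)]
    refine ENNReal.ofReal_le_ofReal ?_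
    have hcard : ((Finset.Icc 1 N ×ˢ Finset.Icc 1 (Nat.clog 2 T)) ×ˢ
        ((Finset.range N ×ˢ Finset.range N).filter fun w => w.1 ≤ w.2)).card ≤ T ^ 4 := by
      have h₁ := Finset.card_filter_le (Finset.range N ×ˢ Finset.range N) fun w => w.1 ≤ w.2
      rw [Finset.card_product, Finset.card_range] at h₁
      have h₂ : Nat.clog 2 T ≤ T := Nat.clog_le_of_le_pow Nat.lt_two_pow_self.le
      rw [Finset.card_product, Finset.card_product, Nat.card_Icc, Nat.card_Icc]
      simp only [Nat.add_sub_cancel]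
      calc _ ≤ (T * T) * (T * T) :=
            Nat.mul_le_mul (Nat.mul_le_mul hN h₂) (h₁.trans (Nat.mul_le_mul hN hN))
        _ = T ^ 4 := by ring
    calc _ ≤ (T : ℝ) ^ 4 * (1 / T ^ 5) := by
          refine mul_le_mul_of_nonneg_right ?_ (by positivity)
          exact_mod_cast hcard
      _ = 1 / T := by field_simp
  have hdetect : P (⋃ i ∈ ((Finset.Icc 1 N ×ˢ (Finset.univ : Finset (Fin K))) ×ˢ
      Finset.Icc 1 N).filter fun i => 4 * Real.log T ≤
        ∑ q ∈ detectingReplays C₀ T μ φ i.1.1 i.1.2 i.2, replayProb i.1.1 q.1 q.2,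
      {b | ∀ q ∈ detectingReplays C₀ T μ φ i.1.1 i.1.2 i.2, b (i.1.1, q.1, q.2) = false}) ≤
        ENNReal.ofReal (1 / T) := by
    refine (measure_biUnion_finset_le _ _).trans ?_
    have hbound : ∀ i ∈ ((Finset.Icc 1 N ×ˢ (Finset.univ : Finset (Fin K))) ×ˢ
        Finset.Icc 1 N).filter fun i => 4 * Real.log T ≤
          ∑ q ∈ detectingReplays C₀ T μ φ i.1.1 i.1.2 i.2, replayProb i.1.1 q.1 q.2,
        P {b | ∀ q ∈ detectingReplays C₀ T μ φ i.1.1 i.1.2 i.2, b (i.1.1, q.1, q.2) = false} ≤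
          ENNReal.ofReal (1 / T ^ 4) := by
      rintro ⟨⟨e, a⟩, w⟩ hi
      rw [Finset.mem_filter] at hi
      refine (replayLaw_no_replay_le _ fun q hq => lt_of_mem_detectingReplays hq).trans ?_
      rw [← exp_neg_nat_mul_log (by omega)]
      refine ENNReal.ofReal_le_ofReal (Real.exp_le_exp.2 ?_)
      have := hi.2
      push_cast
      linarith
    refine (Finset.sum_le_card_nsmul _ _ _ hbound).trans ?_
    rw [nsmul_eq_mul, ← ENNReal.ofReal_natCast, ← ENNReal.ofReal_mul (by positivity)]
    refine ENNReal.ofReal_le_ofReal ?_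
    have hcard : (((Finset.Icc 1 N ×ˢ (Finset.univ : Finset (Fin K))) ×ˢ
        Finset.Icc 1 N).filter fun i => 4 * Real.log T ≤
          ∑ q ∈ detectingReplays C₀ T μ φ i.1.1 i.1.2 i.2, replayProb i.1.1 q.1 q.2).card ≤
        T ^ 3 := by
      refine (Finset.card_filter_le _ _).trans ?_
      rw [Finset.card_product, Finset.card_product, Nat.card_Icc, Finset.card_univ,
        Fintype.card_fin]
      simp only [Nat.add_sub_cancel]
      calc _ ≤ (T * T) * T := Nat.mul_le_mul (Nat.mul_le_mul hN hKT) hN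
        _ = T ^ 3 := by ring
    calc _ ≤ (T : ℝ) ^ 3 * (1 / T ^ 4) := by
          refine mul_le_mul_of_nonneg_right ?_ (by positivity)
          exact_mod_cast hcard
      _ = 1 / T := by field_simp
  rw [show (2 : ℝ) / T = 1 / T + 1 / T by ring, ENNReal.ofReal_add (by positivity) (by positivity)]
  refine le_trans (measure_mono ?_) ((measure_union_le _ _).trans (add_le_add hcount hdetect))
  intro b hb
  by_contra hcon
  rw [Set.mem_union, not_or] at hcon
  refine hb ⟨fun e j u v he hj huv hv => ?_, fun e a w he hew hw => ?_⟩
  · by_contra h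
    refine hcon.1 (Set.mem_biUnion (x := ((e, j), u, v)) ?_ (not_le.1 h).le)
    simp only [Finset.coe_product, Finset.coe_filter, Set.mem_prod, Finset.mem_coe, hj]
    simp
    omega
  · by_contra h
    rw [not_or, not_le] at h
    refine hcon.2 (Set.mem_biUnion (x := ((e, a), w)) ?_ fun q hq => ?_)
    · simp only [Finset.coe_filter, Set.mem_ofPred_eq, Finset.mem_product, Finset.mem_Icc,
        Finset.mem_univ, and_true]
      exact ⟨by omega, h.1.le⟩
    · by_contra hq'
      exact h.2 ⟨q, hq, by simpa using hq'⟩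

end replays

/-! ### Phases between significant shifts -/

section phases

variable {K : ℕ} {μ : ℕ → Fin K → ℝ} {T : ℕ}

/-- A significant shift that occurs by round `T` does have the defining property. -/
lemma shiftTime_succ_spec {i : ℕ} (h : shiftTime μ T (i + 1) ≠ ⊤) :
    shiftTime μ T i < shiftTime μ T (i + 1) ∧ shiftTime μ T (i + 1) ≤ T ∧
      ∀ a : Fin K, ∃ s₁ s₂ : ℕ, s₁ < s₂ ∧ shiftTime μ T i ≤ (s₁ : ℕ∞) ∧
        (s₂ : ℕ∞) ≤ shiftTime μ T (i + 1) ∧ SignificantRegret μ a s₁ s₂ := by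
  rw [shiftTime] at h ⊢
  set S := {τ : ℕ∞ | shiftTime μ T i < τ ∧ τ ≤ (T : ℕ∞) ∧
      ∀ a : Fin K, ∃ s₁ s₂ : ℕ, s₁ < s₂ ∧ shiftTime μ T i ≤ (s₁ : ℕ∞) ∧ (s₂ : ℕ∞) ≤ τ ∧
        SignificantRegret μ a s₁ s₂}
  rcases S.eq_empty_or_nonempty with hS | hS
  · rw [hS, sInf_empty] at h
    exact absurd rfl h
  · exact csInf_mem hS

lemma shiftTime_mono : Monotone (shiftTime μ T) := by
  refine monotone_nat_of_le_succ fun i => ?_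
  by_cases h : shiftTime μ T (i + 1) = ⊤
  · rw [h]; exact le_top
  · exact (shiftTime_succ_spec h).1.le

lemma lt_shiftTime (i : ℕ) : (i : ℕ∞) < shiftTime μ T i := by
  induction i with
  | zero => simp [shiftTime]
  | succ i ih =>
    by_cases h : shiftTime μ T (i + 1) = ⊤
    · rw [h]; exact ENat.natCast_lt_top _
    · have h₁ := (shiftTime_succ_spec h).1
      have h₂ : ((i + 1 : ℕ) : ℕ∞) ≤ shiftTime μ T i := by
        push_cast
        exact Order.add_one_le_of_lt ih
      exact h₂.trans_lt h₁

open Classical in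
/-- The number of significant shifts up to round `t`. -/
def phase {K : ℕ} (μ : ℕ → Fin K → ℝ) (T t : ℕ) : ℕ :=
  Nat.findGreatest (fun i => shiftTime μ T i ≤ (t : ℕ∞)) t

lemma shiftTime_phase_le {t : ℕ} (ht : 1 ≤ t) : shiftTime μ T (phase μ T t) ≤ t := by
  classical
  refine Nat.findGreatest_spec (P := fun i => shiftTime μ T i ≤ (t : ℕ∞)) (Nat.zero_le t) ?_
  simpa [shiftTime] using ht

lemma le_phase {t i : ℕ} (h : shiftTime μ T i ≤ t) : i ≤ phase μ T t := by
  classical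
  exact Nat.le_findGreatest (by exact_mod_cast ((lt_shiftTime i).trans_le h).le) h

lemma lt_shiftTime_phase {t : ℕ} : (t : ℕ∞) < shiftTime μ T (phase μ T t + 1) := by
  by_contra h
  have := le_phase (not_lt.1 h)
  omega

lemma phase_mono : Monotone (phase μ T) := by
  intro t t' h
  rcases Nat.eq_zero_or_pos t with rfl | ht
  · simp [phase]
  · exact le_phase ((shiftTime_phase_le ht).trans (by exact_mod_cast h))

/-- Before the next significant shift, some arm has no significant regret.  Otherwise the latest of
the ends of the intervals on which the arms have significant regret would be a significant
shift. -/
lemma exists_safe [NeZero K] (i : ℕ) : ∃ a : Fin K, ∀ s₁ s₂ : ℕ, s₁ < s₂ → s₂ ≤ T →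
    shiftTime μ T i ≤ s₁ → (s₂ : ℕ∞) < shiftTime μ T (i + 1) → ¬ SignificantRegret μ a s₁ s₂ := by
  by_contra! h
  choose s₁ s₂ h₁ h₂ h₃ h₄ h₅ using h
  obtain ⟨a, -, ha⟩ := Finset.exists_max_image (Finset.univ : Finset (Fin K)) s₂
    Finset.univ_nonempty
  refine absurd (h₄ a) (not_lt.2 ?_)
  conv_lhs => rw [shiftTime]
  refine sInf_le ⟨(h₃ a).trans_lt (by exact_mod_cast h₁ a), by exact_mod_cast h₂ a, fun b => ?_⟩
  exact ⟨s₁ b, s₂ b, h₁ b, h₃ b, by exact_mod_cast ha b (Finset.mem_univ b), h₅ b⟩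

lemma exists_safePhases [NeZero K] : ∃ safe, SafePhases μ T (phase μ T) safe := by
  choose safe hsafe using fun i => exists_safe (μ := μ) (T := T) i
  refine ⟨safe, phase_mono, fun s₁ s₂ h₁ h₂ h₃ h₄ => ?_⟩
  have h := hsafe (phase μ T s₁) s₁ s₂ h₂ h₃ (shiftTime_phase_le h₁) (by
    rw [h₄]; exact lt_shiftTime_phase)
  rw [SignificantRegret, not_le] at h
  rwa [Nat.cast_sub h₂.le]

lemma phase_le_numShifts (hT : 1 ≤ T) : phase μ T T ≤ numShifts μ T := by
  have hfin : {i : ℕ | shiftTime μ T (i + 1) ≤ (T : ℕ∞)}.Finite := by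
    refine (Set.finite_Iio T).subset fun i hi => ?_
    have h := (lt_shiftTime (μ := μ) (T := T) (i + 1)).trans_le hi
    have h' : i + 1 < T := by exact_mod_cast h
    exact (Nat.lt_succ_self i).trans h'
  have hsub : (Finset.range (phase μ T T) : Set ℕ) ⊆
      {i : ℕ | shiftTime μ T (i + 1) ≤ (T : ℕ∞)} := by
    intro i hi
    rw [Finset.coe_range, Set.mem_Iio] at hi
    exact (shiftTime_mono hi).trans (shiftTime_phase_le hT)
  have := Set.ncard_le_ncard hsub hfin
  rwa [Set.ncard_coe_finset, Finset.card_range] at this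

/-- The sum over the phases of the square roots of `K` times their lengths. -/
def phaseSum {K : ℕ} (μ : ℕ → Fin K → ℝ) (T : ℕ) : ℝ :=
  ∑ i ∈ Finset.range (phase μ T T + 1),
    √((K : ℝ) * ((Finset.Icc 1 T).filter fun t => phase μ T t = i).card)

lemma sum_card_phase : ∑ i ∈ Finset.range (phase μ T T + 1),
    ((Finset.Icc 1 T).filter fun t => phase μ T t = i).card = T := by
  rw [← Finset.card_eq_sum_card_fiberwise (f := phase μ T), Nat.card_Icc, Nat.add_sub_cancel]
  intro t ht
  rw [Finset.mem_coe, Finset.mem_Icc] at ht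
  rw [Finset.mem_coe, Finset.mem_range]
  exact Nat.lt_succ_of_le (phase_mono ht.2)

/-- The phase sum, bounded in terms of the number of significant shifts by the Cauchy-Schwarz
inequality. -/
lemma phaseSum_le_sqrt (hT : 1 ≤ T) :
    phaseSum μ T ≤ √(((numShifts μ T : ℝ) + 1) * K * T) := by
  refine Real.le_sqrt_of_sq_le ((sq_sum_le_card_mul_sum_sq).trans ?_)
  have h₁ : ∑ i ∈ Finset.range (phase μ T T + 1),
      √((K : ℝ) * ((Finset.Icc 1 T).filter fun t => phase μ T t = i).card) ^ 2 = K * T := by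
    conv_rhs => rw [← sum_card_phase (μ := μ) (T := T)]
    push_cast
    rw [Finset.mul_sum]
    exact Finset.sum_congr rfl fun i _ => Real.sq_sqrt (by positivity)
  rw [h₁, Finset.card_range, mul_assoc]
  have h₂ : ((phase μ T T + 1 : ℕ) : ℝ) ≤ numShifts μ T + 1 := by
    exact_mod_cast Nat.succ_le_succ (phase_le_numShifts hT)
  gcongr

section variation

variable (μ) in
/-- The change of the mean rewards from round `t - 1` to round `t`. -/
def meanChange (t : ℕ) : ℝ := ⨆ a : Fin K, |μ t a - μ (t - 1) a|

lemma abs_sub_le_meanChange (t : ℕ) (a : Fin K) : |μ t a - μ (t - 1) a| ≤ meanChange μ t :=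
  le_ciSup (f := fun a => |μ t a - μ (t - 1) a|) (Set.finite_range _).bddAbove a

lemma meanChange_nonneg (t : ℕ) : 0 ≤ meanChange μ t := Real.iSup_nonneg fun _ => abs_nonneg _

lemma abs_sub_le_sum_meanChange {s t : ℕ} (h : s ≤ t) (a : Fin K) :
    |μ t a - μ s a| ≤ ∑ r ∈ Finset.Ioc s t, meanChange μ r := by
  induction t, h using Nat.le_induction with
  | base => simp
  | succ t h ih =>
    rw [Finset.sum_Ioc_succ_top h]
    have h₁ := abs_sub_le_meanChange (μ := μ) (t + 1) a
    rw [Nat.add_sub_cancel] at h₁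
    calc |μ (t + 1) a - μ s a| ≤ |μ (t + 1) a - μ t a| + |μ t a - μ s a| := abs_sub_le _ _ _
      _ ≤ _ := by linarith

lemma gap_le_add_sum_meanChange [NeZero K] {s t : ℕ} (h : s ≤ t) (a : Fin K) :
    gap μ s a ≤ gap μ t a + 2 * ∑ r ∈ Finset.Ioc s t, meanChange μ r := by
  refine ciSup_le fun a' => ?_
  have h₁ := (abs_le.1 (abs_sub_le_sum_meanChange (μ := μ) h a')).1
  have h₂ := (abs_le.1 (abs_sub_le_sum_meanChange (μ := μ) h a)).2
  have h₃ := sub_le_gap (μ := μ) t a' a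
  linarith

/-- The mean rewards vary by at least `√(K / n) / 4` in a completed phase of `n` rounds, because
the arm that is optimal at its end has significant regret before. -/
lemma sqrt_le_sum_meanChange [NeZero K] {σ τ i : ℕ} (hσ : shiftTime μ T i = σ)
    (hτ : shiftTime μ T (i + 1) = τ) :
    σ < τ ∧ √(K / (τ - σ : ℕ)) ≤ 4 * ∑ r ∈ Finset.Ioc σ τ, meanChange μ r := by
  obtain ⟨h₁, -, h₂⟩ := shiftTime_succ_spec (μ := μ) (T := T) (i := i) (by rw [hτ]; simp)
  rw [hσ, hτ] at h₁ h₂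
  have hlt : σ < τ := by exact_mod_cast h₁
  refine ⟨hlt, ?_⟩
  obtain ⟨a, ha⟩ := exists_gap_eq_zero (μ := μ) τ
  obtain ⟨s₁, s₂, h₃, h₄, h₅, h₆⟩ := h₂ a
  have h₄' : σ ≤ s₁ := by exact_mod_cast h₄
  have h₅' : s₂ ≤ τ := by exact_mod_cast h₅
  set W := ∑ r ∈ Finset.Ioc σ τ, meanChange μ r
  have hW : ∀ t ∈ Finset.Icc s₁ s₂, gap μ t a ≤ 2 * W := by
    intro t ht
    rw [Finset.mem_Icc] at ht
    have h₇ := gap_le_add_sum_meanChange (μ := μ) (s := t) (t := τ) (by omega) a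
    have h₈ : ∑ r ∈ Finset.Ioc t τ, meanChange μ r ≤ W :=
      Finset.sum_le_sum_of_subset_of_nonneg (Finset.Ioc_subset_Ioc_left (by omega))
        fun r _ _ => meanChange_nonneg r
    rw [ha] at h₇
    linarith
  have h₇ := h₆.trans (Finset.sum_le_card_nsmul _ _ _ hW)
  rw [nsmul_eq_mul, Nat.card_Icc, ← Nat.cast_sub h₃.le] at h₇
  have hW0 : 0 ≤ W := Finset.sum_nonneg fun r _ => meanChange_nonneg r
  have hm : (1 : ℝ) ≤ (s₂ - s₁ : ℕ) := by exact_mod_cast (by omega : 1 ≤ s₂ - s₁)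
  have hmn : ((s₂ - s₁ : ℕ) : ℝ) ≤ (τ - σ : ℕ) := by exact_mod_cast (by omega : s₂ - s₁ ≤ τ - σ)
  have h₈ : ((s₂ + 1 - s₁ : ℕ) : ℝ) ≤ 2 * (s₂ - s₁ : ℕ) := by
    exact_mod_cast (by omega : s₂ + 1 - s₁ ≤ 2 * (s₂ - s₁))
  set m : ℝ := ((s₂ - s₁ : ℕ) : ℝ)
  have h₉ : √((K : ℝ) * m) ≤ m * (4 * W) := by nlinarith
  calc √(K / (τ - σ : ℕ)) ≤ √(K / m) := by gcongr
    _ = √((K : ℝ) * m) / m := by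
        have hm0 : 0 < m := by linarith
        rw [show (K : ℝ) / m = K * m / m ^ 2 by field_simp, Real.sqrt_div (by positivity),
          Real.sqrt_sq hm0.le]
    _ ≤ 4 * W := by rw [div_le_iff₀ (by linarith)]; linarith

lemma sqrt_mul_eq_rpow {x y : ℝ} (hx : 0 < x) (hy : 0 < y) :
    √(x * y) = (x * √(x / y)) ^ (1 / 3 : ℝ) * y ^ (2 / 3 : ℝ) := by
  rw [Real.sqrt_eq_rpow, Real.sqrt_eq_rpow, Real.mul_rpow hx.le hy.le,
    Real.mul_rpow hx.le (by positivity), Real.div_rpow hx.le hy.le,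
    Real.div_rpow (by positivity) (by positivity), ← Real.rpow_mul hx.le, ← Real.rpow_mul hy.le]
  have h₁ : x ^ (1 / 2 : ℝ) = x ^ (1 / 3 : ℝ) * x ^ (1 / 2 * (1 / 3) : ℝ) := by
    rw [← Real.rpow_add hx]; norm_num
  have h₂ : y ^ (2 / 3 : ℝ) = y ^ (1 / 2 : ℝ) * y ^ (1 / 2 * (1 / 3) : ℝ) := by
    rw [← Real.rpow_add hy]; norm_num
  have h₃ := (Real.rpow_pos_of_pos hy (1 / 2 * (1 / 3))).ne'
  rw [h₁, h₂]
  field_simp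

/-- The phase sum, bounded in terms of the total variation.  A completed phase of `n` rounds with
variation `V` contributes at most `(4 K V) ^ (1 / 3) * n ^ (2 / 3)`, and the last phase at most
`√(K T)`. -/
lemma phaseSum_le_totalVariation [NeZero K] (hT : 1 ≤ T) :
    phaseSum μ T ≤ √((K : ℝ) * T) +
      2 * (((K : ℝ) * totalVariation μ T) ^ (1 / 3 : ℝ) * (T : ℝ) ^ (2 / 3 : ℝ)) := by
  -- The phases `i < m` are completed; `σ i` is the first round of phase `i`.
  set m := phase μ T T with hm
  set σ : ℕ → ℕ := fun i => (shiftTime μ T i).toNat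
  have hσ : ∀ i ≤ m, shiftTime μ T i = σ i ∧ σ i ≤ T := by
    intro i hi
    have h := (shiftTime_mono (μ := μ) (T := T) hi).trans (shiftTime_phase_le hT)
    have h' : shiftTime μ T i = σ i := by
      refine (ENat.natCast_toNat ?_).symm
      rintro h''
      rw [h''] at h
      exact absurd h (by simp)
    exact ⟨h', by rw [h'] at h; exact_mod_cast h⟩
  have hσ0 : σ 0 = 1 := by simp [σ, shiftTime]
  have hstep : ∀ i < m, σ i < σ (i + 1) ∧ √(K / (σ (i + 1) - σ i : ℕ)) ≤
      4 * ∑ r ∈ Finset.Ioc (σ i) (σ (i + 1)), meanChange μ r := fun i hi =>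
    sqrt_le_sum_meanChange (hσ i hi.le).1 (hσ (i + 1) hi).1
  have hcard : ∀ i < m, ((Finset.Icc 1 T).filter fun t => phase μ T t = i).card ≤
      σ (i + 1) - σ i := by
    intro i hi
    rw [← Nat.card_Ico]
    refine Finset.card_le_card fun t ht => ?_
    rw [Finset.mem_filter, Finset.mem_Icc] at ht
    have h₁ := shiftTime_phase_le (μ := μ) (T := T) ht.1.1
    have h₂ := lt_shiftTime_phase (μ := μ) (T := T) (t := t)
    rw [ht.2, (hσ i hi.le).1] at h₁
    rw [ht.2, (hσ (i + 1) hi).1] at h₂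
    rw [Finset.mem_Ico]
    exact ⟨by exact_mod_cast h₁, by exact_mod_cast h₂⟩
  have hsumd : ∀ n ≤ m, ∑ i ∈ Finset.range n, (σ (i + 1) - σ i) = σ n - 1 := by
    intro n hn
    induction n with
    | zero => simp [hσ0]
    | succ n ih =>
      rw [Finset.sum_range_succ, ih (by omega)]
      have h₁ := (hstep n hn).1
      have h₂ : 1 ≤ σ n := by
        have h := shiftTime_mono (μ := μ) (T := T) (Nat.zero_le n)
        rw [(hσ n (by omega)).1, (hσ 0 (by omega)).1, hσ0] at h
        exact_mod_cast h
      omega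
  have hsumV : ∀ n ≤ m, ∑ i ∈ Finset.range n, ∑ r ∈ Finset.Ioc (σ i) (σ (i + 1)),
      meanChange μ r = ∑ r ∈ Finset.Ioc 1 (σ n), meanChange μ r := by
    intro n hn
    induction n with
    | zero => simp [hσ0]
    | succ n ih =>
      rw [Finset.sum_range_succ, ih (by omega)]
      have h₂ : 1 ≤ σ n := by
        have h := shiftTime_mono (μ := μ) (T := T) (Nat.zero_le n)
        rw [(hσ n (by omega)).1, (hσ 0 (by omega)).1, hσ0] at h
        exact_mod_cast h
      exact Finset.sum_Ioc_consecutive _ h₂ (hstep n hn).1.le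
  have hV : ∑ i ∈ Finset.range m, ∑ r ∈ Finset.Ioc (σ i) (σ (i + 1)), meanChange μ r ≤
      totalVariation μ T := by
    rw [hsumV m le_rfl]
    refine Finset.sum_le_sum_of_subset_of_nonneg (fun r hr => ?_) fun r _ _ => meanChange_nonneg r
    have := (hσ m le_rfl).2
    rw [Finset.mem_Ioc] at hr
    rw [Finset.mem_Icc]
    omega
  have hd : ((∑ i ∈ Finset.range m, (σ (i + 1) - σ i) : ℕ) : ℝ) ≤ T := by
    rw [hsumd m le_rfl]
    have := (hσ m le_rfl).2
    exact_mod_cast (Nat.sub_le _ _).trans this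
  push_cast at hd
  unfold phaseSum
  rw [Finset.sum_range_succ, add_comm]
  refine add_le_add ?_ ?_
  · refine Real.sqrt_le_sqrt (mul_le_mul_of_nonneg_left ?_ (Nat.cast_nonneg K))
    have := Finset.card_filter_le (Finset.Icc 1 T) fun t => phase μ T t = m
    rw [Nat.card_Icc, Nat.add_sub_cancel] at this
    exact_mod_cast this
  · set V : ℕ → ℝ := fun i => ∑ r ∈ Finset.Ioc (σ i) (σ (i + 1)), meanChange μ r
    set d : ℕ → ℝ := fun i => ((σ (i + 1) - σ i : ℕ) : ℝ)
    have hV0 : ∀ i, 0 ≤ V i := fun i => Finset.sum_nonneg fun r _ => meanChange_nonneg r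
    have hd0 : ∀ i, 0 ≤ d i := fun i => Nat.cast_nonneg _
    have hterm : ∀ i ∈ Finset.range m,
        √((K : ℝ) * ((Finset.Icc 1 T).filter fun t => phase μ T t = i).card) ≤
          (4 * K * V i) ^ (1 / 3 : ℝ) * (d i) ^ (2 / 3 : ℝ) := by
      intro i hi
      rw [Finset.mem_range] at hi
      have hdpos : 0 < d i := by
        have := (hstep i hi).1
        exact Nat.cast_pos.2 (by omega)
      have hc : (((Finset.Icc 1 T).filter fun t => phase μ T t = i).card : ℝ) ≤ d i := by
        exact Nat.cast_le.2 (hcard i hi)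
      have hK : (0 : ℝ) < K := Nat.cast_pos.2 (NeZero.pos K)
      refine (Real.sqrt_le_sqrt (mul_le_mul_of_nonneg_left hc hK.le)).trans ?_
      have h₁ : (K : ℝ) * √(K / d i) ≤ 4 * K * V i := by
        nlinarith [(hstep i hi).2]
      have h₂ : √((K : ℝ) * d i) =
          ((K : ℝ) * √(K / d i)) ^ (1 / 3 : ℝ) * (d i) ^ (2 / 3 : ℝ) := by
        exact sqrt_mul_eq_rpow hK hdpos
      rw [h₂]
      gcongr
    have hpq : Real.HolderConjugate 3 (3 / 2) := by
      rw [Real.holderConjugate_iff]; norm_num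
    have hholder := Real.inner_le_Lp_mul_Lq (Finset.range m)
      (fun i => (4 * K * V i) ^ (1 / 3 : ℝ)) (fun i => (d i) ^ (2 / 3 : ℝ)) hpq
    have h₁ : ∀ i, |(4 * K * V i) ^ (1 / 3 : ℝ)| ^ (3 : ℝ) = 4 * K * V i := by
      intro i
      have := hV0 i
      rw [abs_of_nonneg (by positivity), ← Real.rpow_mul (by positivity)]
      norm_num
    have h₂ : ∀ i, |(d i) ^ (2 / 3 : ℝ)| ^ (3 / 2 : ℝ) = d i := by
      intro i
      have := hd0 i
      rw [abs_of_nonneg (by positivity), ← Real.rpow_mul (by positivity)]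
      norm_num
    simp only [h₁, h₂] at hholder
    refine (Finset.sum_le_sum hterm).trans (hholder.trans ?_)
    rw [← Finset.mul_sum, show (1 : ℝ) / (3 / 2) = 2 / 3 by norm_num]
    have hV' : 0 ≤ ∑ i ∈ Finset.range m, V i := Finset.sum_nonneg fun i _ => hV0 i
    have hd' : 0 ≤ ∑ i ∈ Finset.range m, d i := Finset.sum_nonneg fun i _ => hd0 i
    have h₃ : (4 * (K : ℝ) * ∑ i ∈ Finset.range m, V i) ≤ 2 ^ (3 : ℕ) * (K * totalVariation μ T) := by
      have := mul_le_mul_of_nonneg_left hV (Nat.cast_nonneg (α := ℝ) K)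
      have hp : 0 ≤ (K : ℝ) * totalVariation μ T := le_trans (by positivity) this
      linarith
    have hp : 0 ≤ (K : ℝ) * totalVariation μ T := mul_nonneg (Nat.cast_nonneg _) (hV'.trans hV)
    rw [← mul_assoc]
    refine mul_le_mul ?_ (Real.rpow_le_rpow hd' hd (by norm_num)) (by positivity) (by positivity)
    refine (Real.rpow_le_rpow (by positivity) h₃ (by norm_num)).trans (le_of_eq ?_)
    rw [Real.mul_rpow (by positivity) hp, ← Real.rpow_natCast, ← Real.rpow_mul (by norm_num)]
    norm_num

end variation

end phases

/-! ### The regret of META with a given horizon -/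

/-- The constant in the bound for the regret of META with a given horizon. -/
def regretConst (C₀ : ℝ) : ℝ := 30 * (195 * √C₀ + 1953) + 18

section block

variable {K : ℕ} [NeZero K] (ν : ℕ → Measure (Fin K → ℝ)) [∀ t, IsProbabilityMeasure (ν t)]
  {C₀ : ℝ} {T N : ℕ} {φ : ℕ → ℕ} {safe : ℕ → Fin K}

lemma outcomeLaw_replays_le (S : Set (ℕ × ℕ × ℕ → Bool)) :
    outcomeLaw ν {p | p.1.2 ∈ S} ≤ Measure.infinitePi replayLaw S := by
  have h : MeasurePreserving (fun p : Outcome K => p.1.2) (outcomeLaw ν)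
      (Measure.infinitePi replayLaw) := measurePreserving_snd.comp measurePreserving_fst
  rw [← h.map_eq]
  exact Measure.le_map_apply h.measurable.aemeasurable S

lemma measurable_runArms (t : ℕ) (h₁ : 1 ≤ t) (h₂ : t ≤ T) :
    Measurable fun p : Outcome K => runArms C₀ T p.1 p.2 t := (measurable_run t h₁ h₂).2.fst

lemma measurable_runArm (t : ℕ) (h₁ : 1 ≤ t) (h₂ : t ≤ T) :
    Measurable fun p : Outcome K => runArm C₀ T p.1 p.2 t := (measurable_run t h₁ h₂).2.snd.fst

/-- On the good event the regret is bounded, and its complement has small probability. -/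
lemma sum_lintegral_gap_le_of_card_le
    (hν : ∀ t, ∀ᵐ y ∂(ν t), ∀ a, y a ∈ Set.Icc (0 : ℝ) 1) (hC : 100 ≤ C₀) (hT : 2 ≤ T)
    (hKT : K ≤ T) (hN : N ≤ T) (hφ : SafePhases (mean ν) N φ safe) :
    ∑ t ∈ Finset.Icc 1 N,
      ∫⁻ p, ENNReal.ofReal (gap (mean ν) t (runArm C₀ T p.1 p.2 t)) ∂outcomeLaw ν ≤
    ENNReal.ofReal (30 * (195 * √C₀ + 1953) * (1 + Real.log T) ^ 5 *
      ∑ i ∈ (Finset.Icc 1 N).image φ,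
        √((K : ℝ) * ((Finset.Icc 1 N).filter fun t => φ t = i).card) + 18) := by
  set B := 30 * (195 * √C₀ + 1953) * (1 + Real.log T) ^ 5 * ∑ i ∈ (Finset.Icc 1 N).image φ,
        √((K : ℝ) * ((Finset.Icc 1 N).filter fun t => φ t = i).card)
  have hT0 : (0 : ℝ) < T := by exact_mod_cast (by omega : 0 < T)
  have hlog : 0 ≤ Real.log T := Real.log_natCast_nonneg T
  have hB : 0 ≤ B := by positivity
  have hμ : ∀ t a, mean ν t a ∈ Set.Icc (0 : ℝ) 1 := mean_mem_Icc ν hν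
  -- This set need not be measurable, but it has a measurable superset of the same measure.
  set bad : Set (Outcome K) := {p | ¬ Accurate T N (mean ν) (runLog C₀ T p.1 p.2)} ∪
    {p | p.1.2 ∈ {b | ¬ GoodReplays C₀ T N (mean ν) φ b}}
  have hbad : outcomeLaw ν bad ≤ ENNReal.ofReal (18 / T) := by
    refine (measure_union_le _ _).trans ?_
    rw [show (18 : ℝ) / T = 16 / T + 2 / T by ring,
      ENNReal.ofReal_add (by positivity) (by positivity)]
    exact add_le_add (outcomeLaw_not_accurate_le ν hν C₀ hT hKT hN)
      ((outcomeLaw_replays_le ν _).trans (replayLaw_not_goodReplays_le hT hKT hN))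
  have hmeas : ∀ t ∈ Finset.Icc 1 N, Measurable fun p : Outcome K =>
      ENNReal.ofReal (averageGap (mean ν) (runArms C₀ T p.1 p.2 t) t) := by
    intro t ht
    rw [Finset.mem_Icc] at ht
    exact (Measurable.of_discrete (f := fun A : Finset (Fin K) =>
      ENNReal.ofReal (averageGap (mean ν) A t))).comp
        (measurable_runArms t ht.1 (ht.2.trans hN))
  calc ∑ t ∈ Finset.Icc 1 N,
        ∫⁻ p, ENNReal.ofReal (gap (mean ν) t (runArm C₀ T p.1 p.2 t)) ∂outcomeLaw ν
      = ∑ t ∈ Finset.Icc 1 N, ∫⁻ p,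
          ENNReal.ofReal (averageGap (mean ν) (runArms C₀ T p.1 p.2 t) t) ∂outcomeLaw ν := by
        refine Finset.sum_congr rfl fun t ht => ?_
        rw [Finset.mem_Icc] at ht
        exact lintegral_gap_runArm ν (mean ν) ht.1 (ht.2.trans hN)
    _ = ∫⁻ p, ENNReal.ofReal (∑ t ∈ Finset.Icc 1 N,
          averageGap (mean ν) (runArms C₀ T p.1 p.2 t) t) ∂outcomeLaw ν := by
        rw [← lintegral_finsetSum _ hmeas]
        refine lintegral_congr fun p => ?_
        rw [ENNReal.ofReal_sum_of_nonneg fun t _ => averageGap_nonneg _ _]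
    _ ≤ ∫⁻ p, (ENNReal.ofReal B + (toMeasurable (outcomeLaw ν) bad).indicator
          (fun _ => ENNReal.ofReal T) p) ∂outcomeLaw ν := by
        refine lintegral_mono fun p => ?_
        by_cases hp : p ∈ bad
        · rw [Set.indicator_of_mem (subset_toMeasurable _ _ hp)]
          refine le_add_left (ENNReal.ofReal_le_ofReal ?_)
          refine (Finset.sum_le_card_nsmul _ _ 1 fun t _ => averageGap_le_one hμ _ _).trans ?_
          rw [Nat.card_Icc, Nat.add_sub_cancel, nsmul_eq_mul, mul_one]
          exact_mod_cast hN
        · refine le_add_right (ENNReal.ofReal_le_ofReal ?_)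
          simp only [bad, Set.mem_union, Set.mem_ofPred_eq, not_or, not_not] at hp
          have h := sum_averageGap_le (lg := runLog C₀ T p.1 p.2) (b := p.1.2)
            (e := runEpisode C₀ T p.1 p.2) hC hT hKT hN hμ hφ hp.1 hp.2 (isRun_run hN)
          exact h
    _ = ENNReal.ofReal B + ENNReal.ofReal T * outcomeLaw ν bad := by
        rw [lintegral_add_left measurable_const,
          lintegral_indicator (measurableSet_toMeasurable _ _), setLIntegral_const,
          measure_toMeasurable, lintegral_const, measure_univ, mul_one]
    _ ≤ ENNReal.ofReal B + ENNReal.ofReal T * ENNReal.ofReal (18 / T) := by gcongr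
    _ = ENNReal.ofReal (B + 18) := by
        rw [← ENNReal.ofReal_mul hT0.le, mul_div_cancel₀ _ hT0.ne',
          ENNReal.ofReal_add hB (by norm_num)]

/-- The bound for the regret of META with horizon `T` over the first `N` rounds.  If there are more
arms than rounds, then the trivial bound suffices. -/
lemma sum_lintegral_gap_le (hν : ∀ t, ∀ᵐ y ∂(ν t), ∀ a, y a ∈ Set.Icc (0 : ℝ) 1) (hC : 100 ≤ C₀)
    (hN : N ≤ T) (hφ : SafePhases (mean ν) N φ safe) :
    ∑ t ∈ Finset.Icc 1 N,
      ∫⁻ p, ENNReal.ofReal (gap (mean ν) t (runArm C₀ T p.1 p.2 t)) ∂outcomeLaw ν ≤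
    ENNReal.ofReal (regretConst C₀ * (1 + Real.log T) ^ 5 *
      ∑ i ∈ (Finset.Icc 1 N).image φ,
        √((K : ℝ) * ((Finset.Icc 1 N).filter fun t => φ t = i).card)) := by
  set S := ∑ i ∈ (Finset.Icc 1 N).image φ,
    √((K : ℝ) * ((Finset.Icc 1 N).filter fun t => φ t = i).card) with hSdef
  have hlog : 0 ≤ Real.log T := Real.log_natCast_nonneg T
  have hS : √((K : ℝ) * N) ≤ S := by
    have h₁ : (K : ℝ) * N = ∑ i ∈ (Finset.Icc 1 N).image φ,
        (K : ℝ) * ((Finset.Icc 1 N).filter fun t => φ t = i).card := by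
      have h₂ := Finset.card_eq_sum_card_image φ (Finset.Icc 1 N)
      rw [Nat.card_Icc, Nat.add_sub_cancel] at h₂
      rw [← Finset.mul_sum, ← Nat.cast_sum, ← h₂]
    rw [h₁]
    exact sqrt_sum_le_sum_sqrt _ _ fun i => by positivity
  have hpow : 1 ≤ (1 + Real.log T) ^ 5 := one_le_pow₀ (by linarith)
  have hK1 : (1 : ℝ) ≤ K := by exact_mod_cast NeZero.one_le (n := K)
  have hS0 : 0 ≤ S := (Real.sqrt_nonneg _).trans hS
  have hsq := Real.sqrt_nonneg C₀
  have hmul : S ≤ (1 + Real.log T) ^ 5 * S := le_mul_of_one_le_left hS0 hpow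
  rcases Nat.lt_or_ge K N with h | h
  · refine (sum_lintegral_gap_le_of_card_le ν hν hC (by have := NeZero.one_le (n := K); omega)
      (by omega) hN hφ).trans (ENNReal.ofReal_le_ofReal ?_)
    have h1 : (1 : ℝ) ≤ S := by
      refine le_trans (Real.one_le_sqrt.2 ?_) hS
      have : (1 : ℝ) ≤ N := by exact_mod_cast (by omega : 1 ≤ N)
      nlinarith
    rw [← hSdef, regretConst]
    nlinarith
  · have hterm : ∀ t ∈ Finset.Icc 1 N,
        ∫⁻ p, ENNReal.ofReal (gap (mean ν) t (runArm C₀ T p.1 p.2 t)) ∂outcomeLaw ν ≤ 1 := by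
      intro t _
      calc _ ≤ ∫⁻ _, 1 ∂outcomeLaw ν := by
            refine lintegral_mono fun p => ?_
            rw [← ENNReal.ofReal_one]
            exact ENNReal.ofReal_le_ofReal (gap_le_one (mean_mem_Icc ν hν) t _)
        _ = 1 := by simp
    refine (Finset.sum_le_card_nsmul _ _ _ hterm).trans ?_
    rw [Nat.card_Icc, Nat.add_sub_cancel, nsmul_eq_mul, mul_one, ← ENNReal.ofReal_natCast]
    refine ENNReal.ofReal_le_ofReal ?_
    have h1 : (N : ℝ) ≤ S := by
      refine le_trans (Real.le_sqrt_of_sq_le ?_) hS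
      have h' : (N : ℝ) ≤ K := by exact_mod_cast h
      nlinarith [Nat.cast_nonneg (α := ℝ) N]
    rw [regretConst]
    nlinarith [mul_nonneg hsq (hS0.trans hmul)]

end block

/-! ### The doubling trick -/

section doubling

variable {K : ℕ}

lemma length_history (π : Policy K) (ω : π.Seed) (y : ℕ → Fin K → ℝ) (t : ℕ) :
    (π.history ω y t).length = t := by
  induction t with
  | zero => rfl
  | succ t ih => rw [Policy.history, List.length_append, ih]; rfl

lemma log_two_block {n k : ℕ} (hk : k < 2 ^ n) : Nat.log 2 (2 ^ n - 1 + k + 1) = n := by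
  have := Nat.two_pow_pos n
  rw [Nat.log_eq_iff (Or.inr ⟨by norm_num, by omega⟩), pow_succ]
  omega

variable (π : ℕ → Policy K) (ω : ∀ n, (π n).Seed) (y : ℕ → Fin K → ℝ)

lemma doubling_act {n k : ℕ} (hk : k < 2 ^ n) (h : List (Fin K × ℝ))
    (hh : h.length = 2 ^ n - 1 + k) :
    (doubling π).act ω h = (π n).act (ω n) (h.drop (2 ^ n - 1)) := by
  have hlog : Nat.log 2 (h.length + 1) = n := by rw [hh, log_two_block hk]
  change (π (Nat.log 2 (h.length + 1))).act (ω (Nat.log 2 (h.length + 1)))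
    (h.drop (2 ^ Nat.log 2 (h.length + 1) - 1)) = _
  rw [hlog]

/-- In a block, the doubling policy sees what the policy of the block would see alone. -/
lemma drop_history_doubling {n : ℕ} (k : ℕ) (hk : k ≤ 2 ^ n) :
    ((doubling π).history ω y (2 ^ n - 1 + k)).drop (2 ^ n - 1) =
      (π n).history (ω n) (fun r => y (2 ^ n - 1 + r)) k := by
  induction k with
  | zero => exact List.drop_eq_nil_of_le (length_history _ _ _ _).le
  | succ k ih =>
    have hlen := length_history (doubling π) ω y (2 ^ n - 1 + k)
    have ih' := ih (by omega)
    have hact := doubling_act π ω (by omega) _ hlen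
    rw [ih'] at hact
    change ((doubling π).history ω y (2 ^ n - 1 + k) ++ [(_, y (2 ^ n - 1 + (k + 1)) _)]).drop
        (2 ^ n - 1) = (π n).history (ω n) (fun r => y (2 ^ n - 1 + r)) k ++
          [(_, y (2 ^ n - 1 + (k + 1)) _)]
    rw [List.drop_append_of_le_length (by omega), ih']
    exact congrArg (fun a => (π n).history (ω n) (fun r => y (2 ^ n - 1 + r)) k ++
      [(a, y (2 ^ n - 1 + (k + 1)) a)]) hact

lemma doubling_arm {n s : ℕ} (h₁ : 1 ≤ s) (h₂ : s ≤ 2 ^ n) :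
    (doubling π).arm ω y (2 ^ n - 1 + s) =
      (π n).arm (ω n) (fun r => y (2 ^ n - 1 + r)) s := by
  obtain ⟨k, rfl⟩ : ∃ k, s = k + 1 := ⟨s - 1, by omega⟩
  have hlen := length_history (doubling π) ω y (2 ^ n - 1 + k)
  change (doubling π).act ω ((doubling π).history ω y (2 ^ n - 1 + k)) =
    (π n).act (ω n) ((π n).history (ω n) (fun r => y (2 ^ n - 1 + r)) k)
  rw [doubling_act π ω (by omega) _ hlen, drop_history_doubling π ω y k (by omega)]

end doubling

/-- The rounds after round `c` inherit the phases. -/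
lemma safePhases_shift {K : ℕ} {μ : ℕ → Fin K → ℝ} {T N c : ℕ} {φ : ℕ → ℕ} {safe : ℕ → Fin K}
    (h : SafePhases μ T φ safe) (hN : c + N ≤ T) :
    SafePhases (fun t => μ (c + t)) N (fun t => φ (c + t)) safe where
  mono := fun s t hst => h.mono (Nat.add_le_add_left hst c)
  lt := by
    intro s₁ s₂ h₁ h₂ h₃ h₄
    have h₅ := h.lt (c + s₁) (c + s₂) (by omega) (by omega) (by omega) h₄
    rw [← Finset.image_add_left_Icc, Finset.sum_image fun x _ y _ hxy => Nat.add_left_cancel hxy,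
      Nat.add_sub_add_left] at h₅
    exact h₅

section regret

variable {K : ℕ} [NeZero K] (C₀ : ℝ) (ν : ℕ → Measure (Fin K → ℝ)) [∀ t, IsProbabilityMeasure (ν t)]

/-- The joint law of the seed of the doubling-horizon version of META and of the reward vectors. -/
def doublingLaw : Measure ((metaDoubling K C₀).Seed × (ℕ → Fin K → ℝ)) :=
  (metaDoubling K C₀).law.prod (Measure.infinitePi ν)

instance : IsProbabilityMeasure (doublingLaw C₀ ν) := by
  unfold doublingLaw
  infer_instance

/-- The seed of block `n`, and the reward vectors from the start of this block on. -/
def blockOutcome (n : ℕ) (q : (metaDoubling K C₀).Seed × (ℕ → Fin K → ℝ)) : Outcome K :=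
  (q.1 n, fun r => q.2 (2 ^ n - 1 + r))

lemma measurePreserving_blockOutcome (n : ℕ) :
    MeasurePreserving (blockOutcome C₀ n) (doublingLaw C₀ ν)
      (outcomeLaw fun r => ν (2 ^ n - 1 + r)) := by
  have h₁ : MeasurePreserving (fun ω : ℕ → MetaSeed K => ω n)
      (Measure.infinitePi fun _ : ℕ => metaLaw K) (metaLaw K) :=
    measurePreserving_eval_infinitePi (fun _ : ℕ => metaLaw K) n
  have h₂ : MeasurePreserving (fun (y : ℕ → Fin K → ℝ) r => y (2 ^ n - 1 + r))
      (Measure.infinitePi ν) (Measure.infinitePi fun r => ν (2 ^ n - 1 + r)) :=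
    ⟨by fun_prop, Measure.map_infinitePi_infinitePi_of_inj (add_right_injective _)⟩
  exact h₁.prod h₂

lemma metaDoubling_arm {n s : ℕ} (h₁ : 1 ≤ s) (h₂ : s ≤ 2 ^ n)
    (q : (metaDoubling K C₀).Seed × (ℕ → Fin K → ℝ)) :
    (metaDoubling K C₀).arm q.1 q.2 (2 ^ n - 1 + s) =
      runArm C₀ (2 ^ n) (blockOutcome C₀ n q).1 (blockOutcome C₀ n q).2 s :=
  doubling_arm (fun n => metaPolicy K C₀ (2 ^ n)) q.1 q.2 h₁ h₂

/-- Round `t` is round `s` of block `⌊log₂ t⌋`. -/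
lemma exists_block {t : ℕ} (ht : 1 ≤ t) :
    ∃ s, 1 ≤ s ∧ s ≤ 2 ^ Nat.log 2 t ∧ t = 2 ^ Nat.log 2 t - 1 + s := by
  have h₁ := Nat.pow_log_le_self 2 (by omega : t ≠ 0)
  have h₂ := Nat.lt_pow_succ_log_self (b := 2) (by norm_num) t
  rw [pow_succ] at h₂
  have h₃ := Nat.two_pow_pos (Nat.log 2 t)
  exact ⟨t - (2 ^ Nat.log 2 t - 1), by omega, by omega, by omega⟩

lemma measurable_metaDoubling_arm {t : ℕ} (ht : 1 ≤ t) :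
    Measurable fun q : (metaDoubling K C₀).Seed × (ℕ → Fin K → ℝ) =>
      (metaDoubling K C₀).arm q.1 q.2 t := by
  obtain ⟨s, h₁, h₂, h₃⟩ := exists_block ht
  generalize Nat.log 2 t = n at h₂ h₃
  subst h₃
  simp only [metaDoubling_arm C₀ h₁ h₂]
  -- The map `blockOutcome` is measurable, whatever the laws of the rewards.
  exact (measurable_runArm s h₁ h₂).comp
    (measurePreserving_blockOutcome C₀ (fun _ => Measure.dirac 0) n).measurable

/-- The dynamic regret is the expected sum of the gaps. -/
lemma ofReal_dynamicRegret (hν : ∀ t, ∀ᵐ y ∂(ν t), ∀ a, y a ∈ Set.Icc (0 : ℝ) 1) (T : ℕ) :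
    ENNReal.ofReal (dynamicRegret (metaDoubling K C₀) ν T) = ∑ t ∈ Finset.Icc 1 T,
      ∫⁻ q, ENNReal.ofReal (gap (mean ν) t ((metaDoubling K C₀).arm q.1 q.2 t))
        ∂doublingLaw C₀ ν := by
  have hμ := mean_mem_Icc ν hν
  have hmeas : ∀ t ∈ Finset.Icc 1 T, ∀ f : Fin K → ℝ, Measurable
      fun q : (metaDoubling K C₀).Seed × (ℕ → Fin K → ℝ) =>
        f ((metaDoubling K C₀).arm q.1 q.2 t) := fun t ht f =>
    (Measurable.of_discrete (f := f)).comp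
      (measurable_metaDoubling_arm C₀ (Finset.mem_Icc.1 ht).1)
  have hint : ∀ t ∈ Finset.Icc 1 T, Integrable
      (fun q => mean ν t ((metaDoubling K C₀).arm q.1 q.2 t)) (doublingLaw C₀ ν) := by
    intro t ht
    refine Integrable.of_bound (hmeas t ht (mean ν t)).aestronglyMeasurable 1
      (Filter.Eventually.of_forall fun q => ?_)
    rw [Real.norm_eq_abs, abs_of_nonneg (hμ _ _).1]
    exact (hμ _ _).2
  have hgap : dynamicRegret (metaDoubling K C₀) ν T = ∑ t ∈ Finset.Icc 1 T,
      ∫ q, gap (mean ν) t ((metaDoubling K C₀).arm q.1 q.2 t) ∂doublingLaw C₀ ν := by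
    unfold dynamicRegret
    change _ - ∫ q, _ ∂doublingLaw C₀ ν = _
    rw [integral_finsetSum _ hint, ← Finset.sum_sub_distrib]
    refine Finset.sum_congr rfl fun t ht => ?_
    simp only [gap_eq]
    rw [integral_sub (integrable_const _) (hint t ht)]
    simp
  rw [hgap, ENNReal.ofReal_sum_of_nonneg fun t _ => integral_nonneg fun q => gap_nonneg _ _]
  refine Finset.sum_congr rfl fun t ht => ?_
  refine ofReal_integral_eq_lintegral_ofReal ?_
    (Filter.Eventually.of_forall fun q => gap_nonneg _ _)
  refine Integrable.of_bound (hmeas t ht (gap (mean ν) t)).aestronglyMeasurable 1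
    (Filter.Eventually.of_forall fun q => ?_)
  rw [Real.norm_eq_abs, abs_of_nonneg (gap_nonneg _ _)]
  exact gap_le_one hμ _ _

/-- The regret of the doubling-horizon version of META in one block. -/
lemma sum_lintegral_gap_block_le (hC : 100 ≤ C₀)
    (hν : ∀ t, ∀ᵐ y ∂(ν t), ∀ a, y a ∈ Set.Icc (0 : ℝ) 1) {T n : ℕ} (hn : 2 ^ n ≤ T) :
    ∑ t ∈ (Finset.Icc 1 T).filter (fun t => Nat.log 2 t = n),
      ∫⁻ q, ENNReal.ofReal (gap (mean ν) t ((metaDoubling K C₀).arm q.1 q.2 t)) ∂doublingLaw C₀ ν ≤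
    ENNReal.ofReal (regretConst C₀ * (1 + Real.log T) ^ 5 * phaseSum (mean ν) T) := by
  classical
  have hpos := Nat.two_pow_pos n
  set c := 2 ^ n - 1 with hc
  -- The last block may be cut off by `T`.
  set N := min (2 ^ n) (T - c) with hN
  have hN₁ : N ≤ 2 ^ n := min_le_left _ _
  have hN₂ : c + N ≤ T := by have := min_le_right (2 ^ n) (T - c); omega
  obtain ⟨safe, hsafe⟩ := exists_safePhases (μ := mean ν) (T := T)
  have hsafe' := safePhases_shift hsafe hN₂
  have hrounds : (Finset.Icc 1 T).filter (fun t => Nat.log 2 t = n) =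
      (Finset.Icc 1 N).image fun s => c + s := by
    ext t
    rw [Finset.image_add_left_Icc, Finset.mem_filter, Finset.mem_Icc, Finset.mem_Icc]
    constructor
    · rintro ⟨h₁, rfl⟩
      obtain ⟨s, h₂, h₃, h₄⟩ := exists_block h₁.1
      have h₅ : s ≤ N := le_min h₃ (by omega)
      omega
    · rintro ⟨h₁, h₂⟩
      refine ⟨by omega, ?_⟩
      rw [Nat.log_eq_iff (Or.inr ⟨by norm_num, by omega⟩), pow_succ]
      omega
  rw [hrounds, Finset.sum_image fun x _ y _ hxy => Nat.add_left_cancel hxy]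
  have hterm : ∀ s ∈ Finset.Icc 1 N, ∫⁻ q, ENNReal.ofReal (gap (mean ν) (c + s)
      ((metaDoubling K C₀).arm q.1 q.2 (c + s))) ∂doublingLaw C₀ ν =
      ∫⁻ p, ENNReal.ofReal (gap (mean fun r => ν (c + r)) s (runArm C₀ (2 ^ n) p.1 p.2 s))
        ∂outcomeLaw fun r => ν (c + r) := by
    intro s hs
    rw [Finset.mem_Icc] at hs
    have h := measurePreserving_blockOutcome C₀ ν n
    rw [← hc] at h
    rw [← h.map_eq, lintegral_map _ h.measurable]
    · refine lintegral_congr fun q => ?_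
      rw [hc, metaDoubling_arm C₀ hs.1 (hs.2.trans hN₁)]
      rfl
    · exact (Measurable.of_discrete (f := fun a : Fin K => ENNReal.ofReal
        (gap (mean fun r => ν (c + r)) s a))).comp (measurable_runArm s hs.1 (hs.2.trans hN₁))
  rw [Finset.sum_congr rfl hterm]
  refine (sum_lintegral_gap_le (fun r => ν (c + r)) (fun t => hν (c + t)) hC hN₁ hsafe').trans
    (ENNReal.ofReal_le_ofReal ?_)
  have hconst : 0 ≤ regretConst C₀ := by unfold regretConst; positivity
  have hlog : Real.log ((2 ^ n : ℕ) : ℝ) ≤ Real.log T :=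
    Real.log_le_log (by exact_mod_cast hpos) (by exact_mod_cast hn)
  have hlog0 : 0 ≤ Real.log ((2 ^ n : ℕ) : ℝ) := Real.log_natCast_nonneg _
  have hS : ∑ i ∈ (Finset.Icc 1 N).image (fun t => phase (mean ν) T (c + t)),
      √((K : ℝ) * ((Finset.Icc 1 N).filter fun t => phase (mean ν) T (c + t) = i).card) ≤
      phaseSum (mean ν) T := by
    unfold phaseSum
    refine (Finset.sum_le_sum fun i _ => Real.sqrt_le_sqrt (mul_le_mul_of_nonneg_left
      (Nat.cast_le.2 ?_) (Nat.cast_nonneg K))).trans (Finset.sum_le_sum_of_subset_of_nonneg ?_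
        fun i _ _ => Real.sqrt_nonneg _)
    · refine Finset.card_le_card_of_injOn (fun s => c + s) (fun s hs => ?_)
        fun x _ y _ hxy => Nat.add_left_cancel hxy
      simp only [Finset.coe_filter, Finset.mem_Icc, Set.mem_ofPred_eq] at hs ⊢
      exact ⟨by omega, hs.2⟩
    · intro i hi
      rw [Finset.mem_image] at hi
      obtain ⟨s, hs, rfl⟩ := hi
      rw [Finset.mem_Icc] at hs
      exact Finset.mem_range.2 (Nat.lt_succ_of_le (phase_mono (by omega)))
  refine mul_le_mul (mul_le_mul_of_nonneg_left (by gcongr) hconst) hS ?_ (by positivity)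
  exact Finset.sum_nonneg fun i _ => Real.sqrt_nonneg _

/-- The regret of the doubling-horizon version of META in terms of the lengths of the phases. -/
lemma dynamicRegret_le (hC : 100 ≤ C₀)
    (hν : ∀ t, ∀ᵐ y ∂(ν t), ∀ a, y a ∈ Set.Icc (0 : ℝ) 1) {T : ℕ} (hT : 1 ≤ T) :
    dynamicRegret (metaDoubling K C₀) ν T ≤
      3 * regretConst C₀ * (1 + Real.log T) ^ 6 * phaseSum (mean ν) T := by
  have hlog : 0 ≤ Real.log T := Real.log_natCast_nonneg T
  have hconst : 0 ≤ regretConst C₀ := by unfold regretConst; positivity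
  have hS : 0 ≤ phaseSum (mean ν) T := Finset.sum_nonneg fun i _ => Real.sqrt_nonneg _
  rw [← ENNReal.ofReal_le_ofReal_iff (by positivity), ofReal_dynamicRegret C₀ ν hν,
    ← Finset.sum_fiberwise_of_maps_to (t := Finset.range (Nat.log 2 T + 1)) (g := Nat.log 2)
      fun t ht => Finset.mem_range.2 (Nat.lt_succ_of_le
        (Nat.log_mono_right (Finset.mem_Icc.1 ht).2))]
  refine (Finset.sum_le_card_nsmul _ _ _ fun n hn => sum_lintegral_gap_block_le C₀ ν hC hν
    (Nat.pow_le_of_le_log (by omega) (Nat.lt_succ_iff.1 (Finset.mem_range.1 hn)))).trans ?_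
  rw [Finset.card_range, nsmul_eq_mul, ← ENNReal.ofReal_natCast,
    ← ENNReal.ofReal_mul (Nat.cast_nonneg _)]
  refine ENNReal.ofReal_le_ofReal ?_
  have hblocks : ((Nat.log 2 T + 1 : ℕ) : ℝ) ≤ 3 * (1 + Real.log T) := by
    have h₁ := Real.natLog_le_logb T 2
    rw [Real.logb, le_div_iff₀ (Real.log_pos (by norm_num))] at h₁
    have h₂ := Real.log_two_gt_d9
    have h₃ : (0 : ℝ) ≤ Nat.log 2 T := Nat.cast_nonneg _
    push_cast at h₁ ⊢
    nlinarith
  calc _ ≤ 3 * (1 + Real.log T) *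
        (regretConst C₀ * (1 + Real.log T) ^ 5 * phaseSum (mean ν) T) := by gcongr
    _ = _ := by ring

end regret

end Bandit

end

theorem proposition2 :
    ∃ (c : ℝ) (p : ℕ), 0 < c ∧ ∀ C₀ : ℝ, c ≤ C₀ → ∃ C : ℝ, 0 < C ∧
      ∀ (K : ℕ) [NeZero K] (ν : ℕ → MeasureTheory.Measure (Fin K → ℝ))
        [∀ t, MeasureTheory.IsProbabilityMeasure (ν t)],
        (∀ t, ∀ᵐ y ∂(ν t), ∀ a, y a ∈ Set.Icc (0 : ℝ) 1) →
        ∀ T : ℕ, 1 ≤ T →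
          Bandit.dynamicRegret (Bandit.metaDoubling K C₀) ν T ≤
            C * (1 + Real.log T) ^ p *
              min (√(((Bandit.numShifts (Bandit.mean ν) T : ℝ) + 1) * K * T))
                (√((K : ℝ) * T) +
                  ((K : ℝ) * Bandit.totalVariation (Bandit.mean ν) T) ^ (1 / 3 : ℝ) *
                    (T : ℝ) ^ (2 / 3 : ℝ)) := by
  -- `100` makes the threshold for evictions exceed the errors of the estimates.  META with a given
  -- horizon loses five logarithms, the number of blocks one more.
  refine ⟨100, 6, by norm_num, fun C₀ hC => ⟨6 * Bandit.regretConst C₀, ?_, ?_⟩⟩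
  · unfold Bandit.regretConst
    positivity
  intro K _ ν _ hν T hT
  have hlog : 0 ≤ Real.log T := Real.log_natCast_nonneg T
  have hconst : 0 ≤ Bandit.regretConst C₀ := by unfold Bandit.regretConst; positivity
  have hphase : Bandit.phaseSum (Bandit.mean ν) T ≤
      2 * min (√(((Bandit.numShifts (Bandit.mean ν) T : ℝ) + 1) * K * T))
        (√((K : ℝ) * T) + ((K : ℝ) * Bandit.totalVariation (Bandit.mean ν) T) ^ (1 / 3 : ℝ) *
          (T : ℝ) ^ (2 / 3 : ℝ)) := by
    rw [mul_min_of_nonneg _ _ zero_le_two]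
    refine le_min ((Bandit.phaseSum_le_sqrt hT).trans ?_)
      ((Bandit.phaseSum_le_totalVariation hT).trans ?_)
    · linarith [Real.sqrt_nonneg (((Bandit.numShifts (Bandit.mean ν) T : ℝ) + 1) * K * T)]
    · linarith [Real.sqrt_nonneg ((K : ℝ) * T)]
  refine (Bandit.dynamicRegret_le C₀ ν hC hν hT).trans
    ((mul_le_mul_of_nonneg_left hphase (by positivity)).trans (le_of_eq ?_))
  ring
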